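/- **Setting.** Let $U=\{0,\dots,u-1\}$ and $R=\{0,\dots,r-1\}$ with $1<r\le u$, $\log=\log_2$. Functions are evaluated with words of $\kappa\lceil\log u\rceil$ bits, $\kappa\ge 1$ an absolute constant; a key is one word, and the evaluation time is the number of elementary word operations (constants, $+,-,\cdot$, integer division and remainder, bitwise operations, shifts, comparison, reading one memory word). A data structure draws its random choices uniformly from a finite set, and from them fills a memory; it represents the function $h\colon U\to R$ that a fixed program, not depending on the random choices, computes from the memory. Its size is the number of memory bits plus the number of bits of all constants in the program. A hash class is a finite family of functions from which one is drawn uniformly by its index. A class of functions $N\text{-set}\to\{0,\dots,m-1\}$ is *2-universal* if any two distinct keys collide with probability at most $2/m$, and *2-wise independent* if the values of any two distinct keys are uniform on pairs. Given a 2-wise independent class $\mathcal H$ with range $\{0,\dots,m-1\}$ and a 2-universal class $\mathcal F$ with range $\{0,\dots,\ell-1\}$, a random pair $(h_1,h_2)$ from $\mathcal Z^{c,2}_{\ell,m}$ is $h_i(x)=\bigl(f_i(x)+\sum_{j=1}^{c} z^{(i)}[j,g_j(x)]\bigr)\bmod m$, where $f_1,f_2\in\mathcal H$, $g_1,\dots,g_c\in\mathcal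 F$ and all table entries $z^{(i)}[j,k]\in\{0,\dots,m-1\}$ are chosen independently and uniformly at random. **Theorem.** There are absolute constants $\kappa\ge1$ and $C$ such that for all real $0<\delta<1$, $\varepsilon>0$, $s\ge0$ there are a constant $D$, a function $g(n)=o(n)$ and a number $n_0$ (depending only on $\delta,\varepsilon,s$) such that for all integers $n\ge1$ and $1<r\le u$ there is a data structure $\mathrm{DS}_n$ representing a random function $h\colon U\to R$ with: 1. For each $S\subseteq U$ of size $n$ there is an event $B_S$ of probability at most $D/n^{s+1}$ such that, conditioned on $\overline{B_S}$, the restriction of $h$ to $S$ is uniform among all functions $S\to R$. 2. For every $x\in U$, $h(x)$ is evaluated in time at most $C\max\{s,1\}/\delta$. 3. $\mathrm{DS}_n$ comprises at most $2(1+\varepsilon)n\log|R|+g(n)+D\log\log|U|$ bits. 4. If $n_0\le n\le u$, then $\mathrm{DS}_n$ is built from $\mathcal Z$ and random tables: there are integers $c\ge(s+2)/\delta$, $\ell=\lceil n^\delta\rceil$, $m\le(1+\varepsilon)n$, $N\le D n^{s+3}$, classes $\mathcal H$ (2-wise independent) and $\mathcal F$ (2-universal) as above on $\{0,\dots,N-1\}$,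 a 2-wise independent class $\mathcal K$ from $\{0,\dots,N-1\}$ to $R$, and a class $\mathcal C$ of functions $U\to\{0,\dots,N-1\}$ under which any two distinct keys collide with probability at most $D/n^{s+3}$, such that $$h(x)=\Bigl(t_1[h_1(x')]+t_2[h_2(x')]+f(x')+\sum_{j=1}^{c}y_j[g_j(x')]\Bigr)\bmod r,\qquad x'=q(x),$$ with $q\in\mathcal C$, $(h_1,h_2)\in\mathcal Z^{c,2}_{\ell,m}$ (with components $g_1,\dots,g_c$), $t_1,t_2\in R^m$, $y_1,\dots,y_c\in R^\ell$ and $f\in\mathcal K$ chosen independently and uniformly at random. -/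

import Mathlib

open scoped Asymptotics

namespace UniformHashing

/-! ### Word programs

A key is a number below `|U|`, and a word consists of `w` bits. A program is a sequence of
elementary word operations. Each operation is executed exactly once, takes one time step, and
writes its result to a fresh register, so the running time is the number of instructions.
Register `0` holds the key at the start. -/

/-- Binary word operations. -/
inductive WordOp
  | add | sub | mul | div | mod | and | or | xor | shl | shr | lt

/-- The value of an operation on words, before truncation to `w` bits. -/
def WordOp.eval (w : ℕ) : WordOp → ℕ → ℕ → ℕ
  | .add, a, b => a + b
  | .sub, a, b => a + 2 ^ w - b
  | .mul, a, b => a * b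
  | .div, a, b => a / b
  | .mod, a, b => a % b
  | .and, a, b => a &&& b
  | .or, a, b => a ||| b
  | .xor, a, b => a ^^^ b
  | .shl, a, b => a * 2 ^ b
  | .shr, a, b => a / 2 ^ b
  | .lt, a, b => if a < b then 1 else 0

/-- Instructions: a constant, a read from the memory word whose address is in register `i`,
or a binary operation on the registers `i` and `j`. -/
inductive Instr
  | const (a : ℕ)
  | load (i : ℕ)
  | op (o : WordOp) (i j : ℕ)

/-- The `k`-th bit of a memory of `b` bits; positions outside the memory read as `0`. -/
def memBit {b : ℕ} (mem : Fin b → Bool) (k : ℕ) : ℕ :=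
  if h : k < b then (mem ⟨k, h⟩).toNat else 0

/-- The `a`-th `w`-bit word of the memory. -/
def memWord (w : ℕ) {b : ℕ} (mem : Fin b → Bool) (a : ℕ) : ℕ :=
  ∑ t ∈ Finset.range w, memBit mem (a * w + t) * 2 ^ t

/-- The word computed by one instruction from the current registers. -/
def Instr.eval (w : ℕ) {b : ℕ} (mem : Fin b → Bool) (regs : List ℕ) : Instr → ℕ
  | .const a => a % 2 ^ w
  | .load i => memWord w mem (regs.getD i 0)
  | .op o i j => o.eval w (regs.getD i 0) (regs.getD j 0) % 2 ^ w

/-- The registers after executing a program, oldest first. -/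
def runRegs (w : ℕ) {b : ℕ} (mem : Fin b → Bool) (prog : List Instr) (x : ℕ) : List ℕ :=
  prog.foldl (fun regs ins => regs ++ [ins.eval w mem regs]) [x]

/-- The output is the content of the last register. -/
def run (w : ℕ) {b : ℕ} (mem : Fin b → Bool) (prog : List Instr) (x : ℕ) : ℕ :=
  (runRegs w mem prog x).getLastD 0

/-- The number of bits of the constant occurring in an instruction. -/
def Instr.constBits : Instr → ℕ
  | .const a => a.size
  | _ => 0

/-! ### Data structures representing a random hash function -/

/-- A data structure for a function from `{0, …, u-1}` to `{0, …, r-1}` over words of `w` bits.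
The set-up draws `ω` uniformly from the finite set `Ω` and fills a memory of `memBits` bits;
`prog`, which does not depend on `ω`, then computes the represented function `h ω`. -/
structure HashDS (u r w : ℕ) where
  Ω : Type
  [fintypeΩ : Fintype Ω]
  [decEqΩ : DecidableEq Ω]
  [nonemptyΩ : Nonempty Ω]
  memBits : ℕ
  mem : Ω → Fin memBits → Bool
  prog : List Instr
  h : Ω → Fin u → Fin r
  run_eq : ∀ (ω : Ω) (x : Fin u), run w (mem ω) prog (x : ℕ) = (h ω x : ℕ)

attribute [instance] HashDS.fintypeΩ HashDS.decEqΩ HashDS.nonemptyΩ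

/-- The evaluation time, the same for every key: the number of executed word operations. -/
def HashDS.time {u r w : ℕ} (ds : HashDS u r w) : ℕ := ds.prog.length

/-- The space in bits: the memory and all constants used by the evaluation procedure. -/
def HashDS.space {u r w : ℕ} (ds : HashDS u r w) : ℕ :=
  ds.memBits + (ds.prog.map Instr.constBits).sum

/-- Probability of an event under the uniform distribution on a finite set. -/
noncomputable def prob {Ω : Type} [Fintype Ω] (A : Finset Ω) : ℝ :=
  (A.card : ℝ) / Fintype.card Ω

/-- Conditioned on the complement of `B`, the restriction of `h` to `S` is uniform among all
functions from `S` to the range: `Pr(h|S = v|S and not B) = Pr(not B) / r ^ |S|`. -/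
def UniformOnOutside {Ω : Type} [Fintype Ω] [DecidableEq Ω] {u r : ℕ}
    (h : Ω → Fin u → Fin r) (S : Finset (Fin u)) (B : Finset Ω) : Prop :=
  ∀ v : Fin u → Fin r,
    prob (Finset.univ.filter fun ω => ω ∉ B ∧ ∀ x ∈ S, h ω x = v x)
      = prob Bᶜ / (r : ℝ) ^ S.card

/-! ### Hash classes

A hash class is a finite family of functions, from which a member is drawn by choosing its index
uniformly at random. -/

/-- `c`-universal: two distinct keys collide with probability at most `c / m`. -/
def IsUniversal (c : ℝ) {k N m : ℕ} (F : Fin k → Fin N → Fin m) : Prop :=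
  ∀ x y : Fin N, x ≠ y →
    prob (Finset.univ.filter fun i => F i x = F i y) ≤ c / m

/-- Two-wise independent. -/
def IsTwoIndependent {k N m : ℕ} (H : Fin k → Fin N → Fin m) : Prop :=
  ∀ x y : Fin N, x ≠ y → ∀ a b : Fin m,
    prob (Finset.univ.filter fun i => H i x = a ∧ H i y = b) = 1 / (m : ℝ) ^ 2

/-- The random choices behind a member of the class `𝒵^{c,d}_{ℓ,m}`: (indices of) the functions
`f₁, …, f_d` and `g₁, …, g_c`, and the tables `z⁽¹⁾, …, z⁽ᵈ⁾`. -/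
abbrev ZSeed (kH kF d c l m : ℕ) : Type :=
  (Fin d → Fin kH) × (Fin c → Fin kF) × (Fin d → Fin c → Fin l → Fin m)

/-- `h_i(x) = (f_i(x) + ∑_j z⁽ⁱ⁾[j, g_j(x)]) mod m`. -/
def zHash {kH kF d c l m N : ℕ} (H : Fin kH → Fin N → Fin m) (F : Fin kF → Fin N → Fin l)
    (ζ : ZSeed kH kF d c l m) (i : Fin d) (x : Fin N) : Fin m :=
  ⟨((H (ζ.1 i) x : ℕ) + ∑ j : Fin c, (ζ.2.2 i j (F (ζ.2.1 j) x) : ℕ)) % m,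
    Nat.mod_lt _ (H (ζ.1 i) x).pos⟩

/-- The random choices of the data structure: the function collapsing the universe, the pair
`(h₁, h₂)` from `𝒵`, the tables `t₁, t₂ ∈ R^m`, the tables `y₁, …, y_c ∈ R^ℓ`, and `f`. -/
abbrev DSSeed (kC kH kF kK c l m r : ℕ) : Type :=
  Fin kC × ZSeed kH kF 2 c l m × (Fin 2 → Fin m → Fin r) × (Fin c → Fin l → Fin r) × Fin kK

/-- `t₁[h₁(x')] ⊕ t₂[h₂(x')] ⊕ f(x') ⊕ y₁[g₁(x')] ⊕ … ⊕ y_c[g_c(x')]`, where `x'` is the image of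
`x` in the collapsed universe and `⊕` is addition modulo `r`. -/
def dsHash {kC kH kF kK c l m r u N : ℕ} (col : Fin kC → Fin u → Fin N)
    (H : Fin kH → Fin N → Fin m) (F : Fin kF → Fin N → Fin l) (K : Fin kK → Fin N → Fin r)
    (σ : DSSeed kC kH kF kK c l m r) (x : Fin u) : ℕ :=
  let x' := col σ.1 x
  let ζ := σ.2.1
  ((σ.2.2.1 0 (zHash H F ζ 0 x') : ℕ) + (σ.2.2.1 1 (zHash H F ζ 1 x') : ℕ)
    + (K σ.2.2.2.2 x' : ℕ) + ∑ j : Fin c, (σ.2.2.2.1 j (F (ζ.2.1 j) x') : ℕ)) % r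

/-- The random function represented by `ds` arises from a random pair `(h₁, h₂)` of the class
`𝒵^{c,2}_{ℓ,m}` and random tables, with `c ≥ (s+2)/δ`, `ℓ = ⌈n^δ⌉` and `m ≤ (1+ε)n`, after the
universe has been collapsed to size `O(n^{s+3})`. The map `π` reads off the random choices, and
having fibres of equal size it makes them uniformly distributed. -/
def BuiltFromZ {u r w : ℕ} (ds : HashDS u r w) (n : ℕ) (δ ε s D : ℝ) : Prop :=
  ∃ (N c l m kC kH kF kK : ℕ) (col : Fin kC → Fin u → Fin N)
    (H : Fin kH → Fin N → Fin m) (F : Fin kF → Fin N → Fin l) (K : Fin kK → Fin N → Fin r),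
    (s + 2) / δ ≤ c ∧ l = ⌈(n : ℝ) ^ δ⌉₊ ∧ (m : ℝ) ≤ (1 + ε) * n ∧
    (N : ℝ) ≤ D * (n : ℝ) ^ (s + 3) ∧
    (∀ x y : Fin u, x ≠ y →
      prob (Finset.univ.filter fun i => col i x = col i y) ≤ D / (n : ℝ) ^ (s + 3)) ∧
    IsTwoIndependent H ∧ IsUniversal 2 F ∧ IsTwoIndependent K ∧
    ∃ π : ds.Ω → DSSeed kC kH kF kK c l m r,
      (∀ σ, prob (Finset.univ.filter fun ω => π ω = σ)
        = 1 / (Fintype.card (DSSeed kC kH kF kK c l m r) : ℝ)) ∧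
      ∀ ω x, (ds.h ω x : ℕ) = dsHash col H F K (π ω) x

end UniformHashing

/-!
The values of `h` on `S` depend additively on the tables, so they are uniform as soon as some choice
of the tables produces every function on `S`. The hash values `h₁`, `h₂` turn the keys of `S` into
the edges of a bipartite multigraph on `2 m` vertices. A key with an endpoint of its own can be
given any value, because its table entry is read by no other key. Peeling off such keys leaves a set
in which every endpoint is shared; if some `g_j` is injective there, the table `y_j` does the rest.

Hence only seeds for which no `g_j` is injective on the leafless part are bad. Then the multigraph
contains a short description of the failure: a walk with at most `2 c` jumps, on which some `g_j`
is injective up to the last key. Injectivity of `g_j` makes the hash values along the walk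
uniform, so the expected number of such walks with `t` edges is `m ^ 2 * (|S| / m) ^ t` up to a
polynomial factor in `t`. With `|S| ≤ ρ m`, `ρ < 1`, and universality of the `c` functions `g_j`,
summing over `t` gives `(2 / l) ^ c * m ^ 2 * ∑ t, t ^ (6 c) ρ ^ t = O(n ^ (2 - δ c))`.

The universe is first collapsed to a size polynomial in `n` by reducing modulo a random prime and
multiplicative hashing. Packing several entries of `t₁` and `t₂` as base-`r` digits into one block
makes the rounding of bit lengths cost only a factor `1 + ε / 10` of space.
-/

namespace UniformHashing

/-! ### Uniform probability on finite types -/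

section Probability

variable {Ω Ω' : Type} [Fintype Ω] [Fintype Ω']

lemma prob_nonneg (A : Finset Ω) : 0 ≤ prob A := by
  unfold prob
  positivity

lemma prob_le_one (A : Finset Ω) : prob A ≤ 1 :=
  div_le_one_of_le₀ (by exact_mod_cast A.card_le_univ) (by positivity)

lemma prob_mono {A B : Finset Ω} (h : A ⊆ B) : prob A ≤ prob B := by
  unfold prob
  gcongr

lemma prob_filter_mono {P Q : Ω → Prop} [DecidablePred P] [DecidablePred Q]
    (h : ∀ ω, P ω → Q ω) : prob {ω | P ω} ≤ prob {ω | Q ω} :=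
  prob_mono (Finset.monotone_filter_right _ fun ω _ => h ω)

lemma prob_union_le [DecidableEq Ω] (A B : Finset Ω) : prob (A ∪ B) ≤ prob A + prob B := by
  unfold prob
  rw [← add_div]
  gcongr
  exact_mod_cast Finset.card_union_le A B

lemma prob_filter_or_le (P Q : Ω → Prop) [DecidablePred P] [DecidablePred Q] :
    prob {ω | P ω ∨ Q ω} ≤ prob {ω | P ω} + prob {ω | Q ω} := by
  classical
  rw [Finset.filter_or]
  exact prob_union_le _ _

lemma prob_biUnion_le [DecidableEq Ω] {ι : Type*} (s : Finset ι) (A : ι → Finset Ω) :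
    prob (s.biUnion A) ≤ ∑ i ∈ s, prob (A i) := by
  unfold prob
  rw [← Finset.sum_div]
  gcongr
  exact_mod_cast Finset.card_biUnion_le

lemma prob_pi_forall {ι : Type} [Fintype ι] [DecidableEq ι] (P : Ω → Prop) [DecidablePred P]
    [DecidablePred fun f : ι → Ω => ∀ i, P (f i)] :
    prob {f : ι → Ω | ∀ i, P (f i)} = prob {ω | P ω} ^ Fintype.card ι := by
  have h : ({f : ι → Ω | ∀ i, P (f i)} : Finset (ι → Ω))
      = Fintype.piFinset fun _ => ({ω | P ω} : Finset Ω) := by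
    ext f
    simp
  simp [h, prob, div_pow]

lemma prob_prod_eq_sum (P : Ω → Ω' → Prop) [∀ a, DecidablePred (P a)]
    [DecidablePred fun p : Ω × Ω' => P p.1 p.2] :
    prob {p : Ω × Ω' | P p.1 p.2} = (∑ a, prob {b | P a b}) / Fintype.card Ω := by
  have h : ({p : Ω × Ω' | P p.1 p.2} : Finset (Ω × Ω')).card
      = ∑ a, ({b | P a b} : Finset Ω').card := by
    simp only [Finset.card_filter, Fintype.sum_prod_type]
    congr!
  unfold prob
  rw [h, ← Finset.sum_div, Fintype.card_prod, div_div]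
  push_cast
  rw [mul_comm]

lemma prob_prod_le {P : Ω → Ω' → Prop} [∀ a, DecidablePred (P a)]
    [DecidablePred fun p : Ω × Ω' => P p.1 p.2] {ε : ℝ} (hε : 0 ≤ ε)
    (h : ∀ a, prob {b | P a b} ≤ ε) : prob {p : Ω × Ω' | P p.1 p.2} ≤ ε := by
  rw [prob_prod_eq_sum]
  refine div_le_of_le_mul₀ (by positivity) hε
    ((Finset.sum_le_sum fun a _ => h a).trans_eq ?_)
  simp [mul_comm]

lemma prob_and_le_mul {P : Ω → Prop} {Q : Ω → Ω' → Prop} [DecidablePred P]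
    [∀ a, DecidablePred (Q a)] [DecidablePred fun p : Ω × Ω' => P p.1 ∧ Q p.1 p.2] {ε : ℝ}
    (h : ∀ a, P a → prob {b | Q a b} ≤ ε) :
    prob {p : Ω × Ω' | P p.1 ∧ Q p.1 p.2} ≤ prob {a | P a} * ε := by
  rw [prob_prod_eq_sum fun a b => P a ∧ Q a b, prob, div_mul_eq_mul_div]
  gcongr
  rw [← nsmul_eq_mul, ← Finset.sum_const, Finset.sum_filter]
  refine Finset.sum_le_sum fun a _ => ?_
  by_cases ha : P a
  · simpa [ha] using h a ha
  · simp [ha, prob]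

lemma prob_and_eq_mul {P : Ω → Prop} {Q : Ω → Ω' → Prop} [DecidablePred P]
    [∀ a, DecidablePred (Q a)] [DecidablePred fun p : Ω × Ω' => P p.1 ∧ Q p.1 p.2] {ε : ℝ}
    (h : ∀ a, P a → prob {b | Q a b} = ε) :
    prob {p : Ω × Ω' | P p.1 ∧ Q p.1 p.2} = prob {a | P a} * ε := by
  rw [prob_prod_eq_sum fun a b => P a ∧ Q a b, prob, div_mul_eq_mul_div]
  congr 1
  rw [← nsmul_eq_mul, ← Finset.sum_const, Finset.sum_filter]
  refine Finset.sum_congr rfl fun a _ => ?_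
  by_cases ha : P a
  · simpa [ha] using h a ha
  · simp [ha, prob]

lemma prob_filter_fst_le (P : Ω → Prop) [DecidablePred P] :
    prob {p : Ω × Ω' | P p.1} ≤ prob {a | P a} := by
  have h := prob_and_le_mul (Ω' := Ω') (P := P) (Q := fun _ _ => True) fun _ _ => prob_le_one _
  simpa using h

lemma prob_not_injOn_le {α β : Type} [DecidableEq β] (X : Ω → α → β) (S : Finset α) {η : ℝ}
    (hη₀ : 0 ≤ η) (hη : ∀ x y, x ≠ y → prob {ω | X ω x = X ω y} ≤ η)
    [DecidablePred fun ω => ¬ Set.InjOn (X ω) S] :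
    prob {ω | ¬ Set.InjOn (X ω) S} ≤ S.card ^ 2 * η := by
  classical
  have hsub : ({ω | ¬ Set.InjOn (X ω) S} : Finset Ω)
      ⊆ S.offDiag.biUnion fun p => {ω | X ω p.1 = X ω p.2} := by
    intro ω hω
    simp only [Finset.mem_filter_univ, Set.InjOn, SetLike.mem_coe] at hω
    push Not at hω
    obtain ⟨x, hx, y, hy, hxy, hne⟩ := hω
    simpa using ⟨x, y, ⟨hx, hy, hne⟩, hxy⟩
  calc prob {ω | ¬ Set.InjOn (X ω) S}
      ≤ ∑ p ∈ S.offDiag, prob {ω | X ω p.1 = X ω p.2} :=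
      (prob_mono hsub).trans (prob_biUnion_le _ _)
    _ ≤ ∑ _p ∈ S.offDiag, η :=
      Finset.sum_le_sum fun p hp => hη _ _ (Finset.mem_offDiag.1 hp).2.2
    _ = S.offDiag.card * η := by rw [Finset.sum_const, nsmul_eq_mul]
    _ ≤ S.card ^ 2 * η := by
      gcongr
      rw [Finset.offDiag_card, pow_two]
      exact_mod_cast Nat.sub_le _ _

/-- The random variable `X` is uniformly distributed on `A`. -/
def IsUniform {A : Type} [Fintype A] [DecidableEq A] (X : Ω → A) : Prop :=
  ∀ a, prob {ω | X ω = a} = 1 / (Fintype.card A : ℝ)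

section IsUniform

variable {A : Type} [Fintype A] [DecidableEq A]

lemma IsUniform.prob_filter {X : Ω → A} (hX : IsUniform X) (P : A → Prop) [DecidablePred P] :
    prob {ω | P (X ω)} = prob {a | P a} := by
  have hcard : ({ω | P (X ω)} : Finset Ω).card
      = ∑ a with P a, ({ω | X ω = a} : Finset Ω).card := by
    rw [Finset.card_eq_sum_card_fiberwise (f := X) (t := {a | P a}) (by simp [Set.MapsTo])]
    refine Finset.sum_congr rfl fun a ha => congrArg Finset.card ?_
    ext ω
    simp only [Finset.mem_filter, Finset.mem_univ, true_and] at ha ⊢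
    exact and_iff_right_of_imp fun h => by rwa [h]
  have hfibre : ∀ a, (({ω | X ω = a} : Finset Ω).card : ℝ) / Fintype.card Ω
      = 1 / Fintype.card A := hX
  rw [prob, hcard, Nat.cast_sum, Finset.sum_div, Finset.sum_congr rfl fun a _ => hfibre a,
    Finset.sum_const, nsmul_eq_mul, mul_one_div, prob]

lemma IsUniform.of_equiv (e : Ω ≃ A) : IsUniform e := by
  intro a
  have h : ({ω | e ω = a} : Finset Ω) = {e.symm a} := by
    ext ω
    simp [Equiv.eq_symm_apply]
  rw [h, prob, Finset.card_singleton, Fintype.card_congr e, Nat.cast_one]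

lemma IsUniform.comp {Y : Ω' → A} {X : Ω → Ω'} [DecidableEq Ω'] (hY : IsUniform Y)
    (hX : IsUniform X) : IsUniform fun ω => Y (X ω) :=
  fun a => (hX.prob_filter fun ω => Y ω = a).trans (hY a)

lemma IsUniform.prod_snd [Nonempty Ω] {X : Ω → Ω' → A} (hX : ∀ ω, IsUniform (X ω)) :
    IsUniform fun p : Ω × Ω' => X p.1 p.2 := by
  intro a
  rw [prob_prod_eq_sum fun ω ω' => X ω ω' = a, Finset.sum_congr rfl fun ω _ => hX ω a,
    Finset.sum_const, Finset.card_univ, nsmul_eq_mul, mul_div_cancel_left₀]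
  exact_mod_cast Fintype.card_ne_zero

/-- All fibres of a surjective homomorphism have the same size. -/
lemma IsUniform.const_add_hom {G A : Type} [AddCommGroup G] [AddCommGroup A] [Fintype G]
    [Fintype A] [DecidableEq A] (φ : G →+ A) (hφ : Function.Surjective φ) (a₀ : A) :
    IsUniform fun g => a₀ + φ g := by
  have hfib : ∀ a b : A, ({g | φ g = a} : Finset G).card = ({g | φ g = b} : Finset G).card :=
    fun a b => AddMonoidHom.card_fiber_eq_of_mem_range φ (hφ a) (hφ b)
  intro a
  have htotal : Fintype.card G = Fintype.card A * ({g | φ g = a - a₀} : Finset G).card := by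
    have h := Finset.card_eq_sum_card_fiberwise (f := φ) (s := Finset.univ) (t := Finset.univ)
      (by simp [Set.MapsTo])
    rwa [Finset.sum_congr rfl fun b _ => hfib b (a - a₀), Finset.sum_const, Finset.card_univ,
      Finset.card_univ, smul_eq_mul] at h
  have hpos : 0 < Fintype.card G := Fintype.card_pos
  simp only [← eq_sub_iff_add_eq', prob]
  rw [htotal] at hpos ⊢
  have := Nat.pos_of_mul_pos_left hpos
  have := Nat.pos_of_mul_pos_right hpos
  push_cast
  field_simp

end IsUniform

end Probability

/-! ### Multiplicative hashing and tabulation hashing -/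

lemma card_le_two_mul_div_of_dvd {A : Finset ℤ} {n l : ℕ} (hl : 0 < l)
    (hdvd : ∀ a ∈ A, (l : ℤ) ∣ a) (hne : ∀ a ∈ A, a ≠ 0) (hle : ∀ a ∈ A, |a| ≤ n) :
    A.card ≤ 2 * (n / l) := by
  have hsub : A ⊆ ((Finset.Icc (-(n / l : ℕ) : ℤ) (n / l : ℕ)).erase 0).image (l * ·) := by
    intro a ha
    obtain ⟨b, rfl⟩ := hdvd a ha
    have hb : |b| ≤ (n / l : ℕ) := by
      have h := hle _ ha
      rw [abs_mul, Nat.abs_cast] at h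
      rw [Int.natCast_div, Int.le_ediv_iff_mul_le (by exact_mod_cast hl)]
      linarith
    refine Finset.mem_image_of_mem _ (Finset.mem_erase.2 ⟨?_, Finset.mem_Icc.2 (abs_le.1 hb)⟩)
    exact right_ne_zero_of_mul (hne _ ha)
  have hcard := (Finset.card_le_card hsub).trans Finset.card_image_le
  rw [Finset.card_erase_of_mem
    (Finset.mem_Icc.2 ⟨neg_nonpos.2 (Nat.cast_nonneg _), Nat.cast_nonneg _⟩), Int.card_Icc] at hcard
  omega

section MulMod

variable {p x y : ℕ}

lemma natCast_zmod_ne_of_ne (hx : x < p) (hy : y < p) (hxy : x ≠ y) :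
    (x : ZMod p) ≠ y := by
  rwa [Ne, ZMod.natCast_eq_natCast_iff', Nat.mod_eq_of_lt hx, Nat.mod_eq_of_lt hy]

lemma card_mul_mod_collisions_le {l : ℕ} (hp : p.Prime) (hl : 0 < l) (hx : x < p) (hy : y < p)
    (hxy : x ≠ y) :
    ({a : Fin (p - 1) | x * (a + 1) % p % l = y * (a + 1) % p % l} : Finset _).card
      ≤ 2 * ((p - 1) / l) := by
  have := Fact.mk hp
  set d : Fin (p - 1) → ℤ := fun a => (x * (a + 1) % p : ℕ) - (y * (a + 1) % p : ℕ) with hd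
  have hcast : ∀ a, (d a : ZMod p) = (x - y) * (a + 1 : ℕ) := fun a => by
    simp [hd, sub_mul]
  have hsub : (x - y : ZMod p) ≠ 0 := sub_ne_zero.2 (natCast_zmod_ne_of_ne hx hy hxy)
  have hd_injective : Function.Injective d := by
    intro a b hab
    have h := congrArg (Int.cast : ℤ → ZMod p) hab
    rw [hcast, hcast] at h
    by_contra hne
    exact natCast_zmod_ne_of_ne (by omega) (by omega) (by omega) (mul_left_cancel₀ hsub h)
  have hd_ne_zero : ∀ a, d a ≠ 0 := by
    intro a ha
    have h := hcast a
    rw [ha, Int.cast_zero] at h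
    have hsucc := natCast_zmod_ne_of_ne (p := p) (x := a + 1) (y := 0) (by omega) hp.pos
      (by omega)
    exact mul_ne_zero hsub (by rwa [Nat.cast_zero] at hsucc) h.symm
  rw [← Finset.card_image_of_injective _ hd_injective]
  refine card_le_two_mul_div_of_dvd hl ?_ ?_ ?_ <;> rw [Finset.forall_mem_image] <;> intro a ha
  · exact Nat.modEq_iff_dvd.1 (Finset.mem_filter.1 ha).2.symm
  · exact hd_ne_zero a
  · have hxa := Nat.mod_lt (x * (a + 1)) hp.pos
    have hya := Nat.mod_lt (y * (a + 1)) hp.pos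
    rw [abs_le]
    constructor <;> simp only [hd] <;> omega

lemma prob_mul_mod_collision_le {l : ℕ} (hp : p.Prime) (hl : 0 < l) (hx : x < p) (hy : y < p)
    (hxy : x ≠ y) :
    prob {a : Fin (p - 1) | x * (a + 1) % p % l = y * (a + 1) % p % l} ≤ 2 / l := by
  have hp2 := hp.two_le
  have hcard := card_mul_mod_collisions_le hp hl hx hy hxy
  unfold prob
  rw [Fintype.card_fin, div_le_div_iff₀ (by exact_mod_cast (by omega : 0 < p - 1))
    (by exact_mod_cast hl)]
  norm_cast
  nlinarith [Nat.div_mul_le_self (p - 1) l]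

end MulMod

/-- Multiplicative hashing modulo a prime `p`. The multiplier indexed by `a` is `a + 1`, so that
it is nonzero modulo `p`. -/
def mulClass (p l N : ℕ) [NeZero l] (a : Fin (p - 1)) (x : Fin N) : Fin l :=
  Fin.ofNat l (x * (a + 1) % p)

lemma isUniversal_mulClass {p l N : ℕ} [NeZero l] (hp : p.Prime) (hN : N ≤ p) :
    IsUniversal 2 (mulClass p l N) := by
  intro x y hxy
  simpa [mulClass, Fin.ext_iff] using prob_mul_mod_collision_le hp (NeZero.pos l)
    (x.2.trans_le hN) (y.2.trans_le hN) (Fin.val_ne_of_ne hxy)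

/-- The `i`-th digit of `x` in base `l`. -/
def digit (l : ℕ) [NeZero l] (i x : ℕ) : Fin l := Fin.ofNat l (x / l ^ i)

lemma exists_digit_ne {l : ℕ} [NeZero l] {q x y : ℕ} (hx : x < l ^ q) (hy : y < l ^ q)
    (hxy : x ≠ y) : ∃ i : Fin q, digit l i x ≠ digit l i y := by
  by_contra! h
  refine hxy (congrArg Fin.val (finFunctionFinEquiv.symm.injective
    (a₁ := (⟨x, hx⟩ : Fin (l ^ q))) (a₂ := ⟨y, hy⟩) (funext fun i => Fin.ext ?_)))
  exact congrArg Fin.val (h i)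

/-- Simple tabulation hashing: each digit of the key indexes its own table of group elements. -/
def tabulate {l q m : ℕ} [NeZero l] [NeZero m] (θ : Fin q → Fin l → Fin m) (x : ℕ) : Fin m :=
  ∑ i, θ i (digit l i x)

/-- The tables of simple tabulation hashing, numbered by an initial segment of `ℕ`. -/
noncomputable def tabEquiv (q l m : ℕ) :
    Fin (Fintype.card (Fin q → Fin l → Fin m)) ≃ (Fin q → Fin l → Fin m) :=
  (Fintype.equivFin _).symm

/-- The class of all simple tabulation hash functions with `q` tables of size `l`. -/
noncomputable def tabClass (q l m N : ℕ) [NeZero l] [NeZero m]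
    (i : Fin (Fintype.card (Fin q → Fin l → Fin m))) (x : Fin N) : Fin m :=
  tabulate (tabEquiv q l m i) x

lemma isTwoIndependent_iff {k N m : ℕ} {H : Fin k → Fin N → Fin m} :
    IsTwoIndependent H ↔ ∀ x y, x ≠ y → IsUniform fun i => (H i x, H i y) := by
  simp only [IsTwoIndependent, IsUniform, Prod.forall, Prod.mk.injEq, Fintype.card_prod,
    Fintype.card_fin, Nat.cast_mul, pow_two]

lemma surjective_tabulate_prod {l q m : ℕ} [NeZero l] [NeZero m] {x y : ℕ} {i : Fin q}
    (hi : digit l i x ≠ digit l i y) :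
    Function.Surjective fun θ : Fin q → Fin l → Fin m => (tabulate θ x, tabulate θ y) := by
  rintro ⟨a, b⟩
  set row : Fin l → Fin m := Pi.single (digit l i x) a + Pi.single (digit l i y) b with hrow
  have hval : ∀ z : ℕ, tabulate (Pi.single i row) z = row (digit l i z) := by
    intro z
    unfold tabulate
    rw [Finset.sum_eq_single i (fun j _ hj => by rw [Pi.single_eq_of_ne hj]; rfl) (by simp)]
    simp
  refine ⟨Pi.single i row, ?_⟩
  simp only [hval]
  simp [hrow, hi, hi.symm]

lemma isTwoIndependent_tabClass {q l m N : ℕ} [NeZero l] [NeZero m] (hN : N ≤ l ^ q) :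
    IsTwoIndependent (tabClass q l m N) := by
  rw [isTwoIndependent_iff]
  intro x y hxy
  obtain ⟨i, hi⟩ := exists_digit_ne (x.2.trans_le hN) (y.2.trans_le hN) (Fin.val_ne_of_ne hxy)
  let φ : (Fin q → Fin l → Fin m) →+ Fin m × Fin m :=
    AddMonoidHom.mk' (fun θ => (tabulate θ x, tabulate θ y)) fun θ θ' => by
      simp [tabulate, Finset.sum_add_distrib]
  have hφ : IsUniform φ := by
    simpa only [zero_add] using IsUniform.const_add_hom φ (surjective_tabulate_prod hi) 0
  exact hφ.comp (IsUniform.of_equiv (tabEquiv q l m))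

/-! ### Collapsing the universe -/

lemma le_primeCounting_mul_sq {Q : ℕ} (hQ : 1 ≤ Q) : Q ≤ Nat.primeCounting (64 * Q ^ 2) := by
  have hQ' : (1 : ℝ) ≤ Q := by exact_mod_cast hQ
  set X : ℝ := ((64 * Q ^ 2 : ℕ) : ℝ) with hX
  have hXQ : X = 64 * Q ^ 2 := by simp [hX]
  have hlog_le : Real.log X ≤ 16 * Q - 2 := by
    rw [hXQ, show (64 : ℝ) * Q ^ 2 = (8 * Q) ^ 2 by ring, Real.log_pow]
    have := Real.log_le_sub_one_of_pos (show (0 : ℝ) < 8 * Q by positivity)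
    push_cast
    linarith
  have hlog_pos : 0 < Real.log X := Real.log_pos (by rw [hXQ]; nlinarith)
  have hlog_succ : Real.log (X + 1) ≤ 16 * Q - 1 := by
    have h : Real.log (X + 1) ≤ Real.log (2 * X) :=
      Real.log_le_log (by rw [hXQ]; positivity) (by rw [hXQ]; nlinarith)
    rw [Real.log_mul (by norm_num) (by rw [hXQ]; positivity)] at h
    linarith [Real.log_two_lt_d9]
  have hlog_two : (0.69 : ℝ) * (64 * Q ^ 2) ≤ X * Real.log 2 := by
    rw [hXQ]
    nlinarith [Real.log_two_gt_d9, sq_nonneg (Q : ℝ)]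
  have hpi : (Q : ℝ) ≤ Nat.primeCounting (64 * Q ^ 2) := by
    refine le_trans ?_ (Chebyshev.pi_ge (64 * Q ^ 2))
    rw [le_div_iff₀ hlog_pos]
    nlinarith
  exact_mod_cast hpi

lemma nth_prime_le {Q i : ℕ} (hi : i < Q) : Nat.nth Nat.Prime i ≤ 64 * Q ^ 2 :=
  Nat.lt_succ_iff.1 (Nat.nth_lt_of_lt_count (hi.trans_le (le_primeCounting_mul_sq (by omega))))

lemma card_nth_prime_dvd_le {Q d L : ℕ} (hd : 0 < d) (hL : d ≤ 2 ^ L) :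
    ({i : Fin Q | Nat.nth Nat.Prime i ∣ d} : Finset _).card ≤ L := by
  set A : Finset (Fin Q) := {i | Nat.nth Nat.Prime i ∣ d}
  have hinj : Function.Injective fun i : Fin Q => Nat.nth Nat.Prime i := fun i j h =>
    Fin.ext (Nat.nth_injective Nat.infinite_setOfPred_prime h)
  have hdvd : ∏ p ∈ A.image fun i : Fin Q => Nat.nth Nat.Prime i, p ∣ d := by
    refine Finset.prod_primes_dvd d ?_ ?_ <;> rw [Finset.forall_mem_image] <;> intro i hi
    · exact (Nat.prime_nth_prime i).prime
    · exact (Finset.mem_filter.1 hi).2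
  have hle : 2 ^ A.card ≤ ∏ p ∈ A.image fun i : Fin Q => Nat.nth Nat.Prime i, p := by
    rw [← Finset.card_image_of_injective A hinj]
    refine Finset.pow_card_le_prod _ _ _ ?_
    rw [Finset.forall_mem_image]
    exact fun i _ => (Nat.prime_nth_prime i).two_le
  exact (Nat.pow_le_pow_iff_right one_lt_two).1 ((hle.trans (Nat.le_of_dvd hd hdvd)).trans hL)

lemma clog_two_le_self (u : ℕ) : Nat.clog 2 u ≤ u :=
  Nat.clog_le_of_le_pow Nat.lt_two_pow_self.le

lemma prob_mod_nth_prime_collision_le {E u x y : ℕ} (hx : x < u) (hy : y < u) (hxy : x ≠ y) :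
    prob {i : Fin (E * Nat.clog 2 u) | x % Nat.nth Nat.Prime i = y % Nat.nth Nat.Prime i}
      ≤ 1 / E := by
  wlog hlt : x < y generalizing x y
  · simpa only [eq_comm] using this hy hx hxy.symm (by omega)
  have huL : u ≤ 2 ^ Nat.clog 2 u := Nat.le_pow_clog one_lt_two u
  have hcard := card_nth_prime_dvd_le (Q := E * Nat.clog 2 u) (d := y - x) (L := Nat.clog 2 u)
    (by omega) (by omega)
  have hdvd : ∀ P : ℕ, x % P = y % P ↔ P ∣ y - x := fun P => Nat.modEq_iff_dvd' hlt.le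
  have hL : 0 < Nat.clog 2 u := Nat.clog_pos one_lt_two (by omega)
  simp only [hdvd, prob, Fintype.card_fin]
  calc _ ≤ (Nat.clog 2 u : ℝ) / (E * Nat.clog 2 u : ℕ) := by gcongr
    _ = 1 / E := by push_cast; field_simp

lemma prob_collapse_le {E u p x y : ℕ} (hE : 0 < E) (hp : p.Prime)
    (hpQ : 64 * (E * Nat.clog 2 u) ^ 2 < p) (hx : x < u) (hy : y < u) (hxy : x ≠ y) :
    prob {i : Fin (E * Nat.clog 2 u) × Fin (p - 1) |
      x % Nat.nth Nat.Prime i.1 * (i.2 + 1) % p % E = y % Nat.nth Nat.Prime i.1 * (i.2 + 1) % p % E}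
      ≤ 3 / E := by
  set P : Fin (E * Nat.clog 2 u) → ℕ := fun i => Nat.nth Nat.Prime i
  have hmod_lt : ∀ i z, z % P i < p := fun i z =>
    (Nat.mod_lt z (Nat.prime_nth_prime _).pos).trans ((nth_prime_le i.2).trans_lt hpQ)
  have : Nonempty (Fin (p - 1)) := ⟨⟨0, by have := hp.two_le; omega⟩⟩
  calc _ ≤ prob {i : Fin (E * Nat.clog 2 u) × Fin (p - 1) | x % P i.1 = y % P i.1
          ∨ (x % P i.1 ≠ y % P i.1
            ∧ x % P i.1 * (i.2 + 1) % p % E = y % P i.1 * (i.2 + 1) % p % E)} :=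
        prob_filter_mono fun i hi => or_iff_not_imp_left.2 fun h => ⟨h, hi⟩
    _ ≤ 1 / E + 2 / E := by
      refine (prob_filter_or_le _ _).trans (add_le_add ?_ ?_)
      · exact (prob_filter_fst_le fun i => x % P i = y % P i).trans
          (prob_mod_nth_prime_collision_le hx hy hxy)
      · refine (prob_and_le_mul (Q := fun i a : Fin _ =>
          x % P i * (a + 1) % p % E = y % P i * (a + 1) % p % E) fun i hi =>
          prob_mul_mod_collision_le hp hE (hmod_lt i x) (hmod_lt i y) hi).trans ?_
        exact mul_le_of_le_one_left (by positivity) (prob_le_one _)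
    _ = 3 / E := by ring

/-- A hash class from `{0, …, u-1}` to the smaller universe `{0, …, N-1}`, whose `i`-th member
`x ↦ ((x mod P i) * A i mod p) mod N` is described by the two words `P i` and `A i`. -/
structure CollapseClass (u : ℕ) where
  N : ℕ
  p : ℕ
  card : ℕ
  P : Fin card → ℕ
  A : Fin card → ℕ
  [neZero_N : NeZero N]
  [neZero_card : NeZero card]
  P_le : ∀ i, P i ≤ p
  A_le : ∀ i, A i ≤ p
  N_le_u : N ≤ u
  N_le_p : N ≤ p
  p_le : p ≤ 128 * u ^ 4

namespace CollapseClass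

attribute [instance] CollapseClass.neZero_N CollapseClass.neZero_card

variable {u : ℕ} (𝒞 : CollapseClass u)

/-- The members of the class as functions. -/
def col (i : Fin 𝒞.card) (x : Fin u) : Fin 𝒞.N := Fin.ofNat 𝒞.N (x % 𝒞.P i * 𝒞.A i % 𝒞.p)

/-- The class whose only member is the identity. -/
def identity (u : ℕ) [NeZero u] : CollapseClass u where
  N := u
  p := u
  card := 1
  P _ := u
  A _ := 1
  P_le _ := le_rfl
  A_le _ := NeZero.one_le
  N_le_u := le_rfl
  N_le_p := le_rfl
  p_le := by nlinarith [Nat.le_self_pow (show 4 ≠ 0 by norm_num) u]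

lemma identity_col [NeZero u] (i : Fin 1) (x : Fin u) : (identity u).col i x = x := by
  refine Fin.ext ?_
  change x % u * 1 % u % u = (x : ℕ)
  simp only [Nat.mod_eq_of_lt x.2, mul_one]

/-- Reduction modulo a random prime followed by multiplicative hashing modulo `p`. -/
noncomputable def ofPrime (u E p : ℕ) [NeZero E] (hu : 2 ≤ u) (hEu : E ≤ u) (hp : p.Prime)
    (hp_gt : 64 * (E * Nat.clog 2 u) ^ 2 < p) (hp_le : p ≤ 128 * (E * Nat.clog 2 u) ^ 2) :
    CollapseClass u where
  N := E
  p := p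
  card := E * Nat.clog 2 u * (p - 1)
  P i := Nat.nth Nat.Prime (finProdFinEquiv.symm i).1
  A i := (finProdFinEquiv.symm i).2 + 1
  neZero_card := ⟨by
    have := hp.two_le
    have := NeZero.ne E
    have := Nat.clog_pos one_lt_two hu
    simp only [ne_eq, mul_eq_zero]
    omega⟩
  P_le i := (nth_prime_le (finProdFinEquiv.symm i).1.2).trans hp_gt.le
  A_le i := by omega
  N_le_u := hEu
  N_le_p := by
    have := Nat.clog_pos one_lt_two hu
    have := Nat.le_self_pow (show 2 ≠ 0 by norm_num) (E * Nat.clog 2 u)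
    have : E ≤ E * Nat.clog 2 u := Nat.le_mul_of_pos_right _ ‹_›
    omega
  p_le := by
    refine hp_le.trans (Nat.mul_le_mul_left _ ?_)
    calc (E * Nat.clog 2 u) ^ 2 ≤ (u * u) ^ 2 := by
          gcongr
          exact clog_two_le_self u
      _ = u ^ 4 := by ring

lemma prob_ofPrime_col_eq_le {E p : ℕ} [NeZero E] (hu : 2 ≤ u) (hEu : E ≤ u) (hp : p.Prime)
    (hp_gt : 64 * (E * Nat.clog 2 u) ^ 2 < p) (hp_le : p ≤ 128 * (E * Nat.clog 2 u) ^ 2)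
    {x y : Fin u} (hxy : x ≠ y) :
    prob {i | (ofPrime u E p hu hEu hp hp_gt hp_le).col i x
      = (ofPrime u E p hu hEu hp hp_gt hp_le).col i y} ≤ 3 / E := by
  refine le_of_eq_of_le ?_
    (prob_collapse_le (NeZero.pos E) hp hp_gt x.2 y.2 (Fin.val_ne_of_ne hxy))
  rw [← (IsUniform.of_equiv (finProdFinEquiv (m := E * Nat.clog 2 u) (n := p - 1)).symm).prob_filter
    fun i => x % Nat.nth Nat.Prime i.1 * (i.2 + 1) % p % E
      = y % Nat.nth Nat.Prime i.1 * (i.2 + 1) % p % E]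
  simp only [col, Fin.ext_iff, Fin.val_ofNat]
  rfl

end CollapseClass

lemma exists_collapseClass {e : ℝ} (he : 1 ≤ e) {u : ℕ} (hu : 2 ≤ u) :
    ∃ 𝒞 : CollapseClass u, (𝒞.N : ℝ) ≤ 2 * e ∧ 𝒞.p ≤ 128 * (⌈e⌉₊ * Nat.clog 2 u) ^ 2 ∧
      ∀ x y, x ≠ y → prob {i | 𝒞.col i x = 𝒞.col i y} ≤ 3 / e := by
  have hL : 0 < Nat.clog 2 u := Nat.clog_pos one_lt_two hu
  have hE : 0 < ⌈e⌉₊ := Nat.ceil_pos.2 (by linarith)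
  rcases le_or_gt (u : ℝ) e with hue | hue
  · have : NeZero u := ⟨by omega⟩
    refine ⟨.identity u, ?_, ?_, fun x y hxy => ?_⟩
    · change (u : ℝ) ≤ 2 * e
      linarith
    · have h1 : u ≤ ⌈e⌉₊ := by exact_mod_cast hue.trans (Nat.le_ceil e)
      have h2 : ⌈e⌉₊ ≤ ⌈e⌉₊ * Nat.clog 2 u := Nat.le_mul_of_pos_right _ hL
      have h3 := Nat.le_self_pow (show 2 ≠ 0 by norm_num) (⌈e⌉₊ * Nat.clog 2 u)
      change u ≤ 128 * (⌈e⌉₊ * Nat.clog 2 u) ^ 2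
      omega
    · have hne : ∀ i, (CollapseClass.identity u).col i x ≠ (CollapseClass.identity u).col i y :=
        fun i h => hxy (by
          rwa [CollapseClass.identity_col i x, CollapseClass.identity_col i y] at h)
      rw [Finset.filter_false_of_mem fun i _ => hne i]
      simp only [prob, Finset.card_empty, Nat.cast_zero, zero_div]
      positivity
  · have : NeZero ⌈e⌉₊ := ⟨hE.ne'⟩
    obtain ⟨p, hp, hp_gt, hp_le⟩ := Nat.exists_prime_lt_and_le_two_mul
      (64 * (⌈e⌉₊ * Nat.clog 2 u) ^ 2) (by positivity)
    rw [← mul_assoc] at hp_le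
    refine ⟨.ofPrime u ⌈e⌉₊ p hu (Nat.ceil_le.2 hue.le) hp hp_gt hp_le, ?_, hp_le,
      fun x y hxy => ?_⟩
    · change (⌈e⌉₊ : ℝ) ≤ 2 * e
      linarith [Nat.ceil_lt_add_one (show 0 ≤ e by linarith)]
    · refine (CollapseClass.prob_ofPrime_col_eq_le hu _ hp hp_gt hp_le hxy).trans ?_
      gcongr
      exact Nat.le_ceil e

/-! ### Leafless sets of keys

A pair of functions `a 0`, `a 1` turns keys into the edges of a bipartite multigraph. -/

section Graph

variable {α β γ : Type*} {a : Fin 2 → α → β}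

/-- No edge in `T` has a private endpoint: every endpoint has degree at least two. -/
def Leafless (a : Fin 2 → α → β) (T : Finset α) : Prop :=
  ∀ x ∈ T, ∀ i, ∃ y ∈ T, y ≠ x ∧ a i y = a i x

/-- The bad event for the keys `S`: some leafless subset of `S` on which none of the functions
`G j` is injective. -/
def Bad {c : ℕ} (a : Fin 2 → α → β) (G : Fin c → α → γ) (S : Finset α) : Prop :=
  ∃ T ⊆ S, Leafless a T ∧ ∀ j, ¬ Set.InjOn (G j) T

lemma Bad.image {α' : Type*} [DecidableEq α'] {c : ℕ} {a : Fin 2 → α' → β} {G : Fin c → α' → γ}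
    {S : Finset α} {q : α → α'} (hq : Set.InjOn q S)
    (h : Bad (fun i x => a i (q x)) (fun j x => G j (q x)) S) : Bad a G (S.image q) := by
  obtain ⟨T, hTS, hT, hG⟩ := h
  refine ⟨T.image q, Finset.image_subset_image hTS, ?_, fun j hj => hG j ?_⟩
  · intro z hz i
    obtain ⟨x, hx, rfl⟩ := Finset.mem_image.1 hz
    obtain ⟨y, hy, hyx, hay⟩ := hT x hx i
    exact ⟨q y, Finset.mem_image_of_mem q hy, fun h => hyx (hq (hTS hy) (hTS hx) h), hay⟩
  · rw [Finset.coe_image] at hj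
    exact hj.comp (hq.mono (Finset.coe_subset.2 hTS)) (Set.mapsTo_image q T)

lemma peel_induction [DecidableEq α] {P : Finset α → Prop} (S : Finset α)
    (leafless : ∀ T ⊆ S, Leafless a T → P T)
    (peel : ∀ T, ∀ x ∈ T, ∀ i, (∀ y ∈ T, y ≠ x → a i y ≠ a i x) → P (T.erase x) → P T) : P S := by
  induction S using Finset.strongInduction with
  | H S ih =>
    by_cases hS : Leafless a S
    · exact leafless S subset_rfl hS
    · unfold Leafless at hS
      push Not at hS
      obtain ⟨x, hx, i, hxi⟩ := hS
      exact peel S x hx i hxi (ih _ (Finset.erase_ssubset hx) fun T hT =>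
        leafless T (hT.trans (Finset.erase_subset x S)))

section Tables

variable {A ι : Type*} [AddCommGroup A] [Fintype ι]

lemma sum_single_apply [DecidableEq ι] (i : ι) (f : β → A) (G : ι → α → β) (x : α) :
    ∑ j, (Pi.single i f : ι → β → A) j (G j x) = f (G i x) := by
  rw [Finset.sum_eq_single i (fun j _ hj => by rw [Pi.single_eq_of_ne hj]; rfl) (by simp),
    Pi.single_eq_same]

lemma exists_tables_of_injOn {G : ι → α → γ} {T : Finset α} {j : ι} (hj : Set.InjOn (G j) T)
    (v : α → A) : ∃ y : ι → γ → A, ∀ x ∈ T, ∑ j, y j (G j x) = v x := by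
  classical
  rcases T.eq_empty_or_nonempty with rfl | ⟨x₀, -⟩
  · exact ⟨0, by simp⟩
  · have : Nonempty α := ⟨x₀⟩
    refine ⟨Pi.single j (v ∘ Function.invFunOn (G j) T), fun x hx => ?_⟩
    rw [sum_single_apply, Function.comp_apply, hj.leftInvOn_invFunOn hx]

lemma exists_tables_of_not_bad {c : ℕ} {G : Fin c → α → γ} {S : Finset α} (h : ¬ Bad a G S)
    (v : α → A) :
    ∃ (t : Fin 2 → β → A) (y : Fin c → γ → A),
      ∀ x ∈ S, ∑ i, t i (a i x) + ∑ j, y j (G j x) = v x := by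
  classical
  refine peel_induction (a := a)
    (P := fun T => ∃ (t : Fin 2 → β → A) (y : Fin c → γ → A),
      ∀ x ∈ T, ∑ i, t i (a i x) + ∑ j, y j (G j x) = v x)
    S (fun T hTS hT => ?_) fun T x hx i hxi ⟨t, y, hty⟩ => ?_
  · obtain ⟨j, hj⟩ : ∃ j, Set.InjOn (G j) T := by
      by_contra! hG
      exact h ⟨T, hTS, hT, hG⟩
    obtain ⟨y, hy⟩ := exists_tables_of_injOn hj v
    exact ⟨0, y, by simpa using hy⟩
  · set d := v x - (∑ i, t i (a i x) + ∑ j, y j (G j x)) with hd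
    refine ⟨t + Pi.single i (Pi.single (a i x) d), y, fun z hz => ?_⟩
    simp only [Pi.add_apply, Finset.sum_add_distrib, sum_single_apply]
    rcases eq_or_ne z x with rfl | hzx
    · rw [Pi.single_eq_same, hd]
      abel
    · rw [Pi.single_eq_of_ne (hxi z hz hzx), add_zero]
      exact hty z (Finset.mem_erase.2 ⟨hzx, hz⟩)

end Tables

/-! ### Walks in leafless sets -/

/-- The side of the bipartite graph at which the `p`-th edge of a walk is left. -/
def side (p : ℕ) : Fin 2 := if p % 2 = 0 then 0 else 1

lemma eq_side_or (σ : Fin 2) (p : ℕ) : σ = side p ∨ σ = side (p + 1) := by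
  unfold side
  rcases Nat.mod_two_eq_zero_or_one p with h | h <;> fin_cases σ <;>
    simp [h, Nat.add_mod]

lemma side_add_two (p : ℕ) : side (p + 2) = side p := by simp [side]

/-- The endpoint at which the `p`-th edge of the walk `y` is left has been met before. -/
def Closed (a : Fin 2 → α → β) (y : ℕ → α) (p : ℕ) : Prop :=
  ∃ i < p, a (side p) (y p) = a (side p) (y i)

/-- The keys `y 0, …, y (t-1)` form a walk with jumps: the `(p+1)`-st edge continues at the
endpoint of the `p`-th edge, unless `p + 1 ∈ J`, in which case the endpoint of the `p`-th edge
has been met before. -/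
def IsWalk (a : Fin 2 → α → β) (y : ℕ → α) (t : ℕ) (J : Finset ℕ) : Prop :=
  ∀ p, p + 1 < t →
    (p + 1 ∉ J → a (side p) (y (p + 1)) = a (side p) (y p)) ∧ (p + 1 ∈ J → Closed a y p)

lemma Closed.congr {y y' : ℕ → α} {p : ℕ} (h : Closed a y p) (hy : ∀ i ≤ p, y' i = y i) :
    Closed a y' p := by
  obtain ⟨i, hi, hai⟩ := h
  exact ⟨i, hi, by rw [hy p le_rfl, hy i hi.le, hai]⟩

/-- A walk of `t + 1` distinct keys from `T`. -/
structure WalkIn (a : Fin 2 → α → β) (T : Finset α) (y : ℕ → α) (t : ℕ) (J : Finset ℕ) : Prop where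
  walk : IsWalk a y (t + 1) J
  mem : ∀ p ≤ t, y p ∈ T
  injOn : Set.InjOn y (Set.Iic t)
  jumps : ∀ p ∈ J, p ≤ t

section WalkIn

variable {T : Finset α} {y : ℕ → α} {t : ℕ} {J : Finset ℕ}

lemma WalkIn.lt_card (h : WalkIn a T y t J) : t < T.card := by
  have hcard := Finset.card_le_card_of_injOn (s := Finset.Iic t) (t := T) y
    (fun p hp => h.mem p (Finset.mem_Iic.1 hp)) (by rw [Finset.coe_Iic]; exact h.injOn)
  rwa [Nat.card_Iic] at hcard

lemma WalkIn.snoc {J' : Finset ℕ} (h : WalkIn a T y t J) {z : α} (hz : z ∈ T)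
    (hnew : ∀ p ≤ t, y p ≠ z) (hJ : ∀ p ≤ t, p ∈ J' ↔ p ∈ J) (hJ' : ∀ p ∈ J', p ≤ t + 1)
    (hstep : t + 1 ∉ J' → a (side t) z = a (side t) (y t))
    (hjump : t + 1 ∈ J' → Closed a y t) :
    WalkIn a T (Function.update y (t + 1) z) (t + 1) J' := by
  set y' := Function.update y (t + 1) z with hy'
  have hold : ∀ p ≤ t, y' p = y p := fun p hp => Function.update_of_ne (by omega) _ _
  have hlast : y' (t + 1) = z := Function.update_self _ _ _
  refine ⟨fun p hp => ?_, fun p hp => ?_, ?_, hJ'⟩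
  · rcases (Nat.lt_succ_iff.1 (Nat.succ_lt_succ_iff.1 hp)).lt_or_eq with hpt | rfl
    · obtain ⟨hstep, hjump⟩ := h.walk p (by omega)
      rw [hJ (p + 1) hpt, hold p hpt.le, hold (p + 1) hpt]
      exact ⟨hstep, fun hp => (hjump hp).congr fun i hi => hold i (hi.trans hpt.le)⟩
    · rw [hlast, hold p le_rfl]
      exact ⟨hstep, fun hp => (hjump hp).congr hold⟩
  · rcases Nat.le_succ_iff.1 hp with hpt | rfl
    · rw [hold p hpt]
      exact h.mem p hpt
    · rwa [hlast]
  · have hset : Set.Iic (t + 1) = insert (t + 1) (Set.Iic t) := Order.Iic_succ t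
    rw [hset, Set.injOn_insert (by simp)]
    refine ⟨h.injOn.congr fun p hp => (hold p hp).symm, ?_⟩
    rintro ⟨p, hp, hpz⟩
    rw [hold p hp, hlast] at hpz
    exact hnew p hp hpz

lemma WalkIn.exists_closed (hT : Leafless a T) {y : ℕ → α} {t : ℕ} (h : WalkIn a T y t J) :
    ∃ y' t', t ≤ t' ∧ (∀ p ≤ t, y' p = y p) ∧ WalkIn a T y' t' J ∧ Closed a y' t' := by
  by_cases hc : Closed a y t
  · exact ⟨y, t, le_rfl, fun _ _ => rfl, h, hc⟩
  · obtain ⟨z, hz, hzy, haz⟩ := hT (y t) (h.mem t le_rfl) (side t)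
    have hnew : ∀ p ≤ t, y p ≠ z := by
      rintro p hp rfl
      rcases hp.lt_or_eq with hpt | rfl
      · exact hc ⟨p, hpt, haz.symm⟩
      · exact hzy rfl
    have hJ : t + 1 ∉ J := fun hJ => absurd (h.jumps _ hJ) (by omega)
    have hsnoc := h.snoc hz hnew (fun _ _ => Iff.rfl)
      (fun p hp => (h.jumps p hp).trans (Nat.le_succ t)) (fun _ => haz) (fun h => absurd h hJ)
    have := hsnoc.lt_card
    obtain ⟨y', t', ht, hy', hwalk, hclosed⟩ := hsnoc.exists_closed hT
    refine ⟨y', t', by omega, fun p hp => ?_, hwalk, hclosed⟩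
    rw [hy' p (by omega), Function.update_of_ne (by omega)]
termination_by T.card - t

lemma Leafless.exists_walk_through (hT : Leafless a T) (hne : T.Nonempty)
    (X : Finset α) (hX : X ⊆ T) :
    ∃ y t J, J.card ≤ X.card ∧ WalkIn a T y t J ∧ (∀ x ∈ X, ∃ p ≤ t, y p = x) ∧
      Closed a y t := by
  classical
  induction X using Finset.induction_on with
  | empty =>
    obtain ⟨x₀, hx₀⟩ := hne
    have h : WalkIn a T (fun _ => x₀) 0 ∅ :=
      ⟨fun p hp => by omega, fun _ _ => hx₀, fun p hp q hq _ => by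
        rw [Set.mem_Iic] at hp hq; omega, by simp⟩
    obtain ⟨y, t, -, -, hwalk, hclosed⟩ := h.exists_closed hT
    exact ⟨y, t, ∅, by simp, hwalk, by simp, hclosed⟩
  | insert x X hxX ih =>
    obtain ⟨y, t, J, hJ, hwalk, hcover, hclosed⟩ :=
      ih fun z hz => hX (Finset.mem_insert_of_mem hz)
    by_cases hx : ∃ p ≤ t, y p = x
    · refine ⟨y, t, J, hJ.trans (Finset.card_le_card (Finset.subset_insert _ _)), hwalk, ?_,
        hclosed⟩
      exact (Finset.forall_mem_insert _ _ _).2 ⟨hx, hcover⟩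
    push Not at hx
    have hsnoc := hwalk.snoc (J' := insert (t + 1) J) (hX (Finset.mem_insert_self x X)) hx
      (fun p hp => by simp [show p ≠ t + 1 by omega])
      ((Finset.forall_mem_insert _ _ _).2
        ⟨le_rfl, fun p hp => (hwalk.jumps p hp).trans (Nat.le_succ t)⟩)
      (fun h => absurd (Finset.mem_insert_self _ _) h) (fun _ => hclosed)
    obtain ⟨y', t', ht, hy', hwalk', hclosed'⟩ := hsnoc.exists_closed hT
    refine ⟨y', t', _, ?_, hwalk', (Finset.forall_mem_insert _ _ _).2 ⟨?_, fun z hz => ?_⟩,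
      hclosed'⟩
    · rw [Finset.card_insert_of_notMem hxX]
      exact (Finset.card_insert_le _ _).trans (by omega)
    · exact ⟨t + 1, ht, by rw [hy' _ le_rfl, Function.update_self]⟩
    · obtain ⟨p, hp, rfl⟩ := hcover z hz
      exact ⟨p, by omega, by rw [hy' p (by omega), Function.update_of_ne (by omega)]⟩

end WalkIn

/-- A pair of functions on `s + 1` positions that looks like a walk with at most `K` jumps. -/
def WalkPattern (K : ℕ) {s : ℕ} (b : Fin 2 → Fin (s + 1) → β) : Prop :=
  ∃ J : Finset ℕ, J.card ≤ K ∧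
    IsWalk (fun σ p => b σ (Fin.ofNat (s + 1) p)) (fun p => p) (s + 1) J

/-- The event bounded by the first moment: all `G j` collide on the keys `y`, some `G j` only does
so because of the last key, and the other keys form a walk with at most `K` jumps. -/
abbrev IsCriticalWalk (K : ℕ) {c s : ℕ} (a : Fin 2 → α → β) (G : Fin c → α → γ)
    (y : Fin (s + 2) → α) : Prop :=
  (∀ j, ¬ Function.Injective fun p => G j (y p)) ∧
  (∃ j, Function.Injective fun p : Fin (s + 1) => G j (y p.castSucc)) ∧
  WalkPattern K fun σ (p : Fin (s + 1)) => a σ (y p.castSucc)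

lemma IsWalk.walkPattern {y : ℕ → α} {s t K : ℕ} {J : Finset ℕ} (h : IsWalk a y t J)
    (hst : s < t) (hJ : J.card ≤ K) : WalkPattern K fun σ (p : Fin (s + 1)) => a σ (y p) := by
  refine ⟨J, hJ, fun p hp => ?_⟩
  have hval : ∀ i < s + 1, (Fin.ofNat (s + 1) i : ℕ) = i := fun i hi => Nat.mod_eq_of_lt hi
  obtain ⟨hstep, hjump⟩ := h p (by omega)
  simp only [hval (p + 1) hp, hval p (by omega)]
  refine ⟨hstep, fun hJ => ?_⟩
  obtain ⟨i, hi, hai⟩ := hjump hJ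
  exact ⟨i, hi, by simp only [hval p (by omega), hval i (by omega), hai]⟩

lemma exists_card_le_forall_not_injOn {c : ℕ} {G : Fin c → α → γ} {T : Finset α}
    (hG : ∀ j, ¬ Set.InjOn (G j) T) :
    ∃ X ⊆ T, X.card ≤ 2 * c ∧ ∀ j, ¬ Set.InjOn (G j) X := by
  classical
  unfold Set.InjOn at hG
  push Not at hG
  choose x hx x' hx' hxx' hne using hG
  refine ⟨Finset.univ.biUnion fun j => {x j, x' j}, ?_, ?_, fun j hj => hne j ?_⟩
  · intro z hz
    obtain ⟨j, -, hz⟩ := Finset.mem_biUnion.1 hz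
    rcases Finset.mem_insert.1 hz with rfl | hz
    · exact hx j
    · exact Finset.mem_singleton.1 hz ▸ hx' j
  · refine (Finset.card_biUnion_le_card_mul _ _ 2 fun j _ => Finset.card_le_two).trans ?_
    rw [Finset.card_univ, Fintype.card_fin, mul_comm]
  · exact hj (Finset.mem_biUnion.2 ⟨j, Finset.mem_univ j, by simp⟩)
      (Finset.mem_biUnion.2 ⟨j, Finset.mem_univ j, by simp⟩) (hxx' j)

lemma exists_critical_prefix {c : ℕ} (hc : 0 < c) {G : Fin c → ℕ → γ} {n : ℕ}
    (h : ∀ j, ¬ Set.InjOn (G j) (Set.Iio n)) :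
    ∃ s, s + 2 ≤ n ∧ (∀ j, ¬ Set.InjOn (G j) (Set.Iio (s + 2))) ∧
      ∃ j, Set.InjOn (G j) (Set.Iio (s + 1)) := by
  classical
  have hex : ∃ k, ∀ j, ¬ Set.InjOn (G j) (Set.Iio k) := ⟨n, h⟩
  have htwo : 2 ≤ Nat.find hex := by
    by_contra! hlt
    refine Nat.find_spec hex ⟨0, hc⟩ fun p hp q hq _ => ?_
    rw [Set.mem_Iio] at hp hq
    omega
  obtain ⟨s, hs⟩ := Nat.exists_eq_add_of_le' htwo
  refine ⟨s, hs ▸ Nat.find_min' hex h, hs ▸ Nat.find_spec hex, ?_⟩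
  simpa using Nat.find_min hex (m := s + 1) (by omega)

lemma injOn_Iio_iff_injective {f : ℕ → γ} {n : ℕ} :
    Set.InjOn f (Set.Iio n) ↔ Function.Injective fun p : Fin n => f p :=
  ⟨fun h p q hpq => Fin.ext (h p.2 q.2 hpq),
    fun h p hp q hq hpq => congrArg Fin.val (h (a₁ := ⟨p, hp⟩) (a₂ := ⟨q, hq⟩) hpq)⟩

lemma Bad.exists_isCriticalWalk {c : ℕ} (hc : 0 < c) {G : Fin c → α → γ}
    {S : Finset α} (h : Bad a G S) :
    ∃ s, s + 2 ≤ S.card ∧ ∃ y : Fin (s + 2) → α, (∀ p, y p ∈ S) ∧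
      Function.Injective y ∧ IsCriticalWalk (2 * c) a G y := by
  obtain ⟨T, hTS, hT, hG⟩ := h
  have hne : T.Nonempty := by
    rw [Finset.nonempty_iff_ne_empty]
    rintro rfl
    exact hG ⟨0, hc⟩ (by simp)
  obtain ⟨X, hXT, hXcard, hX⟩ := exists_card_le_forall_not_injOn hG
  obtain ⟨y, t, J, hJ, hwalk, hcover, -⟩ := hT.exists_walk_through hne X hXT
  have hcollide : ∀ j, ¬ Set.InjOn (fun p => G j (y p)) (Set.Iio (t + 1)) := by
    refine fun j hj => hX j fun x hx x' hx' hxx' => ?_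
    obtain ⟨p, hp, rfl⟩ := hcover x hx
    obtain ⟨p', hp', rfl⟩ := hcover x' hx'
    rw [hj (Nat.lt_succ_of_le hp) (Nat.lt_succ_of_le hp') hxx']
  obtain ⟨s, hs, hlast, hprev⟩ := exists_critical_prefix hc hcollide
  have hcard := hwalk.lt_card.trans_le (Finset.card_le_card hTS)
  simp only [injOn_Iio_iff_injective] at hlast hprev
  refine ⟨s, by omega, fun p => y p, fun p => hTS (hwalk.mem p (by omega)), ?_, hlast, hprev,
    hwalk.walk.walkPattern (by omega) (hJ.trans hXcard)⟩
  exact injOn_Iio_iff_injective.1 (hwalk.injOn.mono fun p hp => by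
    rw [Set.mem_Iio] at hp
    exact Set.mem_Iic.2 (by omega))

end Graph

/-! ### Counting walk patterns -/

section Patterns

variable {β : Type*} {K s : ℕ}

/-- A code lists `K` pairs of a jump position and a position met before. -/
abbrev JumpCode (K s : ℕ) : Type := Fin K → Fin (s + 1) × Fin (s + 1)

/-- The pair `b` is a walk whose jumps and their targets are listed by `code`. -/
def FollowsJumps (code : JumpCode K s) (b : Fin 2 → Fin (s + 1) → β) : Prop :=
  ∀ p < s, ((∀ k, ((code k).1 : ℕ) ≠ p + 1) →
      b (side p) (Fin.ofNat (s + 1) (p + 1)) = b (side p) (Fin.ofNat (s + 1) p)) ∧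
    ∀ k, ((code k).1 : ℕ) = p + 1 →
      ((code k).2 : ℕ) < p ∧ b (side p) (Fin.ofNat (s + 1) p) = b (side p) (code k).2

open Classical in
/-- The `s + 2` values that determine a walk with given jumps: the starting point and, for every
edge, the one of its two ends next to the following position that is not met before. -/
noncomputable def freeValues (code : JumpCode K s) (b : Fin 2 → Fin (s + 1) → β) :
    Fin (s + 2) → β :=
  Fin.cons (b (side 1) 0) fun p : Fin (s + 1) =>
    if ∃ k, ((code k).1 : ℕ) = p + 1 then b (side p) (Fin.ofNat (s + 1) (p + 1)) else b (side p) p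

lemma FollowsJumps.eq_of_freeValues_eq {code : JumpCode K s} {b b' : Fin 2 → Fin (s + 1) → β}
    (h : FollowsJumps code b) (h' : FollowsJumps code b')
    (hf : freeValues code b = freeValues code b') : b = b' := by
  obtain ⟨hstart, hfree⟩ := Fin.cons_inj.1 hf
  have hpos : ∀ p : Fin (s + 1), Fin.ofNat (s + 1) (p : ℕ) = p := fun p => Fin.ext (by simp)
  suffices h : ∀ p ≤ s, ∀ σ, b σ (Fin.ofNat (s + 1) p) = b' σ (Fin.ofNat (s + 1) p) by
    funext σ p
    simpa only [hpos] using h p (Fin.is_le p) σ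
  intro p
  induction p using Nat.strong_induction_on with
  | _ p ih =>
    intro hp σ
    rcases eq_side_or σ p with rfl | rfl
    · have hfree_p := congrFun hfree (Fin.ofNat (s + 1) p)
      have hval : (Fin.ofNat (s + 1) p : ℕ) = p := Nat.mod_eq_of_lt (by omega)
      simp only [hval] at hfree_p
      by_cases hk : ∃ k, ((code k).1 : ℕ) = p + 1
      · obtain ⟨k, hk⟩ := hk
        have hps : p < s := by have := (code k).1.is_le; omega
        obtain ⟨hlt, hb⟩ := (h p hps).2 k hk
        rw [hb, ((h' p hps).2 k hk).2, ← hpos (code k).2, ih _ hlt (by omega)]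
      · simpa only [if_neg hk] using hfree_p
    · rcases p with _ | p
      · simpa using hstart
      · have hfree_p := congrFun hfree (Fin.ofNat (s + 1) p)
        have hval : (Fin.ofNat (s + 1) p : ℕ) = p := Nat.mod_eq_of_lt (by omega)
        simp only [hval] at hfree_p
        rw [side_add_two]
        by_cases hk : ∃ k, ((code k).1 : ℕ) = p + 1
        · simpa only [if_pos hk] using hfree_p
        · push Not at hk
          rw [(h p (by omega)).1 hk, (h' p (by omega)).1 hk, ih p (by omega) (by omega)]

lemma exists_enumeration {α : Type*} {J : Finset α} (hJ : J.card ≤ K) (a₀ : α) :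
    ∃ f : Fin K → α, (∀ a ∈ J, ∃ k, f k = a) ∧ ∀ k, f k ∈ J ∨ f k = a₀ := by
  classical
  obtain ⟨e⟩ : Nonempty (J ↪ Fin K) :=
    Function.Embedding.nonempty_of_card_le (by simpa using hJ)
  refine ⟨Function.extend e (↑) fun _ => a₀,
    fun a ha => ⟨e ⟨a, ha⟩, e.injective.extend_apply _ _ _⟩, fun k => ?_⟩
  by_cases hk : ∃ a, e a = k
  · obtain ⟨a, rfl⟩ := hk
    rw [e.injective.extend_apply]
    exact Or.inl a.2
  · exact Or.inr (Function.extend_apply' _ _ _ hk)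

lemma WalkPattern.exists_code {b : Fin 2 → Fin (s + 1) → β} (h : WalkPattern K b) :
    ∃ code : JumpCode K s, FollowsJumps code b := by
  classical
  obtain ⟨J, hJ, hwalk⟩ := h
  have htarget : ∀ q : Fin (s + 1), ∃ i : Fin (s + 1), ∀ p < s, (q : ℕ) = p + 1 → (q : ℕ) ∈ J →
      (i : ℕ) < p ∧ b (side p) (Fin.ofNat (s + 1) p) = b (side p) i := by
    intro q
    by_cases hq : ∃ p < s, (q : ℕ) = p + 1 ∧ (q : ℕ) ∈ J
    · obtain ⟨p, hp, hqp, hqJ⟩ := hq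
      obtain ⟨i, hi, hb⟩ := (hwalk p (by omega)).2 (hqp ▸ hqJ)
      refine ⟨Fin.ofNat (s + 1) i, fun p' _ hqp' _ => ?_⟩
      obtain rfl : p' = p := by omega
      exact ⟨by rwa [Fin.val_ofNat, Nat.mod_eq_of_lt (by omega)], hb⟩
    · exact ⟨0, fun p hp hqp hqJ => absurd ⟨p, hp, hqp, hqJ⟩ hq⟩
  choose target htarget using htarget
  obtain ⟨f, hsurj, hf⟩ := exists_enumeration (K := K)
    (J := Finset.univ.filter fun q : Fin (s + 1) => (q : ℕ) ∈ J)
    ((Finset.card_le_card_of_injOn Fin.val (fun q hq => (Finset.mem_filter.1 hq).2)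
      Fin.val_injective.injOn).trans hJ) 0
  refine ⟨fun k => (f k, target (f k)), fun p hp => ⟨fun hn => ?_, fun k hk => ?_⟩⟩
  · refine (hwalk p (by omega)).1 fun hpJ => ?_
    obtain ⟨k, hk⟩ := hsurj ⟨p + 1, by omega⟩ (by simpa using hpJ)
    exact hn k (congrArg Fin.val hk)
  · refine htarget (f k) p hp hk ?_
    rcases hf k with h | h
    · exact (Finset.mem_filter.1 h).2
    · simp [h] at hk

open Classical in
lemma card_walkPattern_le [Fintype β] (K s : ℕ) :
    (Finset.univ.filter fun b : Fin 2 → Fin (s + 1) → β => WalkPattern K b).card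
      ≤ (s + 1) ^ (2 * K) * Fintype.card β ^ (s + 2) := by
  have hsub : (Finset.univ.filter fun b : Fin 2 → Fin (s + 1) → β => WalkPattern K b)
      ⊆ (Finset.univ : Finset (JumpCode K s)).biUnion fun code =>
        Finset.univ.filter fun b => FollowsJumps code b := by
    intro b hb
    obtain ⟨code, hcode⟩ := (Finset.mem_filter.1 hb).2.exists_code
    simpa using ⟨code, hcode⟩
  refine (Finset.card_le_card hsub).trans
    ((Finset.card_biUnion_le_card_mul _ _ (Fintype.card β ^ (s + 2)) fun code _ => ?_).trans_eq ?_)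
  · calc _ ≤ (Finset.univ : Finset (Fin (s + 2) → β)).card :=
          Finset.card_le_card_of_injOn (freeValues code) (by simp) fun b hb b' hb' =>
            (Finset.mem_filter.1 hb).2.eq_of_freeValues_eq (Finset.mem_filter.1 hb').2
      _ = Fintype.card β ^ (s + 2) := by simp
  · simp only [Finset.card_univ, Fintype.card_fun, Fintype.card_prod, Fintype.card_fin, ← pow_two,
      ← pow_mul]

end Patterns

/-! ### The probability of the bad event -/

section BadEvent

variable {kH kF c d l m N n : ℕ} [NeZero m]

lemma fin_val_sum {ι : Type*} (t : Finset ι) (f : ι → Fin m) :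
    ((∑ i ∈ t, f i : Fin m) : ℕ) = (∑ i ∈ t, (f i : ℕ)) % m := by
  classical
  induction t using Finset.induction_on with
  | empty => simp
  | insert i t hi ih =>
    rw [Finset.sum_insert hi, Finset.sum_insert hi, Fin.val_add, ih, Nat.add_mod_mod]

lemma zHash_eq_sum (H : Fin kH → Fin N → Fin m) (F : Fin kF → Fin N → Fin l)
    (ζ : ZSeed kH kF d c l m) (i : Fin d) (x : Fin N) :
    zHash H F ζ i x = H (ζ.1 i) x + ∑ j, ζ.2.2 i j (F (ζ.2.1 j) x) := by
  apply Fin.ext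
  rw [Fin.val_add, fin_val_sum, Nat.add_mod_mod]
  rfl

lemma isUniform_add_sum_tables {k : ℕ} {G : Fin c → Fin k → Fin l}
    (hG : ∃ j, Function.Injective (G j)) (b₀ : Fin d → Fin k → Fin m) :
    IsUniform fun (z : Fin d → Fin c → Fin l → Fin m) σ p => b₀ σ p + ∑ j, z σ j (G j p) := by
  obtain ⟨j, hj⟩ := hG
  let lookup : (Fin d → Fin c → Fin l → Fin m) →+ (Fin d → Fin k → Fin m) :=
    { toFun := fun z σ p => ∑ j, z σ j (G j p)
      map_zero' := by ext; simp
      map_add' := fun z z' => by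
        funext σ p
        simp only [Pi.add_apply, Finset.sum_add_distrib] }
  refine IsUniform.const_add_hom lookup (fun b => ?_) b₀
  choose z hz using fun σ => exists_tables_of_injOn (G := G) (T := Finset.univ)
    hj.injOn (b σ)
  exact ⟨z, funext fun σ => funext fun p => hz σ p (Finset.mem_univ p)⟩

open Classical in
lemma prob_walkPattern_lookup_le {s : ℕ} (K : ℕ) {G : Fin c → Fin (s + 1) → Fin l}
    (hG : ∃ j, Function.Injective (G j)) (b₀ : Fin 2 → Fin (s + 1) → Fin m) :
    prob {z : Fin 2 → Fin c → Fin l → Fin m |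
        WalkPattern K fun σ p => b₀ σ p + ∑ j, z σ j (G j p)}
      ≤ (s + 1 : ℝ) ^ (2 * K) / (m : ℝ) ^ s := by
  have hm : (0 : ℝ) < m := by exact_mod_cast NeZero.pos m
  have hcount : (({b | WalkPattern K b} : Finset (Fin 2 → Fin (s + 1) → Fin m)).card : ℝ)
      ≤ (s + 1 : ℝ) ^ (2 * K) * (m : ℝ) ^ (s + 2) := by
    have h := card_walkPattern_le (β := Fin m) K s
    rw [Fintype.card_fin] at h
    exact_mod_cast h
  rw [(isUniform_add_sum_tables hG b₀).prob_filter (WalkPattern K), prob,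
    div_le_div_iff₀ (by positivity) (by positivity)]
  simp only [Fintype.card_fun, Fintype.card_fin, Nat.cast_pow]
  calc _ ≤ (s + 1 : ℝ) ^ (2 * K) * (m : ℝ) ^ (s + 2) * (m : ℝ) ^ s := by gcongr
    _ = _ := by ring

open Classical in
lemma IsUniversal.prob_not_injective_le {F : Fin kF → Fin N → Fin l} {C : ℝ} (hC : 0 ≤ C)
    (hF : IsUniversal C F) {k : ℕ} {y : Fin k → Fin N} (hy : Function.Injective y) :
    prob {i | ¬ Function.Injective fun p => F i (y p)} ≤ (k : ℝ) ^ 2 * (C / l) := by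
  have h := prob_not_injOn_le (fun i p => F i (y p)) Finset.univ (η := C / l) (by positivity)
    fun p p' hp => hF _ _ (hy.ne hp)
  simpa [Set.injOn_univ] using h

open Classical in
lemma prob_forall_not_injective_le {F : Fin kF → Fin N → Fin l} (hF : IsUniversal 2 F) {s : ℕ}
    {y : Fin (s + 2) → Fin N} (hy : Function.Injective y) :
    prob {g : Fin c → Fin kF | ∀ j, ¬ Function.Injective fun p => F (g j) (y p)}
      ≤ ((s + 2 : ℝ) ^ 2 * (2 / l)) ^ c := by
  have h := hF.prob_not_injective_le zero_le_two hy
  push_cast at h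
  refine (prob_pi_forall fun i => ¬ Function.Injective fun p => F i (y p)).trans_le ?_
  rw [Fintype.card_fin]
  exact pow_le_pow_left₀ (prob_nonneg _) h c

open Classical in
lemma prob_isCriticalWalk_le (H : Fin kH → Fin N → Fin m) {F : Fin kF → Fin N → Fin l}
    (hF : IsUniversal 2 F) {s : ℕ} {y : Fin (s + 2) → Fin N} (hy : Function.Injective y) (K : ℕ) :
    prob {ζ : ZSeed kH kF 2 c l m | IsCriticalWalk K (zHash H F ζ) (fun j => F (ζ.2.1 j)) y}
      ≤ ((s + 2 : ℝ) ^ 2 * (2 / l)) ^ c * ((s + 1 : ℝ) ^ (2 * K) / (m : ℝ) ^ s) := by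
  refine prob_prod_le
    (P := fun f τ => IsCriticalWalk K (zHash H F (f, τ)) (fun j => F (τ.1 j)) y)
    (by positivity) fun f => ?_
  have hsplit := prob_and_le_mul
    (P := fun g : Fin c → Fin kF => ∀ j, ¬ Function.Injective fun p => F (g j) (y p))
    (Q := fun g (z : Fin 2 → Fin c → Fin l → Fin m) =>
      (∃ j, Function.Injective fun p : Fin (s + 1) => F (g j) (y p.castSucc)) ∧
      WalkPattern K fun σ (p : Fin (s + 1)) => zHash H F (f, g, z) σ (y p.castSucc))
    (ε := (s + 1 : ℝ) ^ (2 * K) / (m : ℝ) ^ s) fun g _ => ?_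
  · refine (prob_filter_mono fun τ h => ?_).trans (hsplit.trans
      (mul_le_mul_of_nonneg_right (prob_forall_not_injective_le hF hy) (by positivity)))
    exact h
  by_cases hg : ∃ j, Function.Injective fun p : Fin (s + 1) => F (g j) (y p.castSucc)
  · refine (prob_filter_mono fun z h => ?_).trans
      (prob_walkPattern_lookup_le K hg fun σ p => H (f σ) (y p.castSucc))
    simpa only [zHash_eq_sum] using h.2
  · simp only [hg, false_and, Finset.filter_false, prob, Finset.card_empty, Nat.cast_zero,
      zero_div]
    positivity

open Classical in
lemma prob_bad_le_sum (hc : 0 < c) (H : Fin kH → Fin N → Fin m)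
    {F : Fin kF → Fin N → Fin l} (hF : IsUniversal 2 F) (S : Finset (Fin N)) (hS : S.card = n) :
    prob {ζ : ZSeed kH kF 2 c l m | Bad (zHash H F ζ) (fun j => F (ζ.2.1 j)) S}
      ≤ ∑ s ∈ Finset.range n, (n : ℝ) ^ (s + 2) *
        (((s + 2 : ℝ) ^ 2 * (2 / l)) ^ c * ((s + 1 : ℝ) ^ (2 * (2 * c)) / (m : ℝ) ^ s)) := by
  let tuples (s : ℕ) : Finset (Fin (s + 2) → Fin N) :=
    {y ∈ Fintype.piFinset fun _ => S | Function.Injective y}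
  let critical (s : ℕ) (y : Fin (s + 2) → Fin N) : Finset (ZSeed kH kF 2 c l m) :=
    {ζ | IsCriticalWalk (2 * c) (zHash H F ζ) (fun j => F (ζ.2.1 j)) y}
  have hsub : ({ζ : ZSeed kH kF 2 c l m | Bad (zHash H F ζ) (fun j => F (ζ.2.1 j)) S} : Finset _)
      ⊆ (Finset.range n).biUnion fun s => (tuples s).biUnion (critical s) := by
    intro ζ hζ
    obtain ⟨s, hs, y, hyS, hy, hcrit⟩ := (Finset.mem_filter.1 hζ).2.exists_isCriticalWalk hc
    exact Finset.mem_biUnion.2 ⟨s, Finset.mem_range.2 (by omega), Finset.mem_biUnion.2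
      ⟨y, Finset.mem_filter.2 ⟨Fintype.mem_piFinset.2 hyS, hy⟩,
        Finset.mem_filter.2 ⟨Finset.mem_univ _, hcrit⟩⟩⟩
  have htuples : ∀ s, ((tuples s).card : ℝ) ≤ (n : ℝ) ^ (s + 2) := fun s => by
    have h := Finset.card_filter_le (Fintype.piFinset fun _ : Fin (s + 2) => S) Function.Injective
    rw [Fintype.card_piFinset_const, hS] at h
    exact_mod_cast h
  refine (prob_mono hsub).trans ((prob_biUnion_le _ _).trans (Finset.sum_le_sum fun s _ => ?_))
  refine (prob_biUnion_le _ _).trans ((Finset.sum_le_sum fun y hy =>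
    prob_isCriticalWalk_le H hF (Finset.mem_filter.1 hy).2 (2 * c)).trans ?_)
  rw [Finset.sum_const, nsmul_eq_mul]
  gcongr
  exact htuples s

open Classical in
lemma prob_bad_le (hc : 0 < c) (H : Fin kH → Fin N → Fin m)
    {F : Fin kF → Fin N → Fin l} (hF : IsUniversal 2 F) (S : Finset (Fin N)) (hS : S.card = n)
    {ρ A : ℝ} (hρ : (n : ℝ) ≤ ρ * m)
    (hA : ∀ k, ∑ t ∈ Finset.range k, (t : ℝ) ^ (6 * c) * ρ ^ t ≤ A) :
    prob {ζ : ZSeed kH kF 2 c l m | Bad (zHash H F ζ) (fun j => F (ζ.2.1 j)) S}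
      ≤ (2 / l : ℝ) ^ c * (m : ℝ) ^ 2 * A := by
  have hm : (0 : ℝ) < m := by exact_mod_cast NeZero.pos m
  have hρ₀ : 0 ≤ ρ := nonneg_of_mul_nonneg_left ((Nat.cast_nonneg n).trans hρ) hm
  have hseries : ∑ s ∈ Finset.range n, ((s + 2 : ℕ) : ℝ) ^ (6 * c) * ρ ^ (s + 2) ≤ A := by
    refine le_trans ?_ (hA (n + 2))
    rw [Finset.sum_range_succ', Finset.sum_range_succ', add_assoc]
    exact le_add_of_nonneg_right (by positivity)
  have hterm : ∀ s : ℕ, (n : ℝ) ^ (s + 2) *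
        (((s + 2 : ℝ) ^ 2 * (2 / l)) ^ c * ((s + 1 : ℝ) ^ (2 * (2 * c)) / (m : ℝ) ^ s))
      ≤ (2 / l : ℝ) ^ c * (m : ℝ) ^ 2 * (((s + 2 : ℕ) : ℝ) ^ (6 * c) * ρ ^ (s + 2)) := fun s =>
    calc _ ≤ (ρ * m) ^ (s + 2) *
          (((s + 2 : ℝ) ^ 2 * (2 / l)) ^ c * ((s + 2 : ℝ) ^ (2 * (2 * c)) / (m : ℝ) ^ s)) := by
          gcongr
          norm_num
      _ = _ := by
          rw [show 6 * c = 2 * c + 2 * (2 * c) by ring, pow_add _ (2 * c), mul_pow,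
            mul_pow _ (2 / (l : ℝ)) c, ← pow_mul, pow_add (m : ℝ)]
          push_cast
          field_simp
  refine (prob_bad_le_sum hc H hF S hS).trans ((Finset.sum_le_sum fun s _ => hterm s).trans ?_)
  rw [← Finset.mul_sum]
  gcongr

end BadEvent

/-! ### Uniformity outside the bad event -/

section RandomFunction

variable {kC kH kF kK c l m r u N : ℕ}

lemma uniformOnOutside_of_prob_eq {Ω₁ Ω₂ Ω₃ : Type} [Fintype Ω₁] [Fintype Ω₂] [Fintype Ω₃]
    [Nonempty Ω₃] [DecidableEq (Ω₁ × Ω₂ × Ω₃)] {X : Ω₁ × Ω₂ × Ω₃ → Fin u → Fin r}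
    {S : Finset (Fin u)} {P : Ω₁ → Ω₂ → Prop}
    [DecidablePred fun ω : Ω₁ × Ω₂ × Ω₃ => P ω.1 ω.2.1]
    (h : ∀ a b, ¬ P a b → ∀ v : Fin u → Fin r,
      prob {τ | ∀ x ∈ S, X (a, b, τ) x = v x} = 1 / (r : ℝ) ^ S.card) :
    UniformOnOutside X S {ω | P ω.1 ω.2.1} := by
  classical
  intro v
  have hequiv : IsUniform (Equiv.prodAssoc Ω₁ Ω₂ Ω₃).symm := IsUniform.of_equiv _
  have hprod := prob_and_eq_mul (P := fun a : Ω₁ × Ω₂ => ¬ P a.1 a.2)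
    (Q := fun a τ => ∀ x ∈ S, X (a.1, a.2, τ) x = v x) fun a ha => h a.1 a.2 ha v
  have hcompl := prob_and_eq_mul (P := fun a : Ω₁ × Ω₂ => ¬ P a.1 a.2)
    (Q := fun _ (_ : Ω₃) => True) (ε := 1) fun _ _ => by simp [prob]
  rw [← hequiv.prob_filter] at hprod hcompl
  rw [mul_one] at hcompl
  rw [← hcompl, mul_one_div] at hprod
  convert hprod using 3
  · simp
  · ext ω
    simp

/-- The choices of the collapse function and of the graph for which the values on `S` may fail to
be uniform. -/
def BadSeed (col : Fin kC → Fin u → Fin N) (H : Fin kH → Fin N → Fin m)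
    (F : Fin kF → Fin N → Fin l) (S : Finset (Fin u)) (q : Fin kC) (ζ : ZSeed kH kF 2 c l m) :
    Prop :=
  Bad (fun i x => zHash H F ζ i (col q x)) (fun j x => F (ζ.2.1 j) (col q x)) S

open Classical in
lemma prob_badSeed_le_of_injOn [NeZero m] (hc : 0 < c) {col : Fin kC → Fin u → Fin N}
    (H : Fin kH → Fin N → Fin m) {F : Fin kF → Fin N → Fin l} (hF : IsUniversal 2 F)
    {S : Finset (Fin u)} {q : Fin kC} (hq : Set.InjOn (col q) S) {ρ A : ℝ}
    (hρ : (S.card : ℝ) ≤ ρ * m)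
    (hA : ∀ k, ∑ t ∈ Finset.range k, (t : ℝ) ^ (6 * c) * ρ ^ t ≤ A) :
    prob {ζ : ZSeed kH kF 2 c l m | BadSeed col H F S q ζ} ≤ (2 / l : ℝ) ^ c * (m : ℝ) ^ 2 * A :=
  (prob_filter_mono fun _ h => Bad.image hq h).trans
    (prob_bad_le hc H hF _ (Finset.card_image_of_injOn hq) hρ hA)

open Classical in
lemma prob_badSeed_le [NeZero m] (hc : 0 < c) {col : Fin kC → Fin u → Fin N}
    (H : Fin kH → Fin N → Fin m) {F : Fin kF → Fin N → Fin l} (hF : IsUniversal 2 F) {η : ℝ}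
    (hη : 0 ≤ η) (hcol : ∀ x y, x ≠ y → prob {i | col i x = col i y} ≤ η) {S : Finset (Fin u)}
    {ρ A : ℝ} (hρ : (S.card : ℝ) ≤ ρ * m)
    (hA : ∀ k, ∑ t ∈ Finset.range k, (t : ℝ) ^ (6 * c) * ρ ^ t ≤ A) :
    prob {σ : DSSeed kC kH kF kK c l m r | BadSeed col H F S σ.1 σ.2.1}
      ≤ (S.card : ℝ) ^ 2 * η + (2 / l : ℝ) ^ c * (m : ℝ) ^ 2 * A := by
  have hA₀ : 0 ≤ A := le_trans (by simp) (hA 0)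
  have hinj := (prob_filter_fst_le (Ω' := ZSeed kH kF 2 c l m × (Fin 2 → Fin m → Fin r) ×
    (Fin c → Fin l → Fin r) × Fin kK) fun q => ¬ Set.InjOn (col q) S).trans
      (prob_not_injOn_le col S hη hcol)
  have hbad : ∀ q, Set.InjOn (col q) S →
      prob {τ : ZSeed kH kF 2 c l m × (Fin 2 → Fin m → Fin r) × (Fin c → Fin l → Fin r) × Fin kK |
        BadSeed col H F S q τ.1} ≤ (2 / l : ℝ) ^ c * (m : ℝ) ^ 2 * A := fun q hq =>
    (prob_filter_fst_le fun ζ => BadSeed col H F S q ζ).trans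
      (prob_badSeed_le_of_injOn hc H hF hq hρ hA)
  have hgraph := (prob_and_le_mul (P := fun q => Set.InjOn (col q) S) hbad).trans
    (mul_le_of_le_one_left (by positivity) (prob_le_one _))
  refine le_trans (prob_filter_mono fun σ h => ?_) ((prob_filter_or_le _ _).trans
    (add_le_add hinj hgraph))
  exact or_iff_not_imp_left.2 fun hσ => ⟨not_not.1 hσ, h⟩

variable [NeZero r]

/-- `dsHash` with values in `{0, …, r-1}`. -/
def dsFun (col : Fin kC → Fin u → Fin N) (H : Fin kH → Fin N → Fin m)
    (F : Fin kF → Fin N → Fin l) (K : Fin kK → Fin N → Fin r) (σ : DSSeed kC kH kF kK c l m r)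
    (x : Fin u) : Fin r :=
  ⟨dsHash col H F K σ x, Nat.mod_lt _ (NeZero.pos r)⟩

lemma dsFun_eq_sum (col : Fin kC → Fin u → Fin N) (H : Fin kH → Fin N → Fin m)
    (F : Fin kF → Fin N → Fin l) (K : Fin kK → Fin N → Fin r) (q : Fin kC)
    (ζ : ZSeed kH kF 2 c l m) (t : Fin 2 → Fin m → Fin r) (y : Fin c → Fin l → Fin r)
    (f : Fin kK) (x : Fin u) :
    dsFun col H F K (q, ζ, t, y, f) x = K f (col q x) +
      (∑ i, t i (zHash H F ζ i (col q x)) + ∑ j, y j (F (ζ.2.1 j) (col q x))) := by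
  apply Fin.ext
  simp only [dsFun, dsHash, Fin.val_add, fin_val_sum, Fin.sum_univ_two, Nat.add_mod_mod,
    Nat.mod_add_mod]
  congr 1
  ring

lemma isUniform_sum_tables_of_not_bad {α β γ : Type} [Fintype β] [DecidableEq β] [Fintype γ]
    [DecidableEq γ] [DecidableEq α] {a : Fin 2 → α → β} {G : Fin c → α → γ} {S : Finset α}
    (h : ¬ Bad a G S) (v₀ : S → Fin r) :
    IsUniform fun (τ : (Fin 2 → β → Fin r) × (Fin c → γ → Fin r)) (x : S) =>
      v₀ x + (∑ i, τ.1 i (a i x) + ∑ j, τ.2 j (G j x)) := by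
  let lookup : (Fin 2 → β → Fin r) × (Fin c → γ → Fin r) →+ (S → Fin r) :=
    { toFun := fun τ x => ∑ i, τ.1 i (a i x) + ∑ j, τ.2 j (G j x)
      map_zero' := by ext; simp
      map_add' := fun τ τ' => by
        funext x
        simp only [Prod.fst_add, Prod.snd_add, Pi.add_apply, Finset.sum_add_distrib]
        abel }
  have hsurj : Function.Surjective lookup := fun v => by
    obtain ⟨t, y, hty⟩ :=
      exists_tables_of_not_bad h fun x => if hx : x ∈ S then v ⟨x, hx⟩ else 0
    exact ⟨(t, y), funext fun x => (hty x x.2).trans (dif_pos x.2)⟩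
  exact IsUniform.const_add_hom lookup hsurj v₀

lemma prob_forall_dsFun_eq [NeZero kK] {col : Fin kC → Fin u → Fin N} {H : Fin kH → Fin N → Fin m}
    {F : Fin kF → Fin N → Fin l} (K : Fin kK → Fin N → Fin r) {S : Finset (Fin u)} {q : Fin kC}
    {ζ : ZSeed kH kF 2 c l m} (h : ¬ BadSeed col H F S q ζ) (v : Fin u → Fin r) :
    prob {τ : (Fin 2 → Fin m → Fin r) × (Fin c → Fin l → Fin r) × Fin kK |
      ∀ x ∈ S, dsFun col H F K (q, ζ, τ) x = v x} = 1 / (r : ℝ) ^ S.card := by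
  let e : (Fin 2 → Fin m → Fin r) × (Fin c → Fin l → Fin r) × Fin kK
      ≃ Fin kK × (Fin 2 → Fin m → Fin r) × (Fin c → Fin l → Fin r) :=
    (Equiv.prodAssoc _ _ _).symm.trans (Equiv.prodComm _ _)
  have hsum := isUniform_sum_tables_of_not_bad (r := r)
    (a := fun i x => zHash H F ζ i (col q x)) (G := fun j x => F (ζ.2.1 j) (col q x)) h
  have hunif := IsUniform.prod_snd fun f : Fin kK => hsum fun x => K f (col q x)
  have hv := hunif.comp (IsUniform.of_equiv e) fun x => v x
  rw [Fintype.card_fun, Fintype.card_coe, Fintype.card_fin, Nat.cast_pow] at hv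
  rw [← hv]
  congr 1
  ext ⟨t, y, f⟩
  simp only [Finset.mem_filter, Finset.mem_univ, true_and, dsFun_eq_sum, funext_iff,
    Subtype.forall]
  rfl

open Classical in
lemma uniformOnOutside_badSeed [NeZero m] [NeZero l] [NeZero kK] (col : Fin kC → Fin u → Fin N)
    (H : Fin kH → Fin N → Fin m) (F : Fin kF → Fin N → Fin l) (K : Fin kK → Fin N → Fin r)
    (S : Finset (Fin u)) :
    UniformOnOutside (dsFun (c := c) col H F K) S {σ | BadSeed col H F S σ.1 σ.2.1} :=
  uniformOnOutside_of_prob_eq (P := BadSeed col H F S) fun _ _ h v =>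
    prob_forall_dsFun_eq K h v

end RandomFunction

/-! ### Compiling expressions to word programs -/

/-- Expressions over the key, constants, memory reads and word operations: the terms in which the
evaluation procedure is written before it is compiled to instructions. -/
inductive Expr
  | key
  | cst (a : ℕ)
  | load (e : Expr)
  | bin (o : WordOp) (e f : Expr)

namespace Expr

/-- The word denoted by an expression. -/
def val (w : ℕ) {b : ℕ} (mem : Fin b → Bool) (x : ℕ) : Expr → ℕ
  | key => x % 2 ^ w
  | cst a => a % 2 ^ w
  | load e => memWord w mem (e.val w mem x)
  | bin o e f => o.eval w (e.val w mem x) (f.val w mem x) % 2 ^ w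

/-- The number of nodes, which is the number of instructions of the compiled program. -/
def size : Expr → ℕ
  | key => 1
  | cst _ => 1
  | load e => e.size + 1
  | bin _ e f => e.size + f.size + 1

/-- Every constant of the expression is below `B`. -/
def ConstsLt (B : ℕ) : Expr → Prop
  | key => True
  | cst a => a < B
  | load e => e.ConstsLt B
  | bin _ e f => e.ConstsLt B ∧ f.ConstsLt B

/-- The program of an expression when registers `0, …, k-1` are in use; its value ends up in
register `k + e.size - 1`. -/
def code (k : ℕ) : Expr → List Instr
  | key => [.op .or 0 0]
  | cst a => [.const a]
  | load e => e.code k ++ [.load (k + e.size - 1)]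
  | bin o e f =>
    e.code k ++ f.code (k + e.size) ++ [.op o (k + e.size - 1) (k + e.size + f.size - 1)]

lemma length_code (e : Expr) (k : ℕ) : (e.code k).length = e.size := by
  induction e generalizing k with
  | key => rfl
  | cst a => rfl
  | load e ih => simp [code, size, ih]
  | bin o e f ih₁ ih₂ => simp [code, size, ih₁, ih₂, add_assoc]

lemma exists_foldl_code_eq {w b : ℕ} (mem : Fin b → Bool) (x : ℕ) (e : Expr) (regs : List ℕ) :
    ∃ regs' : List ℕ, regs'.length + 1 = e.size ∧
      (e.code (regs.length + 1)).foldl (fun regs ins => regs ++ [ins.eval w mem regs]) (x :: regs)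
        = x :: (regs ++ regs' ++ [e.val w mem x]) := by
  induction e generalizing regs with
  | key => exact ⟨[], by simp [code, size, val, Instr.eval, WordOp.eval]⟩
  | cst a => exact ⟨[], by simp [code, size, val, Instr.eval]⟩
  | load e ih =>
    obtain ⟨T, hT, hfold⟩ := ih regs
    refine ⟨T ++ [e.val w mem x], by simp [size, ← hT], ?_⟩
    have hlast : regs.length + 1 + e.size - 1 = (x :: (regs ++ T)).length := by
      simp only [List.length_cons, List.length_append]
      omega
    rw [code, List.foldl_append, hfold, hlast, List.foldl_cons, List.foldl_nil]
    simp [Instr.eval, val]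
  | bin o e f ih₁ ih₂ =>
    obtain ⟨T, hT, hfold⟩ := ih₁ regs
    obtain ⟨T', hT', hfold'⟩ := ih₂ (regs ++ T ++ [e.val w mem x])
    have hlen : regs.length + 1 + e.size = (regs ++ T ++ [e.val w mem x]).length + 1 := by
      simp only [List.length_append, List.length_singleton]
      omega
    have hfst : regs.length + 1 + e.size - 1 = (x :: (regs ++ T)).length := by
      simp only [List.length_cons, List.length_append]
      omega
    have hsnd : regs.length + 1 + e.size + f.size - 1
        = (x :: (regs ++ T ++ [e.val w mem x] ++ T')).length := by
      simp only [List.length_cons, List.length_append, List.length_nil]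
      omega
    refine ⟨T ++ [e.val w mem x] ++ T' ++ [f.val w mem x], ?_, ?_⟩
    · simp only [size, List.length_append, List.length_singleton]
      omega
    rw [code, List.foldl_append, List.foldl_append, hfold, hfst, hsnd, hlen, hfold',
      List.foldl_cons, List.foldl_nil]
    simp [Instr.eval, val]

theorem run_code {w b : ℕ} (mem : Fin b → Bool) (x : ℕ) (e : Expr) :
    run w mem (e.code 1) x = e.val w mem x := by
  obtain ⟨regs, -, hfold⟩ := exists_foldl_code_eq (w := w) mem x e []
  rw [run, runRegs, show 1 = ([] : List ℕ).length + 1 from rfl, hfold, ← List.cons_append,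
    List.getLastD_concat]

lemma constBits_code_le {β : ℕ} (e : Expr) (he : e.ConstsLt (2 ^ β)) (k : ℕ) :
    ((e.code k).map Instr.constBits).sum ≤ e.size * β := by
  induction e generalizing k with
  | key => simp [code, Instr.constBits]
  | cst a => simpa [code, Instr.constBits, size] using Nat.size_le.2 he
  | load e ih =>
    have := ih he k
    simp only [code, size, List.map_append, List.sum_append, List.map_cons, List.map_nil,
      List.sum_cons, List.sum_nil, Instr.constBits]
    nlinarith
  | bin o e f ih₁ ih₂ =>
    have := ih₁ he.1 k
    have := ih₂ he.2 (k + e.size)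
    simp only [code, size, List.map_append, List.sum_append, List.map_cons, List.map_nil,
      List.sum_cons, List.sum_nil, Instr.constBits]
    nlinarith

/-- The sum of `n` expressions. -/
def sum : (n : ℕ) → (Fin n → Expr) → Expr
  | 0, _ => cst 0
  | n + 1, E => bin .add (E 0) (sum n fun i => E i.succ)

lemma size_sum {B n : ℕ} {E : Fin n → Expr} (h : ∀ i, (E i).size = B) :
    (sum n E).size = n * (B + 1) + 1 := by
  induction n with
  | zero => simp [sum, size]
  | succ n ih =>
    simp only [sum, size, h, ih fun i => h i.succ]
    ring

lemma constsLt_sum {B n : ℕ} {E : Fin n → Expr} (hB : 0 < B) (h : ∀ i, (E i).ConstsLt B) :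
    (sum n E).ConstsLt B := by
  induction n with
  | zero => exact hB
  | succ n ih => exact ⟨h 0, ih fun i => h i.succ⟩

section Values

variable {w b : ℕ} {mem : Fin b → Bool} {x : ℕ} {e f : Expr} {v v' : ℕ}

lemma val_key (h : x < 2 ^ w) : key.val w mem x = x :=
  Nat.mod_eq_of_lt h

lemma val_cst (h : v < 2 ^ w) : (cst v).val w mem x = v :=
  Nat.mod_eq_of_lt h

lemma val_load (he : e.val w mem x = v) : (load e).val w mem x = memWord w mem v := by
  rw [val, he]

lemma val_bin (o : WordOp) (he : e.val w mem x = v) (hf : f.val w mem x = v') :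
    (bin o e f).val w mem x = o.eval w v v' % 2 ^ w := by
  rw [val, he, hf]

lemma val_add (he : e.val w mem x = v) (hf : f.val w mem x = v') (h : v + v' < 2 ^ w) :
    (bin .add e f).val w mem x = v + v' :=
  (val_bin _ he hf).trans (Nat.mod_eq_of_lt h)

lemma val_sub (he : e.val w mem x = v) (hf : f.val w mem x = v') (h : v < 2 ^ w) (hle : v' ≤ v) :
    (bin .sub e f).val w mem x = v - v' := by
  rw [val_bin _ he hf, WordOp.eval, Nat.sub_add_comm hle, Nat.add_mod_right]
  exact Nat.mod_eq_of_lt ((Nat.sub_le _ _).trans_lt h)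

lemma val_mul (he : e.val w mem x = v) (hf : f.val w mem x = v') (h : v * v' < 2 ^ w) :
    (bin .mul e f).val w mem x = v * v' :=
  (val_bin _ he hf).trans (Nat.mod_eq_of_lt h)

lemma val_div (he : e.val w mem x = v) (hf : f.val w mem x = v') (h : v < 2 ^ w) :
    (bin .div e f).val w mem x = v / v' :=
  (val_bin _ he hf).trans (Nat.mod_eq_of_lt ((Nat.div_le_self _ _).trans_lt h))

lemma val_mod (he : e.val w mem x = v) (hf : f.val w mem x = v') (h : v < 2 ^ w) :
    (bin .mod e f).val w mem x = v % v' :=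
  (val_bin _ he hf).trans (Nat.mod_eq_of_lt ((Nat.mod_le _ _).trans_lt h))

lemma val_sum {n : ℕ} {E : Fin n → Expr} {a : Fin n → ℕ} (h : ∀ i, (E i).val w mem x = a i)
    (hlt : ∑ i, a i < 2 ^ w) : (sum n E).val w mem x = ∑ i, a i := by
  induction n with
  | zero => simp [sum, val]
  | succ n ih =>
    rw [Fin.sum_univ_succ] at hlt ⊢
    exact val_add (h 0) (ih (fun i => h i.succ) (by omega)) hlt

end Values

end Expr

/-! ### Arrays in memory -/

/-- The memory whose bits are the first `b` binary digits of `M`. -/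
def memOf (b M : ℕ) : Fin b → Bool := fun k => M.testBit k

lemma memBit_memOf {b M : ℕ} (hM : M < 2 ^ b) (k : ℕ) :
    memBit (memOf b M) k = (M.testBit k).toNat := by
  unfold memBit memOf
  split_ifs with h
  · rfl
  · rw [Nat.testBit_lt_two_pow (hM.trans_le (Nat.pow_le_pow_right two_pos (not_lt.1 h)))]
    rfl

lemma sum_testBit_toNat (X w : ℕ) :
    ∑ t ∈ Finset.range w, (X.testBit t).toNat * 2 ^ t = X % 2 ^ w := by
  induction w with
  | zero => simp [Nat.mod_one]
  | succ w ih =>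
    rw [Finset.sum_range_succ, ih, Nat.toNat_testBit, Nat.mod_pow_succ, mul_comm (2 ^ w)]

lemma memWord_memOf {b M : ℕ} (hM : M < 2 ^ b) (w a : ℕ) :
    memWord w (memOf b M) a = M / 2 ^ (a * w) % 2 ^ w := by
  rw [← sum_testBit_toNat]
  refine Finset.sum_congr rfl fun t _ => ?_
  rw [memBit_memOf hM, Nat.testBit_div_two_pow, add_comm]

/-- The bits of `M` from position `o` on form an array of `b`-bit numbers with entries `a i`. -/
def StoresArray {n : ℕ} (M o b : ℕ) (a : Fin n → ℕ) : Prop :=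
  ∀ i : Fin n, M / 2 ^ (o + i * b) % 2 ^ b = a i

lemma StoresArray.of_mod_eq {n M M' o o' b : ℕ} {a : Fin n → ℕ} (h : StoresArray M o b a)
    (hM : M' % 2 ^ o' = M) (hle : o + n * b ≤ o') : StoresArray M' o b a := by
  intro i
  have hi : o + i * b + b ≤ o' := by nlinarith [i.isLt]
  rw [← h i, ← hM]
  refine Nat.eq_of_testBit_eq fun t => ?_
  simp only [Nat.testBit_mod_two_pow, Nat.testBit_div_two_pow]
  by_cases ht : t < b
  · simp [ht, show t + (o + i * b) < o' by omega]
  · simp [ht]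

lemma finFunctionFinEquiv_div_pow_mod {n m : ℕ} (f : Fin n → Fin m) (i : Fin n) :
    (finFunctionFinEquiv f : ℕ) / m ^ (i : ℕ) % m = f i := by
  conv_rhs => rw [← finFunctionFinEquiv.symm_apply_apply f]
  rfl

lemma exists_append_array {M o b n : ℕ} (hM : M < 2 ^ o) (a : Fin n → ℕ)
    (ha : ∀ i, a i < 2 ^ b) :
    ∃ M', M' < 2 ^ (o + n * b) ∧ M' % 2 ^ o = M ∧ StoresArray M' o b a := by
  let X := finFunctionFinEquiv fun i => (⟨a i, ha i⟩ : Fin (2 ^ b))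
  have hX : (X : ℕ) < 2 ^ (n * b) := by
    rw [mul_comm, pow_mul]
    exact X.isLt
  refine ⟨M + 2 ^ o * X, ?_, ?_, fun i => ?_⟩
  · rw [pow_add]
    nlinarith
  · rw [Nat.add_mul_mod_self_left, Nat.mod_eq_of_lt hM]
  · rw [pow_add, ← Nat.div_div_eq_div_mul, Nat.add_mul_div_left _ _ (by positivity),
      Nat.div_eq_of_lt hM, zero_add, mul_comm, pow_mul, finFunctionFinEquiv_div_pow_mod]

namespace Expr

/-- The `b` bits of the memory that start at the bit position given by `e`, which may straddle two
consecutive words. -/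
def field (w : ℕ) (e : Expr) (b : ℕ) : Expr :=
  bin .mod
    (bin .add
      (bin .shr (load (bin .div e (cst w))) (bin .mod e (cst w)))
      (bin .shl (load (bin .add (bin .div e (cst w)) (cst 1)))
        (bin .sub (cst w) (bin .mod e (cst w)))))
    (cst (2 ^ b))

/-- Two consecutive words `X % 2 ^ w` and `X / 2 ^ w % 2 ^ w` give the `b` bits of `X` from
position `s` on. -/
lemma shift_words_modEq {X w s b : ℕ} (hs : s ≤ w) (hb : b ≤ w) :
    (X % 2 ^ w / 2 ^ s % 2 ^ w + X / 2 ^ w % 2 ^ w * 2 ^ (w - s) % 2 ^ w) % 2 ^ w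
      ≡ X / 2 ^ s [MOD 2 ^ b] := by
  have hsplit : X / 2 ^ s = X % 2 ^ w / 2 ^ s + X / 2 ^ w * 2 ^ (w - s) := by
    conv_lhs => rw [← Nat.mod_add_div X (2 ^ w)]
    rw [← Nat.add_sub_cancel' hs, pow_add, mul_assoc, Nat.add_mul_div_left _ _ (by positivity),
      Nat.add_sub_cancel_left, mul_comm (2 ^ (w - s))]
  rw [hsplit]
  refine Nat.ModEq.of_dvd (Nat.pow_dvd_pow 2 hb) ((Nat.mod_modEq _ _).trans ?_)
  exact (Nat.mod_modEq _ _).add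
    ((Nat.mod_modEq _ _).trans ((Nat.mod_modEq _ _).mul_right _))

lemma val_field {w B M x o b : ℕ} {e : Expr} (hM : M < 2 ^ B)
    (he : e.val w (memOf B M) x = o) (ho : o + 1 < 2 ^ w) (hb : b < w) :
    (field w e b).val w (memOf B M) x = M / 2 ^ o % 2 ^ b := by
  have hw : w < 2 ^ w := Nat.lt_two_pow_self
  have hs : o % w ≤ w := (Nat.mod_lt _ (by omega)).le
  have hb' : 2 ^ b < 2 ^ w := Nat.pow_lt_pow_right one_lt_two hb
  have hdiv := val_div he (val_cst (v := w) hw) (by omega)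
  have hmod := val_mod he (val_cst (v := w) hw) (by omega)
  have hnext := val_add hdiv (val_cst (v := 1) (by omega))
    ((Nat.add_le_add_right (Nat.div_le_self _ _) 1).trans_lt ho)
  have hshift := val_sub (val_cst (v := w) hw) hmod hw hs
  have hlow := val_bin .shr (val_load hdiv) hmod
  have hhigh := val_bin .shl (val_load hnext) hshift
  rw [field, val_mod (val_bin .add hlow hhigh) (val_cst hb') (Nat.mod_lt _ (by positivity))]
  simp only [WordOp.eval]
  rw [memWord_memOf hM, memWord_memOf hM, add_mul, one_mul, pow_add, ← Nat.div_div_eq_div_mul]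
  refine (shift_words_modEq hs hb.le).trans ?_
  rw [Nat.div_div_eq_div_mul, ← pow_add, Nat.div_add_mod']

/-- Entry `e` of the array of `b`-bit numbers starting at bit position `o`. -/
def entry (w o b : ℕ) (e : Expr) : Expr :=
  field w (bin .add (cst o) (bin .mul e (cst b))) b

lemma size_entry (w o b : ℕ) (e : Expr) : (entry w o b e).size = 4 * e.size + 35 := by
  simp only [entry, field, size]
  ring

lemma constsLt_entry {w o b B : ℕ} {e : Expr} (he : e.ConstsLt B) (hw : w < B) (ho : o < B)
    (hb : 2 ^ b < B) : (entry w o b e).ConstsLt B := by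
  have hpos : 0 < 2 ^ b := by positivity
  have hB : 1 < B := by omega
  have hb' : b < B := Nat.lt_two_pow_self.trans hb
  simp [entry, field, ConstsLt, *]

lemma val_entry {n w B M x o b : ℕ} {a : Fin n → ℕ} {e : Expr} {i : Fin n} (hM : M < 2 ^ B)
    (ha : StoresArray M o b a) (he : e.val w (memOf B M) x = i) (ho : o + n * b + 1 < 2 ^ w)
    (hb : b < w) : (entry w o b e).val w (memOf B M) x = a i := by
  have hi : i * b ≤ n * b := Nat.mul_le_mul_right b i.isLt.le
  have hmul := val_mul he (val_cst (v := b) (hb.trans Nat.lt_two_pow_self)) (by omega)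
  rw [entry, val_field hM (val_add (val_cst (v := o) (by omega)) hmul (by omega)) (by omega) hb]
  exact ha i

end Expr

/-! ### The evaluation program -/

/-- The parameters of the data structure for `n` keys: the class that collapses the universe, the
number `k` of table entries packed into one block, the parameters `c`, `l`, `m` of the class
`𝒵^{c,2}_{l,m}`, and the prime modulus `pF` of the functions `g_j`. The inequalities make all
numbers that occur in the evaluation fit into words. -/
structure Layout (n u r : ℕ) where
  𝒞 : CollapseClass u
  (k c l m pF : ℕ)
  u_large : 16 ≤ u
  n_le : n ≤ u
  two_le_r : 2 ≤ r
  r_le : r ≤ u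
  two_le_l : 2 ≤ l
  l_le : l ≤ n
  small : 4 * c + 3 * Nat.clog l 𝒞.N + 5 ≤ n
  m_pos : 0 < m
  m_le : m ≤ 2 * n
  k_pos : 0 < k
  k_le : k ≤ n
  r_pow_le : r ^ k ≤ u
  prime_pF : pF.Prime
  N_le_pF : 𝒞.N ≤ pF
  pF_le : pF ≤ 2 * 𝒞.N

open _root_.UniformHashing.Expr

namespace Layout

variable {n u r : ℕ} (L : Layout n u r)

instance : NeZero L.l := ⟨by have := L.two_le_l; omega⟩

instance : NeZero L.m := ⟨L.m_pos.ne'⟩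

instance : NeZero (L.pF - 1) := ⟨by have := L.prime_pF.two_le; omega⟩

/-- The number of digits in base `l` of a key of the collapsed universe, that is, the number of
tables of a simple tabulation hash function. -/
def q : ℕ := Nat.clog L.l L.𝒞.N

/-- The word length. -/
def w (_ : Layout n u r) : ℕ := 8 * Nat.clog 2 u

/-- The number of bits of the two numbers describing the collapsing function. -/
def wp : ℕ := L.𝒞.p.size

/-- The number of bits of an entry of the small tables. -/
def wt : ℕ := Nat.clog 2 (L.pF + L.m + r)

/-- The number of bits of a block of `k` entries of `t₁` and `t₂`. -/
def wb : ℕ := Nat.clog 2 (r ^ L.k)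

/-- The number of blocks into which `t₁` and `t₂` are cut. -/
def blocks : ℕ := 2 * L.m / L.k + 1

/-- The small tables: those of `f₁` and `f₂` and the tables `z⁽¹⁾`, `z⁽²⁾`; those of `f` and the
tables `y_j`; and, for each `j`, a table that is constantly equal to the multiplier of `g_j`. -/
abbrev Row : Type := (Fin 2 × (Fin L.q ⊕ Fin L.c)) ⊕ ((Fin L.q ⊕ Fin L.c) ⊕ Fin L.c)

lemma card_row : Fintype.card L.Row = 4 * L.c + 3 * L.q := by
  simp only [Fintype.card_sum, Fintype.card_prod, Fintype.card_fin]
  ring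

/-- The memory position of the blocks' part: the powers of `r` below `r ^ k`, then the blocks. -/
def start : ℕ := 2 * L.wp + Fintype.card L.Row * L.l * L.wt

/-- The number of memory bits. -/
def bits : ℕ := L.start + L.k * L.wb + L.blocks * L.wb

/-- The key's image in the collapsed universe. -/
def collapsedE : Expr :=
  bin .mod (bin .mod (bin .mul (bin .mod key (entry L.w 0 L.wp (cst 0)))
    (entry L.w 0 L.wp (cst 1))) (cst L.𝒞.p)) (cst L.𝒞.N)

/-- Entry `e` of a small table. -/
noncomputable def rowE (τ : L.Row) (e : Expr) : Expr :=
  entry L.w (2 * L.wp + Fintype.equivFin L.Row τ * L.l * L.wt) L.wt e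

/-- The value of `g_j`. -/
noncomputable def gE (j : Fin L.c) : Expr :=
  bin .mod (bin .mod (bin .mul L.collapsedE (L.rowE (.inr (.inr j)) (cst 0))) (cst L.pF))
    (cst L.l)

/-- The `d`-th digit of the collapsed key. -/
def digitE (d : ℕ) : Expr := bin .mod (bin .div L.collapsedE (cst (L.l ^ d))) (cst L.l)

/-- A simple tabulation plus the sum of lookups at the places `g_j`. -/
noncomputable def lookupE (ρ : Fin L.q ⊕ Fin L.c → L.Row) : Expr :=
  bin .add (sum L.q fun d => L.rowE (ρ (.inl d)) (L.digitE d))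
    (sum L.c fun j => L.rowE (ρ (.inr j)) (L.gE j))

/-- The position `i m + h_i` in the concatenation of `t₁` and `t₂`. -/
noncomputable def indexE (i : Fin 2) : Expr :=
  bin .add (cst (i * L.m)) (bin .mod (L.lookupE fun s => .inl (i, s)) (cst L.m))

/-- The value `t_i[h_i]`, a digit of a block in base `r`. -/
noncomputable def entryE (i : Fin 2) : Expr :=
  bin .mod (bin .div (entry L.w (L.start + L.k * L.wb) L.wb (bin .div (L.indexE i) (cst L.k)))
    (entry L.w L.start L.wb (bin .mod (L.indexE i) (cst L.k)))) (cst r)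

/-- The hash value. -/
noncomputable def hashE : Expr :=
  bin .mod (bin .add (bin .add (L.entryE 0) (L.entryE 1)) (L.lookupE fun s => .inr (.inl s)))
    (cst r)

lemma size_collapsedE : L.collapsedE.size = 85 := by
  simp [collapsedE, size, size_entry]

lemma size_lookupE (ρ : Fin L.q ⊕ Fin L.c → L.Row) :
    (L.lookupE ρ).size = L.q * 392 + L.c * 552 + 3 := by
  have hdigit (d) : (L.rowE (ρ (.inl d)) (L.digitE d)).size = 391 := by
    simp [rowE, digitE, size, size_entry, size_collapsedE]
  have hg (j) : (L.rowE (ρ (.inr j)) (L.gE j)).size = 551 := by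
    simp [rowE, gE, size, size_entry, size_collapsedE]
  rw [lookupE, size, size_sum hdigit, size_sum hg]
  ring

lemma size_hashE : L.hashE.size ≤ 10000 * (L.c + L.q + 1) := by
  simp only [hashE, entryE, indexE, size, size_entry, size_lookupE]
  omega

lemma row_add_le_start (τ : L.Row) :
    2 * L.wp + Fintype.equivFin L.Row τ * L.l * L.wt + L.l * L.wt ≤ L.start := by
  have h := Nat.mul_le_mul_right (L.l * L.wt) (Nat.succ_le_of_lt (Fintype.equivFin L.Row τ).isLt)
  rw [Nat.succ_mul] at h
  rw [start]
  nlinarith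

lemma constsLt_lookupE {B : ℕ} (ρ : Fin L.q ⊕ Fin L.c → L.Row) (hw : L.w < B)
    (hp : 2 ^ L.wp < B) (ht : 2 ^ L.wt < B) (hF : L.pF < B) (hl : L.l < B)
    (hdigit : ∀ d < L.q, L.l ^ d < B) (hbits : L.bits < B) : (L.lookupE ρ).ConstsLt B := by
  have hstart : L.start ≤ L.bits := by unfold bits; omega
  have hpB : L.𝒞.p < B := (Nat.lt_size_self _).trans hp
  have hB : 1 < B := Nat.one_le_two_pow.trans_lt ht
  have hcollapsed : L.collapsedE.ConstsLt B :=
    ⟨⟨⟨⟨trivial, constsLt_entry (by simp [ConstsLt]; omega) hw (by omega) hp⟩,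
      constsLt_entry hB hw (by omega) hp⟩, hpB⟩, L.𝒞.N_le_p.trans_lt hpB⟩
  have hrow (τ : L.Row) (e : Expr) (he : e.ConstsLt B) : (L.rowE τ e).ConstsLt B :=
    constsLt_entry he hw (by have := L.row_add_le_start τ; omega) ht
  refine ⟨constsLt_sum (by omega) fun d => hrow _ _ ⟨⟨hcollapsed, hdigit d d.2⟩, hl⟩,
    constsLt_sum (by omega) fun j => hrow _ _ ⟨⟨⟨hcollapsed, hrow _ _ ?_⟩, hF⟩, hl⟩⟩
  exact (Nat.zero_lt_one.trans hB :)

lemma constsLt_hashE {B : ℕ} (hw : L.w < B) (hp : 2 ^ L.wp < B) (ht : 2 ^ L.wt < B)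
    (hb : 2 ^ L.wb < B) (hF : L.pF < B) (hl : L.l < B) (hdigit : ∀ d < L.q, L.l ^ d < B)
    (hbits : L.bits < B) (hm : L.m < B) (hk : L.k < B) (hr : r < B) : L.hashE.ConstsLt B := by
  have hlookup (ρ) : (L.lookupE ρ).ConstsLt B :=
    L.constsLt_lookupE ρ hw hp ht hF hl hdigit hbits
  have hindex (i : Fin 2) : (L.indexE i).ConstsLt B := by
    refine ⟨?_, hlookup _, hm⟩
    have : (i : ℕ) * L.m ≤ 1 * L.m := Nat.mul_le_mul_right _ (by omega)
    exact (this.trans_eq (one_mul _)).trans_lt hm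
  have hentry (i : Fin 2) : (L.entryE i).ConstsLt B :=
    ⟨⟨constsLt_entry ⟨hindex i, hk⟩ hw (by unfold bits at hbits; omega) hb,
      constsLt_entry ⟨hindex i, hk⟩ hw (by unfold bits at hbits; omega) hb⟩, hr⟩
  exact ⟨⟨⟨hentry 0, hentry 1⟩, hlookup _⟩, hr⟩

end Layout

lemma two_pow_clog_le {x : ℕ} (hx : 0 < x) : 2 ^ Nat.clog 2 x ≤ 2 * x := by
  obtain rfl | hx := (show 1 ≤ x from hx).eq_or_lt
  · simp
  · obtain ⟨j, hj⟩ := Nat.exists_eq_succ_of_ne_zero (Nat.clog_pos one_lt_two hx).ne'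
    have := Nat.pow_pred_clog_lt_self one_lt_two hx
    rw [hj] at this ⊢
    rw [pow_succ']
    exact Nat.mul_le_mul_left 2 this.le

lemma two_pow_size_le {x : ℕ} (hx : 0 < x) : 2 ^ x.size ≤ 2 * x := by
  obtain ⟨j, hj⟩ := Nat.exists_eq_succ_of_ne_zero (Nat.size_pos.2 hx).ne'
  rw [hj, pow_succ']
  exact Nat.mul_le_mul_left 2 (Nat.lt_size.1 (by omega))

namespace Layout

variable {n u r : ℕ} (L : Layout n u r)

lemma N_pos : 0 < L.𝒞.N := NeZero.pos _

lemma p_pos : 0 < L.𝒞.p := L.N_pos.trans_le L.𝒞.N_le_p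

include L in
lemma one_le_n : 1 ≤ n := by have := L.small; omega

include L in
lemma two_le_u : 2 ≤ u := L.two_le_r.trans L.r_le

lemma pow_lt_N {d : ℕ} (hd : d < L.q) : L.l ^ d < L.𝒞.N :=
  lt_of_not_ge fun h => hd.not_ge (Nat.clog_le_of_le_pow h)

lemma N_le_pow : L.𝒞.N ≤ L.l ^ L.q := Nat.le_pow_clog L.two_le_l _

lemma lt_two_pow_w {a : ℕ} (ha : a < 256 * u ^ 6) : a < 2 ^ L.w := by
  have hu : 16 ^ 2 ≤ u ^ 2 := Nat.pow_le_pow_left L.u_large 2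
  calc a < 256 * u ^ 6 := ha
    _ ≤ u ^ 2 * u ^ 6 := Nat.mul_le_mul_right _ hu
    _ = u ^ 8 := by ring
    _ ≤ (2 ^ Nat.clog 2 u) ^ 8 := Nat.pow_le_pow_left (Nat.le_pow_clog one_lt_two u) 8
    _ = 2 ^ L.w := by rw [w, mul_comm, pow_mul]

lemma mul_lt_two_pow_w {a b : ℕ} (ha : a ≤ 10 * u) (hb : b ≤ 10 * u) : a * b < 2 ^ L.w := by
  have hu : 0 < u := by have := L.u_large; omega
  refine L.lt_two_pow_w ?_
  calc a * b ≤ 10 * u * (10 * u) := Nat.mul_le_mul ha hb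
    _ = 100 * u ^ 2 := by ring
    _ < 256 * u ^ 2 := by have := pow_pos hu 2; omega
    _ ≤ 256 * u ^ 6 := by gcongr; omega

lemma lt_two_pow_w_of_le {a : ℕ} (ha : a ≤ 10 * u) : a < 2 ^ L.w := by
  simpa using L.mul_lt_two_pow_w ha (b := 1) (by have := L.u_large; omega)

lemma mul_p_lt_two_pow_w {a : ℕ} (ha : a ≤ u) : a * L.𝒞.p < 2 ^ L.w := by
  have hu : 0 < u := by have := L.u_large; omega
  refine L.lt_two_pow_w ?_
  calc a * L.𝒞.p ≤ u * (128 * u ^ 4) := Nat.mul_le_mul ha L.𝒞.p_le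
    _ = 128 * u ^ 5 := by ring
    _ < 256 * u ^ 5 := by have := pow_pos hu 5; omega
    _ ≤ 256 * u ^ 6 := by gcongr; omega

lemma wp_lt : L.wp < L.w := by
  refine (Nat.pow_lt_pow_iff_right one_lt_two).1 ((two_pow_size_le L.p_pos).trans_lt ?_)
  exact L.mul_p_lt_two_pow_w (by have := L.u_large; omega)

lemma wt_lt : L.wt < L.w := by
  refine (Nat.pow_lt_pow_iff_right one_lt_two).1 ((two_pow_clog_le ?_).trans_lt ?_)
  · have := L.m_pos
    omega
  · have := L.pF_le
    have := L.𝒞.N_le_u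
    have := L.m_le
    have := L.n_le
    have := L.r_le
    exact L.mul_lt_two_pow_w (by have := L.u_large; omega) (by omega)

lemma wb_lt : L.wb < L.w := by
  have hle : L.wb ≤ Nat.clog 2 u := Nat.clog_mono_right 2 L.r_pow_le
  have hpos : 0 < Nat.clog 2 u := Nat.clog_pos one_lt_two (by have := L.u_large; omega)
  unfold w
  omega

lemma bits_le : L.bits ≤ 9 * n ^ 2 * L.w := by
  have hblocks : L.k + L.blocks ≤ 5 * n + 1 := by
    have := Nat.div_le_self (2 * L.m) L.k
    have := L.k_le
    have := L.m_le
    unfold blocks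
    omega
  have hrow : Fintype.card L.Row ≤ n := by
    have := L.small
    rw [card_row, q]
    omega
  have hn : 5 ≤ n := by have := L.small; omega
  calc L.bits = 2 * L.wp + Fintype.card L.Row * L.l * L.wt + (L.k + L.blocks) * L.wb := by
        rw [bits, start]
        ring
    _ ≤ 2 * L.w + n * n * L.w + (5 * n + 1) * L.w := by
        gcongr
        exacts [L.wp_lt.le, L.l_le, L.wt_lt.le, L.wb_lt.le]
    _ = (n * n + 5 * n + 3) * L.w := by ring
    _ ≤ 9 * n ^ 2 * L.w := Nat.mul_le_mul_right _ (by nlinarith)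

lemma bits_lt : L.bits + 1 < 2 ^ L.w := by
  have hu := L.u_large
  refine L.lt_two_pow_w ?_
  calc L.bits + 1 ≤ 9 * u ^ 2 * (8 * u) + 1 := by
        refine Nat.succ_le_succ (L.bits_le.trans ?_)
        unfold w
        gcongr
        exacts [L.n_le, clog_two_le_self u]
    _ = 72 * u ^ 3 + 1 := by ring
    _ < 256 * u ^ 3 := by have := pow_pos (show 0 < u by omega) 3; omega
    _ ≤ 256 * u ^ 6 := by gcongr <;> omega

end Layout

lemma StoresArray.row {a l M o b : ℕ} {f : Fin a → Fin l → ℕ}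
    (h : StoresArray M o b fun s : Fin (a * l) => f (finProdFinEquiv.symm s).1
      (finProdFinEquiv.symm s).2) (i : Fin a) :
    StoresArray M (o + i * l * b) b (f i) := by
  intro v
  have := h (finProdFinEquiv (i, v))
  simp only [Equiv.symm_apply_apply, finProdFinEquiv_apply_val] at this
  rw [← this]
  congr 3
  ring

namespace Layout

variable {n u r : ℕ} (L : Layout n u r)

/-- The random choices. -/
abbrev Seed : Type :=
  DSSeed L.𝒞.card (Fintype.card (Fin L.q → Fin L.l → Fin L.m)) (L.pF - 1)
    (Fintype.card (Fin L.q → Fin L.l → Fin r)) L.c L.l L.m r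

variable (ω : L.Seed)

/-- The entries of the small tables. -/
noncomputable def rowData : L.Row → Fin L.l → ℕ
  | .inl (i, .inl d), v => tabEquiv _ _ _ (ω.2.1.1 i) d v
  | .inl (i, .inr j), v => ω.2.1.2.2 i j v
  | .inr (.inl (.inl d)), v => tabEquiv _ _ _ ω.2.2.2.2 d v
  | .inr (.inl (.inr j)), v => ω.2.2.2.1 j v
  | .inr (.inr j), _ => ω.2.1.2.1 j + 1

lemma rowData_lt (τ : L.Row) (v : Fin L.l) : L.rowData ω τ v < 2 ^ L.wt := by
  have hm : L.m ≤ L.pF + L.m + r := by omega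
  have hr : r ≤ L.pF + L.m + r := by omega
  refine lt_of_lt_of_le ?_ (Nat.le_pow_clog one_lt_two (L.pF + L.m + r))
  match τ with
  | .inl (i, .inl d) => exact (Fin.isLt _).trans_le hm
  | .inl (i, .inr j) => exact (Fin.isLt _).trans_le hm
  | .inr (.inl (.inl d)) => exact (Fin.isLt _).trans_le hr
  | .inr (.inl (.inr j)) => exact (Fin.isLt _).trans_le hr
  | .inr (.inr j) =>
    have := (ω.2.1.2.1 j).isLt
    simp only [rowData]
    omega

variable [NeZero r]

/-- The concatenation of `t₁` and `t₂`, continued by zeros. -/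
def tableEntry (s : ℕ) : Fin r :=
  if h : s < 2 * L.m then
    ω.2.2.1 (finProdFinEquiv.symm ⟨s, h⟩).1 (finProdFinEquiv.symm ⟨s, h⟩).2
  else 0

lemma tableEntry_mul_add (i : Fin 2) (v : Fin L.m) :
    L.tableEntry ω (i * L.m + v) = ω.2.2.1 i v := by
  have h : (finProdFinEquiv (i, v) : ℕ) = i * L.m + v := by
    rw [finProdFinEquiv_apply_val, add_comm, mul_comm]
  rw [← h, tableEntry, dif_pos (finProdFinEquiv (i, v)).isLt, Fin.eta,
    Equiv.symm_apply_apply]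

/-- Block `s` of the concatenation of `t₁` and `t₂`, as a number in base `r`. -/
def block (s : ℕ) : Fin (r ^ L.k) :=
  finFunctionFinEquiv fun e : Fin L.k => L.tableEntry ω (s * L.k + e)

lemma block_div_pow_mod (s : ℕ) :
    (L.block ω (s / L.k) : ℕ) / r ^ (s % L.k) % r = L.tableEntry ω s := by
  have := finFunctionFinEquiv_div_pow_mod
    (fun e : Fin L.k => L.tableEntry ω (s / L.k * L.k + e)) ⟨s % L.k, Nat.mod_lt _ L.k_pos⟩
  rwa [Nat.div_add_mod'] at this

/-- The number `M` encodes the random choices `ω`: its binary digits consist of the description of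
the collapsing function, the small tables, the powers of `r` and the blocks of `t₁` and `t₂`. -/
structure Encodes (M : ℕ) : Prop where
  lt : M < 2 ^ L.bits
  header : StoresArray M 0 L.wp ![L.𝒞.P ω.1, L.𝒞.A ω.1]
  row : ∀ τ, StoresArray M (2 * L.wp + Fintype.equivFin L.Row τ * L.l * L.wt) L.wt (L.rowData ω τ)
  powers : StoresArray M L.start L.wb fun e : Fin L.k => r ^ (e : ℕ)
  blocks : StoresArray M (L.start + L.k * L.wb) L.wb fun s : Fin L.blocks => (L.block ω s : ℕ)

lemma exists_encodes : ∃ M, L.Encodes ω M := by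
  have hp : L.𝒞.p < 2 ^ L.wp := Nat.lt_size_self _
  have hb : r ^ L.k ≤ 2 ^ L.wb := Nat.le_pow_clog one_lt_two _
  have hheader (i : Fin 2) : ![L.𝒞.P ω.1, L.𝒞.A ω.1] i < 2 ^ L.wp := by
    fin_cases i
    exacts [(L.𝒞.P_le _).trans_lt hp, (L.𝒞.A_le _).trans_lt hp]
  obtain ⟨M₁, hlt₁, -, hM₁⟩ :=
    exists_append_array (M := 0) (o := 0) (by simp) _ hheader
  obtain ⟨M₂, hlt₂, hmod₂, hM₂⟩ := exists_append_array hlt₁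
    (fun s : Fin (Fintype.card L.Row * L.l) =>
      L.rowData ω ((Fintype.equivFin L.Row).symm (finProdFinEquiv.symm s).1)
        (finProdFinEquiv.symm s).2) fun s => L.rowData_lt ω _ _
  obtain ⟨M₃, hlt₃, hmod₃, hM₃⟩ := exists_append_array hlt₂
    (fun e : Fin L.k => r ^ (e : ℕ))
    fun e => (Nat.pow_lt_pow_right L.two_le_r e.isLt).trans_le hb
  obtain ⟨M₄, hlt₄, hmod₄, hM₄⟩ := exists_append_array hlt₃
    (fun s : Fin L.blocks => (L.block ω s : ℕ)) fun s => (Fin.isLt _).trans_le hb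
  simp only [zero_add] at *
  have hrows := (hM₂.of_mod_eq hmod₃ le_rfl).of_mod_eq hmod₄ (Nat.le_add_right _ _)
  refine ⟨M₄, hlt₄, ?_, fun τ => ?_, hM₃.of_mod_eq hmod₄ le_rfl, hM₄⟩
  · exact ((hM₁.of_mod_eq hmod₂ (by simp)).of_mod_eq hmod₃ (by omega)).of_mod_eq hmod₄ (by omega)
  · simpa using StoresArray.row (f := fun i => L.rowData ω ((Fintype.equivFin L.Row).symm i)) hrows
      (Fintype.equivFin L.Row τ)

end Layout

namespace Layout

variable {n u r : ℕ} (L : Layout n u r)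

/-- The functions `g_j`. -/
abbrev multClass : Fin (L.pF - 1) → Fin L.𝒞.N → Fin L.l := mulClass L.pF L.l L.𝒞.N

/-- The functions `f₁` and `f₂`. -/
noncomputable abbrev tabClassH :
    Fin (Fintype.card (Fin L.q → Fin L.l → Fin L.m)) → Fin L.𝒞.N → Fin L.m :=
  tabClass L.q L.l L.m L.𝒞.N

/-- The functions `f`. -/
noncomputable abbrev tabClassK [NeZero r] :
    Fin (Fintype.card (Fin L.q → Fin L.l → Fin r)) → Fin L.𝒞.N → Fin r :=
  tabClass L.q L.l r L.𝒞.N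

/-- The value of `lookupE` for the collapsed key `y`. -/
noncomputable def lookup (ω : L.Seed) (ρ : Fin L.q ⊕ Fin L.c → L.Row) (y : Fin L.𝒞.N) : ℕ :=
  ∑ d, L.rowData ω (ρ (.inl d)) (digit L.l d y)
    + ∑ j, L.rowData ω (ρ (.inr j)) (L.multClass (ω.2.1.2.1 j) y)

lemma lookup_inl_mod (ω : L.Seed) (i : Fin 2) (y : Fin L.𝒞.N) :
    L.lookup ω (fun s => .inl (i, s)) y % L.m = zHash L.tabClassH L.multClass ω.2.1 i y := by
  simp only [lookup, rowData, zHash, tabClass, tabulate, fin_val_sum, Nat.mod_add_mod]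

lemma lookup_inr_mod [NeZero r] (ω : L.Seed) (y : Fin L.𝒞.N) :
    L.lookup ω (fun s => .inr (.inl s)) y % r = (L.tabClassK ω.2.2.2.2 y
      + ∑ j, (ω.2.2.2.1 j (L.multClass (ω.2.1.2.1 j) y) : ℕ)) % r := by
  simp only [lookup, rowData, tabClass, tabulate, fin_val_sum, Nat.mod_add_mod]

lemma r_le_two_pow_wt : r ≤ 2 ^ L.wt :=
  (Nat.le_add_left r (L.pF + L.m)).trans (Nat.le_pow_clog one_lt_two _)

lemma lookup_add_lt (ω : L.Seed) (ρ : Fin L.q ⊕ Fin L.c → L.Row) (y : Fin L.𝒞.N) :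
    L.lookup ω ρ y + 2 * 2 ^ L.wt < 2 ^ L.w := by
  have hwt : 2 ^ L.wt ≤ 10 * u := by
    have := L.pF_le
    have := L.𝒞.N_le_u
    have := L.m_le
    have := L.n_le
    have := L.r_le
    exact (two_pow_clog_le (by have := L.m_pos; omega)).trans (by omega)
  have hn : L.q + L.c + 2 ≤ u := by
    have := L.small
    have := L.n_le
    unfold q
    omega
  have hdigits : ∑ d, L.rowData ω (ρ (.inl d)) (digit L.l d y) ≤ L.q * 2 ^ L.wt := by
    simpa using Finset.sum_le_card_nsmul (Finset.univ : Finset (Fin L.q)) _ _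
      fun d _ => (L.rowData_lt ω (ρ (.inl d)) (digit L.l d y)).le
  have hg : ∑ j, L.rowData ω (ρ (.inr j)) (L.multClass (ω.2.1.2.1 j) y) ≤ L.c * 2 ^ L.wt := by
    simpa using Finset.sum_le_card_nsmul (Finset.univ : Finset (Fin L.c)) _ _
      fun j _ => (L.rowData_lt ω (ρ (.inr j)) (L.multClass (ω.2.1.2.1 j) y)).le
  calc L.lookup ω ρ y + 2 * 2 ^ L.wt ≤ (L.q + L.c + 2) * 2 ^ L.wt := by
        unfold lookup
        linarith
    _ < 2 ^ L.w := L.mul_lt_two_pow_w (by omega) hwt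

/-- The value of an expression for the key `x` and the memory encoded by `M`. -/
abbrev evalE (M : ℕ) (x : Fin u) (e : Expr) : ℕ := e.val L.w (memOf L.bits M) x

section Correctness

variable {L} [NeZero r] {ω : L.Seed} {M : ℕ} (hM : L.Encodes ω M) (x : Fin u)
include hM

lemma Encodes.val_collapsedE : L.evalE M x L.collapsedE = L.𝒞.col ω.1 x := by
  have hu : u < 2 ^ L.w := L.lt_two_pow_w_of_le (by omega)
  have hp : L.𝒞.p < 2 ^ L.w := by simpa using L.mul_p_lt_two_pow_w (a := 1) (by have := x.2; omega)
  have hoff : 0 + 2 * L.wp + 1 < 2 ^ L.w := by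
    have := L.bits_lt
    unfold bits start at this
    omega
  have hone : 1 < 2 ^ L.w := Nat.one_lt_two_pow (by have := L.wp_lt; omega)
  have hP := val_entry (x := x) hM.lt hM.header (i := 0) (val_cst (by simp)) hoff L.wp_lt
  have hA := val_entry (x := x) hM.lt hM.header (i := 1) (val_cst hone) hoff L.wp_lt
  have hmul : x % L.𝒞.P ω.1 * L.𝒞.A ω.1 < 2 ^ L.w :=
    (Nat.mul_le_mul_left _ (L.𝒞.A_le _)).trans_lt
      (L.mul_p_lt_two_pow_w ((Nat.mod_le _ _).trans x.2.le))
  exact val_mod (val_mod (val_mul (val_mod (val_key (x.2.trans hu)) hP (x.2.trans hu)) hA hmul)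
    (val_cst hp) hmul) (val_cst (L.𝒞.N_le_p.trans_lt hp)) ((Nat.mod_le _ _).trans_lt hmul)

lemma Encodes.val_rowE (τ : L.Row) {e : Expr} {v : Fin L.l} (he : L.evalE M x e = v) :
    L.evalE M x (L.rowE τ e) = L.rowData ω τ v := by
  have := L.row_add_le_start τ
  have := L.bits_lt
  refine val_entry hM.lt (hM.row τ) he ?_ L.wt_lt
  unfold bits at this
  omega

lemma Encodes.val_gE (j : Fin L.c) :
    L.evalE M x (L.gE j) = L.multClass (ω.2.1.2.1 j) (L.𝒞.col ω.1 x) := by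
  have hN := L.𝒞.N_le_u
  have hF := L.pF_le
  have hmul : (L.𝒞.col ω.1 x : ℕ) * (ω.2.1.2.1 j + 1) < 2 ^ L.w :=
    L.mul_lt_two_pow_w (by omega) (by have := (ω.2.1.2.1 j).2; omega)
  have ha := hM.val_rowE x (.inr (.inr j)) (e := cst 0) (v := 0) (val_cst (by simp))
  exact val_mod (val_mod (val_mul (hM.val_collapsedE x) ha hmul)
    (val_cst (L.lt_two_pow_w_of_le (by omega))) hmul)
    (val_cst (L.lt_two_pow_w_of_le (by have := L.l_le; have := L.n_le; omega)))
    ((Nat.mod_le _ _).trans_lt hmul)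

lemma Encodes.val_digitE (d : Fin L.q) :
    L.evalE M x (L.digitE d) = digit L.l d (L.𝒞.col ω.1 x) := by
  have hN := L.𝒞.N_le_u
  have hx : (L.𝒞.col ω.1 x : ℕ) < 2 ^ L.w := L.lt_two_pow_w_of_le (by omega)
  have hpow : L.l ^ (d : ℕ) < 2 ^ L.w := L.lt_two_pow_w_of_le (by have := L.pow_lt_N d.2; omega)
  exact val_mod (val_div (hM.val_collapsedE x) (val_cst hpow) hx)
    (val_cst (L.lt_two_pow_w_of_le (by have := L.l_le; have := L.n_le; omega)))
    ((Nat.div_le_self _ _).trans_lt hx)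

lemma Encodes.val_lookupE (ρ : Fin L.q ⊕ Fin L.c → L.Row) :
    L.evalE M x (L.lookupE ρ) = L.lookup ω ρ (L.𝒞.col ω.1 x) := by
  have hlt := L.lookup_add_lt ω ρ (L.𝒞.col ω.1 x)
  refine val_add (val_sum (fun d => hM.val_rowE x _ (hM.val_digitE x d)) ?_)
    (val_sum (fun j => hM.val_rowE x _ (hM.val_gE x j)) ?_) ?_ <;>
  · unfold lookup at hlt
    omega

lemma Encodes.val_indexE (i : Fin 2) : L.evalE M x (L.indexE i)
    = i * L.m + zHash L.tabClassH L.multClass ω.2.1 i (L.𝒞.col ω.1 x) := by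
  have hlt := L.lookup_add_lt ω (fun s => .inl (i, s)) (L.𝒞.col ω.1 x)
  have hm : L.m ≤ 2 * u := L.m_le.trans (Nat.mul_le_mul_left 2 L.n_le)
  have hi : (i : ℕ) * L.m ≤ 1 * L.m := Nat.mul_le_mul_right _ (by omega)
  rw [← lookup_inl_mod]
  have hmod := Nat.mod_lt (L.lookup ω (fun s => .inl (i, s)) (L.𝒞.col ω.1 x)) L.m_pos
  exact val_add (val_cst (L.lt_two_pow_w_of_le (by omega)))
    (val_mod (hM.val_lookupE x _) (val_cst (L.lt_two_pow_w_of_le (by omega))) (by omega))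
    (L.lt_two_pow_w_of_le (by omega))

lemma Encodes.val_entryE (i : Fin 2) : L.evalE M x (L.entryE i)
    = ω.2.2.1 i (zHash L.tabClassH L.multClass ω.2.1 i (L.𝒞.col ω.1 x)) := by
  rw [← tableEntry_mul_add, ← block_div_pow_mod]
  have hindex := hM.val_indexE x i
  set z := zHash L.tabClassH L.multClass ω.2.1 i (L.𝒞.col ω.1 x)
  have hs : i * L.m + z < 2 * L.m := by
    have : (i : ℕ) * L.m ≤ 1 * L.m := Nat.mul_le_mul_right _ (by omega)
    omega
  have hm := L.m_le
  have hn := L.n_le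
  have hk := L.k_le
  have hbits := L.bits_lt
  unfold bits at hbits
  have hsw : i * L.m + z < 2 ^ L.w := L.lt_two_pow_w_of_le (by omega)
  have hkw : L.k < 2 ^ L.w := L.lt_two_pow_w_of_le (by omega)
  have hblock : (i * L.m + z) / L.k < L.blocks :=
    Nat.lt_succ_of_le (Nat.div_le_div_right hs.le)
  have hpow := val_entry hM.lt hM.powers (i := ⟨_, Nat.mod_lt _ L.k_pos⟩)
    (val_mod hindex (val_cst hkw) hsw) (by omega) L.wb_lt
  have hb := val_entry hM.lt hM.blocks (i := ⟨_, hblock⟩)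
    (val_div hindex (val_cst hkw) hsw) (by omega) L.wb_lt
  have hlt : (L.block ω ((i * L.m + z) / L.k) : ℕ) < 2 ^ L.w :=
    L.lt_two_pow_w_of_le (by have := L.r_pow_le; omega)
  exact val_mod (val_div hb hpow hlt)
    (val_cst (L.lt_two_pow_w_of_le (by have := L.r_le; omega)))
    ((Nat.div_le_self _ _).trans_lt hlt)

theorem Encodes.val_hashE :
    L.evalE M x L.hashE = dsHash L.𝒞.col L.tabClassH L.multClass L.tabClassK ω x := by
  have hlt := L.lookup_add_lt ω (fun s => .inr (.inl s)) (L.𝒞.col ω.1 x)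
  have hr := L.r_le_two_pow_wt
  have h₀ := (ω.2.2.1 0 (zHash L.tabClassH L.multClass ω.2.1 0 (L.𝒞.col ω.1 x))).2
  have h₁ := (ω.2.2.1 1 (zHash L.tabClassH L.multClass ω.2.1 1 (L.𝒞.col ω.1 x))).2
  have hrw : r < 2 ^ L.w := L.lt_two_pow_w_of_le (by have := L.r_le; omega)
  refine (val_mod (val_add (val_add (hM.val_entryE x 0) (hM.val_entryE x 1) ?_)
    (hM.val_lookupE x _) ?_) (val_cst hrw) ?_).trans ?_
  any_goals omega
  rw [Nat.add_mod, lookup_inr_mod, ← Nat.add_mod, ← add_assoc]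
  rfl

end Correctness

/-- The data structure with the given parameters. -/
noncomputable def ds [NeZero r] : HashDS u r L.w where
  Ω := L.Seed
  memBits := L.bits
  mem ω := memOf L.bits (L.exists_encodes ω).choose
  prog := L.hashE.code 1
  h := dsFun L.𝒞.col L.tabClassH L.multClass L.tabClassK
  run_eq ω x := by
    rw [run_code]
    exact (L.exists_encodes ω).choose_spec.val_hashE x

end Layout

/-! ### Space -/

lemma one_le_logb_two {x : ℝ} (hx : 2 ≤ x) : 1 ≤ Real.logb 2 x := by
  rwa [Real.le_logb_iff_rpow_le one_lt_two (by linarith), Real.rpow_one]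

lemma logb_two_nonneg {x : ℝ} (hx : 2 ≤ x) : 0 ≤ Real.logb 2 x :=
  zero_le_one.trans (one_le_logb_two hx)

lemma logb_logb_two_nonneg {x : ℝ} (hx : 2 ≤ x) : 0 ≤ Real.logb 2 (Real.logb 2 x) :=
  Real.logb_nonneg one_lt_two (one_le_logb_two hx)

lemma le_logb_of_two_pow_le {a : ℕ} {x : ℝ} (h : 2 ^ a ≤ x) : (a : ℝ) ≤ Real.logb 2 x := by
  rwa [Real.le_logb_iff_rpow_le one_lt_two (lt_of_lt_of_le (by positivity) h), Real.rpow_natCast]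

lemma clog_two_le_logb_add_one {a : ℕ} (ha : 0 < a) :
    (Nat.clog 2 a : ℝ) ≤ Real.logb 2 a + 1 := by
  have h := Real.natCeil_logb_natCast 2 a
  rw [Nat.cast_ofNat] at h
  rw [← h]
  exact (Nat.ceil_lt_add_one (Real.logb_nonneg one_lt_two (by exact_mod_cast ha))).le

lemma size_le_logb_add_one {a : ℕ} (ha : 0 < a) : (a.size : ℝ) ≤ Real.logb 2 a + 1 := by
  have h : (2 : ℝ) ^ a.size ≤ 2 * a := by exact_mod_cast two_pow_size_le ha
  refine (le_logb_of_two_pow_le h).trans_eq ?_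
  rw [Real.logb_mul two_ne_zero (by positivity), Real.logb_self_eq_one one_lt_two, add_comm]

lemma logb_clog_two_le {u : ℕ} (hu : 2 ≤ u) :
    Real.logb 2 (Nat.clog 2 u) ≤ Real.logb 2 (Real.logb 2 u) + 1 := by
  have hlog : 1 ≤ Real.logb 2 u := one_le_logb_two (by exact_mod_cast hu)
  have hclog : (0 : ℝ) < Nat.clog 2 u := by exact_mod_cast Nat.clog_pos one_lt_two hu
  have hle := clog_two_le_logb_add_one (a := u) (by omega)
  calc Real.logb 2 (Nat.clog 2 u) ≤ Real.logb 2 (2 * Real.logb 2 u) :=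
        Real.logb_le_logb_of_le one_lt_two hclog (by linarith)
    _ = Real.logb 2 (Real.logb 2 u) + 1 := by
        rw [Real.logb_mul two_ne_zero (by linarith), Real.logb_self_eq_one one_lt_two, add_comm]

namespace Layout

variable {n u r : ℕ} (L : Layout n u r)

/-- A number of bits that suffices for each constant of the evaluation program. -/
def constLen : ℕ := L.wp + L.wt + L.wb + 2 * n.size + L.w.size + 5

lemma constsLt_hashE_two_pow_constLen : L.hashE.ConstsLt (2 ^ L.constLen) := by
  have lt_of_le {a e : ℕ} (ha : a ≤ 2 ^ e) (he : e < L.constLen) : a < 2 ^ L.constLen :=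
    ha.trans_lt (Nat.pow_lt_pow_right one_lt_two he)
  have hn : n ≤ 2 ^ n.size := (Nat.lt_size_self n).le
  have ht : L.pF + L.m + r ≤ 2 ^ L.wt := Nat.le_pow_clog one_lt_two _
  have hbits : L.bits ≤ 2 ^ (4 + 2 * n.size + L.w.size) :=
    calc L.bits ≤ 9 * n ^ 2 * L.w := L.bits_le
      _ ≤ 2 ^ 4 * (2 ^ n.size) ^ 2 * 2 ^ L.w.size := by
          gcongr
          exacts [by norm_num, (Nat.lt_size_self _).le]
      _ = 2 ^ (4 + 2 * n.size + L.w.size) := by ring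
  have hdigit (d) (hd : d < L.q) : L.l ^ d ≤ 2 ^ L.wt := by
    have := L.pow_lt_N hd
    have := L.N_le_pF
    omega
  unfold constLen at *
  exact L.constsLt_hashE (lt_of_le (Nat.lt_size_self _).le (by omega))
    (lt_of_le (e := L.wp) le_rfl (by omega)) (lt_of_le (e := L.wt) le_rfl (by omega))
    (lt_of_le (e := L.wb) le_rfl (by omega)) (lt_of_le (e := L.wt) (by omega) (by omega))
    (lt_of_le (L.l_le.trans hn) (by omega))
    (fun d hd => lt_of_le (hdigit d hd) (by omega)) (lt_of_le hbits (by omega))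
    (lt_of_le (e := L.wt) (by omega) (by omega)) (lt_of_le (L.k_le.trans hn) (by omega))
    (lt_of_le (e := L.wt) (by omega) (by omega))

lemma wb_le : (L.wb : ℝ) ≤ L.k * Real.logb 2 r + 1 := by
  have hr := L.two_le_r
  have h := clog_two_le_logb_add_one (a := r ^ L.k) (by positivity)
  rwa [Nat.cast_pow, Real.logb_pow] at h

theorem space_ds_le [NeZero r] : (L.ds.space : ℝ) ≤ 2 * L.m * (Real.logb 2 r + 1 / L.k)
    + (4 * L.c + 3 * L.q) * L.l * L.wt + (10000 * (L.c + L.q + 1) + L.k + 3) * L.constLen := by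
  have hconst : ((L.hashE.code 1).map Instr.constBits).sum
      ≤ 10000 * (L.c + L.q + 1) * L.constLen :=
    (Expr.constBits_code_le _ L.constsLt_hashE_two_pow_constLen 1).trans
      (Nat.mul_le_mul_right _ L.size_hashE)
  have hwp : L.wp ≤ L.constLen := by unfold constLen; omega
  have hwb : L.wb ≤ L.constLen := by unfold constLen; omega
  have hspace : L.ds.space ≤ 2 * L.constLen + (4 * L.c + 3 * L.q) * L.l * L.wt
      + (L.k + 1) * L.constLen + 2 * L.m / L.k * L.wb + 10000 * (L.c + L.q + 1) * L.constLen :=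
    calc L.ds.space = L.bits + ((L.hashE.code 1).map Instr.constBits).sum := rfl
      _ ≤ L.bits + 10000 * (L.c + L.q + 1) * L.constLen := by gcongr
      _ = 2 * L.wp + (4 * L.c + 3 * L.q) * L.l * L.wt + (L.k + 1) * L.wb
          + 2 * L.m / L.k * L.wb + 10000 * (L.c + L.q + 1) * L.constLen := by
        rw [bits, start, card_row, blocks]
        ring
      _ ≤ _ := by gcongr
  have hblocks : ((2 * L.m / L.k : ℕ) : ℝ) * L.wb ≤ 2 * L.m * (Real.logb 2 r + 1 / L.k) := by
    have hk : (0 : ℝ) < L.k := by exact_mod_cast L.k_pos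
    calc ((2 * L.m / L.k : ℕ) : ℝ) * L.wb
        ≤ 2 * L.m / L.k * (L.k * Real.logb 2 r + 1) := by
          gcongr
          exacts [by exact_mod_cast Nat.cast_div_le (α := ℝ), L.wb_le]
      _ = 2 * L.m * (Real.logb 2 r + 1 / L.k) := by
          field_simp
  have hcast := (Nat.cast_le (α := ℝ)).2 hspace
  push_cast at hcast
  linarith

end Layout

/-! ### Choice of the parameters -/

lemma natCeil_rpow_le_two_mul {δ : ℝ} (hδ : 0 ≤ δ) {n : ℕ} (hn : 1 ≤ n) :
    (⌈(n : ℝ) ^ δ⌉₊ : ℝ) ≤ 2 * (n : ℝ) ^ δ := by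
  have hone : (1 : ℝ) ≤ (n : ℝ) ^ δ := Real.one_le_rpow (by exact_mod_cast hn) hδ
  have hceil := Nat.ceil_lt_add_one (zero_le_one.trans hone)
  linarith

lemma two_le_natCeil_rpow {δ : ℝ} (hδ : 0 < δ) {n : ℕ} (hn : 1 < n) : 2 ≤ ⌈(n : ℝ) ^ δ⌉₊ :=
  Nat.lt_ceil.2 (by simpa using Real.one_lt_rpow (by exact_mod_cast hn) hδ)

lemma natCeil_rpow_le_self {δ : ℝ} (hδ : δ ≤ 1) {n : ℕ} (hn : 1 ≤ n) : ⌈(n : ℝ) ^ δ⌉₊ ≤ n := by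
  rw [Nat.ceil_le]
  simpa using Real.rpow_le_rpow_of_exponent_le (x := n) (by exact_mod_cast hn) hδ

lemma rpow_le_natCeil_rpow_pow {δ a : ℝ} (hδ : 0 < δ) {n c : ℕ} (hn : 1 ≤ n) (hc : a / δ ≤ c) :
    (n : ℝ) ^ a ≤ (⌈(n : ℝ) ^ δ⌉₊ : ℝ) ^ c :=
  calc (n : ℝ) ^ a ≤ (n : ℝ) ^ (δ * c) :=
        Real.rpow_le_rpow_of_exponent_le (by exact_mod_cast hn) ((div_le_iff₀' hδ).1 hc)
    _ = ((n : ℝ) ^ δ) ^ c := by rw [Real.rpow_mul (Nat.cast_nonneg n), Real.rpow_natCast]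
    _ ≤ (⌈(n : ℝ) ^ δ⌉₊ : ℝ) ^ c := by
        gcongr
        exact Nat.le_ceil _

lemma eventually_mul_natCeil_rpow_mul_logb_le {δ a b : ℝ} (hδ : 0 ≤ δ) (hδ1 : δ < 1)
    (ha : 0 ≤ a) (hb : 0 < b) :
    ∀ᶠ n : ℕ in Filter.atTop, a * ⌈(n : ℝ) ^ δ⌉₊ * Real.logb 2 n ≤ b * n := by
  have : 0 < Real.log 2 := Real.log_pos one_lt_two
  have hlittle := (isLittleO_log_rpow_atTop (r := 1 - δ) (by linarith)).bound
    (show 0 < b * Real.log 2 / (2 * (a + 1)) by positivity)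
  filter_upwards [tendsto_natCast_atTop_atTop.eventually hlittle, Filter.eventually_ge_atTop 1]
    with n hn hn1
  have hn1' : (1 : ℝ) ≤ n := by exact_mod_cast hn1
  rw [Real.norm_of_nonneg (Real.log_nonneg hn1'), Real.norm_of_nonneg (by positivity)] at hn
  calc a * ⌈(n : ℝ) ^ δ⌉₊ * Real.logb 2 n
      ≤ (a + 1) * (2 * (n : ℝ) ^ δ) * (b * Real.log 2 / (2 * (a + 1)) * (n : ℝ) ^ (1 - δ)
          / Real.log 2) := by
        have := Real.log_nonneg hn1'
        rw [Real.logb]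
        gcongr
        · linarith
        · exact natCeil_rpow_le_two_mul hδ hn1
    _ = b * ((n : ℝ) ^ δ * (n : ℝ) ^ (1 - δ)) := by field_simp
    _ = b * n := by rw [← Real.rpow_add (by linarith), add_sub_cancel, Real.rpow_one]

/-- If `r` is so large that rounding its logarithm is harmless, blocks of one entry do. Otherwise
all powers of `r` needed for larger blocks fit into a word. -/
lemma exists_block_size {ε : ℝ} (hε : 0 < ε) {u r k₀ : ℕ} (hk₀ : 10 / ε ≤ k₀) (hr : 2 ≤ r)
    (hru : r ≤ u) (hu : 2 ^ (k₀ * k₀) ≤ u) :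
    ∃ k, 0 < k ∧ k ≤ k₀ ∧ r ^ k ≤ u ∧ 10 ≤ ε * (k * Real.logb 2 r) := by
  have hk₀pos : 0 < k₀ := by
    have : 0 < 10 / ε := by positivity
    exact_mod_cast this.trans_le hk₀
  suffices ∃ k, 0 < k ∧ k ≤ k₀ ∧ r ^ k ≤ u ∧ (k₀ : ℝ) ≤ k * Real.logb 2 r by
    obtain ⟨k, hk, hkk₀, hrk, hle⟩ := this
    exact ⟨k, hk, hkk₀, hrk, (div_le_iff₀' hε).1 (hk₀.trans hle)⟩
  rcases le_or_gt (2 ^ k₀) r with h | h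
  · refine ⟨1, one_pos, hk₀pos, by simpa using hru, ?_⟩
    simpa using le_logb_of_two_pow_le (x := r) (by exact_mod_cast h)
  · refine ⟨k₀, hk₀pos, le_rfl, ?_, ?_⟩
    · rw [pow_mul] at hu
      exact (Nat.pow_le_pow_left h.le k₀).trans hu
    · exact le_mul_of_one_le_right (Nat.cast_nonneg _) (one_le_logb_two (by exact_mod_cast hr))

lemma exists_nat_mul_le_le_mul {ε : ℝ} (hε : 0 < ε) {n : ℕ} (hn : ⌈4 / ε⌉₊ ≤ n) :
    ∃ m : ℕ, (1 + ε / 4) * n ≤ m ∧ (m : ℝ) ≤ (1 + ε / 2) * n := by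
  have hεn := Nat.ceil_le.1 hn
  rw [div_le_iff₀ hε] at hεn
  have := Nat.lt_floor_add_one ((1 + ε / 2) * (n : ℝ))
  exact ⟨⌊(1 + ε / 2) * (n : ℝ)⌋₊, by linarith, Nat.floor_le (by positivity)⟩

/-- The parameters are those of the theorem for `δ`, `ε` and `s`: the number `m` exceeds `n` by a
factor between `1 + ε / 4` and `1 + ε / 2`, the blocks are so long that rounding up their numbers
of bits costs at most a factor `1 + ε / 10`, and the collapsed universe has size
`O(n ^ (s + 3))`. -/
structure Layout.Tuned {n u r : ℕ} (L : Layout n u r) (δ ε s : ℝ) : Prop where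
  c_eq : L.c = ⌈(s + 3) / δ⌉₊
  l_eq : L.l = ⌈(n : ℝ) ^ δ⌉₊
  le_m : (1 + ε / 4) * n ≤ L.m
  m_le : (L.m : ℝ) ≤ (1 + ε / 2) * n
  k_le : L.k ≤ ⌈10 / ε⌉₊
  le_k : 10 ≤ ε * (L.k * Real.logb 2 r)
  N_le : (L.𝒞.N : ℝ) ≤ 2 * (n : ℝ) ^ (s + 3)
  p_le : L.𝒞.p ≤ 128 * (⌈(n : ℝ) ^ (s + 3)⌉₊ * Nat.clog 2 u) ^ 2
  col_le : ∀ x y, x ≠ y → prob {i | L.𝒞.col i x = L.𝒞.col i y} ≤ 3 / (n : ℝ) ^ (s + 3)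

lemma clog_natCeil_rpow_le {δ s : ℝ} (hδ : 0 < δ) {n N : ℕ} (hn : 2 ≤ n)
    (hN : (N : ℝ) ≤ 2 * (n : ℝ) ^ (s + 3)) :
    Nat.clog ⌈(n : ℝ) ^ δ⌉₊ N ≤ ⌈(s + 4) / δ⌉₊ := by
  have hn2 : (2 : ℝ) ≤ n := by exact_mod_cast hn
  have hle : (N : ℝ) ≤ (⌈(n : ℝ) ^ δ⌉₊ : ℝ) ^ ⌈(s + 4) / δ⌉₊ :=
    calc (N : ℝ) ≤ 2 * (n : ℝ) ^ (s + 3) := hN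
      _ ≤ (n : ℝ) ^ (s + 3) * n := by
          rw [mul_comm]
          gcongr
      _ = (n : ℝ) ^ (s + 4) := by
          rw [← Real.rpow_add_one (by positivity)]
          ring_nf
      _ ≤ _ := rpow_le_natCeil_rpow_pow hδ (by omega) (Nat.le_ceil _)
  exact Nat.clog_le_of_le_pow (by exact_mod_cast hle)

theorem exists_tuned {δ ε s : ℝ} (hδ : 0 < δ) (hδ1 : δ ≤ 1) (hε : 0 < ε) (hε1 : ε ≤ 1)
    (hs : -3 ≤ s) :
    ∃ n₀ : ℕ, ∀ n u r : ℕ, n₀ ≤ n → n ≤ u → 2 ≤ r → r ≤ u →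
      ∃ L : Layout n u r, L.Tuned δ ε s := by
  obtain ⟨c, hc⟩ : ∃ c, c = ⌈(s + 3) / δ⌉₊ := ⟨_, rfl⟩
  obtain ⟨k₀, hk₀⟩ : ∃ k₀, k₀ = ⌈10 / ε⌉₊ := ⟨_, rfl⟩
  obtain ⟨b, hb⟩ : ∃ b, b = 2 ^ (k₀ * k₀) := ⟨_, rfl⟩
  refine ⟨16 + (4 * c + 3 * ⌈(s + 4) / δ⌉₊ + 5) + ⌈4 / ε⌉₊ + b + k₀,
    fun n u r hn hnu hr hru => ?_⟩
  have hn1 : (1 : ℝ) ≤ n := by exact_mod_cast (by omega : 1 ≤ n)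
  obtain ⟨𝒞, hN, hp, hcol⟩ := exists_collapseClass
    (Real.one_le_rpow hn1 (by linarith : 0 ≤ s + 3)) (by omega : 2 ≤ u)
  obtain ⟨m, hle_m, hm_le⟩ := exists_nat_mul_le_le_mul hε (by omega : ⌈4 / ε⌉₊ ≤ n)
  obtain ⟨k, hk, hkk₀, hrk, hkε⟩ := exists_block_size hε (hk₀ ▸ Nat.le_ceil _) hr hru
    (hb ▸ (by omega : b ≤ u))
  obtain ⟨pF, hpF, hNpF, hpFN⟩ := Nat.exists_prime_lt_and_le_two_mul 𝒞.N (NeZero.ne _)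
  have hq := clog_natCeil_rpow_le hδ (by omega) hN
  have hm_pos : (0 : ℝ) < m := by nlinarith
  have hm_two : (m : ℝ) ≤ 2 * n := by nlinarith
  refine ⟨⟨𝒞, k, c, ⌈(n : ℝ) ^ δ⌉₊, m, pF, by omega, hnu, hr, hru,
    two_le_natCeil_rpow hδ (by omega), natCeil_rpow_le_self hδ1 (by omega), by omega,
    by exact_mod_cast hm_pos, by exact_mod_cast hm_two, hk, by omega, hrk, hpF, hNpF.le, hpFN⟩,
    hc, rfl, hle_m, hm_le, hk₀ ▸ hkk₀, hkε, hN, hp, hcol⟩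

namespace Layout.Tuned

variable {n u r : ℕ} {L : Layout n u r} {δ ε s : ℝ}

lemma q_le (h : L.Tuned δ ε s) (hδ : 0 < δ) : L.q ≤ ⌈(s + 4) / δ⌉₊ := by
  rw [q, h.l_eq]
  exact clog_natCeil_rpow_le hδ (L.two_le_l.trans L.l_le) h.N_le

lemma wp_le (h : L.Tuned δ ε s) (hs : -3 ≤ s) :
    (L.wp : ℝ) ≤ 2 * (s + 3) * Real.logb 2 n + 2 * Real.logb 2 (Real.logb 2 u) + 12 := by
  have hn := L.one_le_n
  have hn0 : (0 : ℝ) < n := by exact_mod_cast hn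
  have hclog : (0 : ℝ) < Nat.clog 2 u := by exact_mod_cast Nat.clog_pos one_lt_two L.two_le_u
  have hp : (L.𝒞.p : ℝ) ≤ 2 ^ 9 * ((n : ℝ) ^ (s + 3)) ^ 2 * (Nat.clog 2 u : ℝ) ^ 2 :=
    calc (L.𝒞.p : ℝ) ≤ 128 * (⌈(n : ℝ) ^ (s + 3)⌉₊ * Nat.clog 2 u) ^ 2 := by
          exact_mod_cast h.p_le
      _ ≤ 128 * (2 * (n : ℝ) ^ (s + 3) * Nat.clog 2 u) ^ 2 := by
          gcongr
          exact natCeil_rpow_le_two_mul (by linarith) hn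
      _ = _ := by ring
  have hlog : Real.logb 2 L.𝒞.p
      ≤ 9 + 2 * ((s + 3) * Real.logb 2 n) + 2 * Real.logb 2 (Nat.clog 2 u) := by
    refine (Real.logb_le_logb_of_le one_lt_two (by exact_mod_cast L.p_pos) hp).trans_eq ?_
    rw [Real.logb_mul (by positivity) (by positivity), Real.logb_mul (by positivity)
      (by positivity), Real.logb_pow, Real.logb_pow, Real.logb_pow,
      Real.logb_rpow_eq_mul_logb_of_pos hn0, Real.logb_self_eq_one one_lt_two]
    norm_num
  have hsize : (L.wp : ℝ) ≤ Real.logb 2 L.𝒞.p + 1 := size_le_logb_add_one L.p_pos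
  linarith [logb_clog_two_le L.two_le_u]

lemma wt_le (h : L.Tuned δ ε s) (hs : -2 ≤ s) :
    (L.wt : ℝ) ≤ (s + 3) * Real.logb 2 n + Real.logb 2 r + 3 := by
  have hn : (1 : ℝ) ≤ n := by exact_mod_cast L.one_le_n
  have hr : (2 : ℝ) ≤ r := by exact_mod_cast L.two_le_r
  have hpow : (n : ℝ) ≤ (n : ℝ) ^ (s + 3) := Real.self_le_rpow_of_one_le hn (by linarith)
  have hpF : (L.pF : ℝ) ≤ 2 * L.𝒞.N := by exact_mod_cast L.pF_le
  have hm : (L.m : ℝ) ≤ 2 * n := by exact_mod_cast L.m_le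
  have hle : ((L.pF + L.m + r : ℕ) : ℝ) ≤ 2 ^ 2 * (n : ℝ) ^ (s + 3) * r := by
    push_cast
    nlinarith [h.N_le]
  have hpos : 0 < L.pF + L.m + r := by have := L.m_pos; omega
  have hlog : Real.logb 2 ((L.pF + L.m + r : ℕ) : ℝ)
      ≤ 2 + (s + 3) * Real.logb 2 n + Real.logb 2 r := by
    refine (Real.logb_le_logb_of_le one_lt_two (by exact_mod_cast hpos) hle).trans_eq ?_
    rw [Real.logb_mul (by positivity) (by positivity), Real.logb_mul (by positivity)
      (by positivity), Real.logb_pow, Real.logb_rpow_eq_mul_logb_of_pos (by linarith),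
      Real.logb_self_eq_one one_lt_two]
    norm_num
  have hclog : (L.wt : ℝ) ≤ _ := clog_two_le_logb_add_one hpos
  linarith

lemma constLen_le (h : L.Tuned δ ε s) (hs : -2 ≤ s) :
    (L.constLen : ℝ) ≤ (3 * s + 11) * Real.logb 2 n + (L.k + 1) * Real.logb 2 r
      + 3 * Real.logb 2 (Real.logb 2 u) + 28 := by
  have hn : (n.size : ℝ) ≤ Real.logb 2 n + 1 := size_le_logb_add_one L.one_le_n
  have hclog := Nat.clog_pos one_lt_two L.two_le_u
  have hw : (L.w.size : ℝ) ≤ Real.logb 2 (Real.logb 2 u) + 5 := by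
    have hsize : (L.w.size : ℝ) ≤ Real.logb 2 L.w + 1 :=
      size_le_logb_add_one (by unfold w; omega)
    have hlog : Real.logb 2 L.w = 3 + Real.logb 2 (Nat.clog 2 u) := by
      rw [w, Nat.cast_mul, show ((8 : ℕ) : ℝ) = 2 ^ 3 by norm_num,
        Real.logb_mul (by positivity) (by positivity), Real.logb_pow,
        Real.logb_self_eq_one one_lt_two]
      norm_num
    linarith [logb_clog_two_le L.two_le_u]
  have hsum : (L.constLen : ℝ) = L.wp + L.wt + L.wb + 2 * n.size + L.w.size + 5 := by
    exact_mod_cast rfl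
  linarith [h.wp_le (by linarith), h.wt_le hs, L.wb_le]

lemma wt_le_mul (h : L.Tuned δ ε s) (hs : -2 ≤ s) :
    (L.wt : ℝ) ≤ (s + 7) * (Real.logb 2 n * Real.logb 2 r) := by
  have hn : 1 ≤ Real.logb 2 n := one_le_logb_two (by exact_mod_cast L.two_le_l.trans L.l_le)
  have hr : 1 ≤ Real.logb 2 r := one_le_logb_two (by exact_mod_cast L.two_le_r)
  have hn_le := le_mul_of_one_le_right (zero_le_one.trans hn) hr
  have hr_le := le_mul_of_one_le_left (zero_le_one.trans hr) hn
  linarith [h.wt_le hs, mul_le_mul_of_nonneg_left hn_le (by linarith : 0 ≤ s + 3)]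

lemma constLen_le_mul (h : L.Tuned δ ε s) (hs : -2 ≤ s) :
    (L.constLen : ℝ) ≤ (3 * s + L.k + 43)
      * (Real.logb 2 n * Real.logb 2 r + Real.logb 2 (Real.logb 2 u)) := by
  have hn : 1 ≤ Real.logb 2 n := one_le_logb_two (by exact_mod_cast L.two_le_l.trans L.l_le)
  have hr : 1 ≤ Real.logb 2 r := one_le_logb_two (by exact_mod_cast L.two_le_r)
  have hu : 0 ≤ Real.logb 2 (Real.logb 2 u) := logb_logb_two_nonneg (by exact_mod_cast L.two_le_u)
  have hn_le := le_mul_of_one_le_right (zero_le_one.trans hn) hr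
  have hr_le := le_mul_of_one_le_left (zero_le_one.trans hr) hn
  calc (L.constLen : ℝ)
      ≤ (3 * s + L.k + 40) * (Real.logb 2 n * Real.logb 2 r)
        + 3 * Real.logb 2 (Real.logb 2 u) := by
        linarith [h.constLen_le hs,
          mul_le_mul_of_nonneg_left hn_le (by linarith : 0 ≤ 3 * s + 11),
          mul_le_mul_of_nonneg_left hr_le (by linarith : 0 ≤ (L.k : ℝ) + 1)]
    _ ≤ (3 * s + L.k + 43) * (Real.logb 2 n * Real.logb 2 r)
        + (3 * s + L.k + 43) * Real.logb 2 (Real.logb 2 u) := by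
        gcongr <;> linarith
    _ = _ := by ring

theorem space_ds_le [NeZero r] (h : L.Tuned δ ε s) (hs : -2 ≤ s) :
    (L.ds.space : ℝ) ≤ 2 * (1 + ε / 10) * L.m * Real.logb 2 r
      + ((4 * L.c + 3 * L.q) * (s + 7) + (10000 * (L.c + L.q + 1) + L.k + 3) * (3 * s + L.k + 43))
        * (L.l * Real.logb 2 n * Real.logb 2 r + Real.logb 2 (Real.logb 2 u)) := by
  have hn : 0 ≤ Real.logb 2 n := logb_two_nonneg (by exact_mod_cast L.two_le_l.trans L.l_le)
  have hr : 0 ≤ Real.logb 2 r := logb_two_nonneg (by exact_mod_cast L.two_le_r)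
  have hu : 0 ≤ Real.logb 2 (Real.logb 2 u) := logb_logb_two_nonneg (by exact_mod_cast L.two_le_u)
  have hwt := h.wt_le_mul hs
  have hconst := h.constLen_le_mul hs
  have hspace := L.space_ds_le
  have hle_k := h.le_k
  generalize Real.logb 2 n = G at *
  generalize Real.logb 2 (Real.logb 2 u) = Z at *
  generalize Real.logb 2 r = ρ at *
  have hl : (1 : ℝ) ≤ L.l := by exact_mod_cast one_le_two.trans L.two_le_l
  have hk : (0 : ℝ) < L.k := by exact_mod_cast L.k_pos
  have hinv : 1 / (L.k : ℝ) ≤ ε / 10 * ρ := by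
    rw [div_le_iff₀ hk]
    linarith
  have hle_l : G * ρ ≤ L.l * G * ρ := by
    rw [mul_assoc]
    exact le_mul_of_one_le_left (by positivity) hl
  have hs7 : 0 ≤ s + 7 := by linarith
  have hs43 : 0 ≤ 3 * s + L.k + 43 := by linarith
  calc (L.ds.space : ℝ) ≤ 2 * L.m * (ρ + ε / 10 * ρ)
        + (4 * L.c + 3 * L.q) * L.l * ((s + 7) * (G * ρ))
        + (10000 * (L.c + L.q + 1) + L.k + 3) * ((3 * s + L.k + 43) * (G * ρ + Z)) := by
        refine hspace.trans ?_
        gcongr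
    _ = 2 * (1 + ε / 10) * L.m * ρ + ((4 * L.c + 3 * L.q) * (s + 7) * (L.l * G * ρ + 0)
        + (10000 * (L.c + L.q + 1) + L.k + 3) * (3 * s + L.k + 43) * (G * ρ + Z)) := by
        ring
    _ ≤ 2 * (1 + ε / 10) * L.m * ρ + ((4 * L.c + 3 * L.q) * (s + 7) * (L.l * G * ρ + Z)
        + (10000 * (L.c + L.q + 1) + L.k + 3) * (3 * s + L.k + 43) * (L.l * G * ρ + Z)) := by
        gcongr
    _ = _ := by ring

end Layout.Tuned

theorem exists_space_ds_le {δ s : ℝ} (ε : ℝ) (hδ : 0 < δ) (hs : -2 ≤ s) :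
    ∃ D, 0 ≤ D ∧ ∀ {n u r : ℕ} [NeZero r] (L : Layout n u r), L.Tuned δ ε s →
      (L.ds.space : ℝ) ≤ 2 * (1 + ε / 10) * L.m * Real.logb 2 r
        + D * (⌈(n : ℝ) ^ δ⌉₊ * Real.logb 2 n * Real.logb 2 r + Real.logb 2 (Real.logb 2 u)) := by
  obtain ⟨c, hc⟩ : ∃ c, c = ⌈(s + 3) / δ⌉₊ := ⟨_, rfl⟩
  obtain ⟨q, hq⟩ : ∃ q, q = ⌈(s + 4) / δ⌉₊ := ⟨_, rfl⟩
  obtain ⟨k, hk⟩ : ∃ k, k = ⌈10 / ε⌉₊ := ⟨_, rfl⟩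
  have hs_add (a : ℕ) : 0 ≤ 3 * s + a + 43 := by linarith [a.cast_nonneg (α := ℝ)]
  have hs7 : 0 ≤ s + 7 := by linarith
  refine ⟨(4 * c + 3 * q) * (s + 7) + (10000 * (c + q + 1) + k + 3) * (3 * s + k + 43), ?_,
    fun {n u r} _ L h => (h.space_ds_le hs).trans ?_⟩
  · have := hs_add k
    positivity
  · have hLc : (L.c : ℝ) = c := by exact_mod_cast hc ▸ h.c_eq
    have hLq : (L.q : ℝ) ≤ q := by exact_mod_cast hq ▸ h.q_le hδ
    have hLk : (L.k : ℝ) ≤ k := by exact_mod_cast hk ▸ h.k_le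
    have hlogn : 0 ≤ Real.logb 2 n := Real.logb_nonneg one_lt_two (by exact_mod_cast L.one_le_n)
    have hlogr : 0 ≤ Real.logb 2 r := logb_two_nonneg (by exact_mod_cast L.two_le_r)
    have hlogu : 0 ≤ Real.logb 2 (Real.logb 2 u) :=
      logb_logb_two_nonneg (by exact_mod_cast L.two_le_u)
    have := hs_add L.k
    rw [hLc, h.l_eq]
    gcongr

/-! ### Tuned data structures -/

lemma exists_sum_pow_mul_pow_le {ρ : ℝ} (hρ : 0 ≤ ρ) (hρ1 : ρ < 1) (d : ℕ) :
    ∃ A, 0 ≤ A ∧ ∀ k, ∑ t ∈ Finset.range k, (t : ℝ) ^ d * ρ ^ t ≤ A := by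
  have hsum := summable_pow_mul_geometric_of_norm_lt_one d (by rwa [Real.norm_of_nonneg hρ])
  exact ⟨_, tsum_nonneg fun t => by positivity,
    fun k => hsum.sum_le_tsum _ fun t _ => by positivity⟩

lemma mul_add_two_div_pow_mul_le {δ s A : ℝ} (hδ : 0 < δ) (hA : 0 ≤ A) {n c m : ℕ} (hn : 1 ≤ n)
    (hc : (s + 3) / δ ≤ c) (hm : m ≤ 2 * n) :
    (n : ℝ) ^ 2 * (3 / (n : ℝ) ^ (s + 3)) + (2 / (⌈(n : ℝ) ^ δ⌉₊ : ℝ)) ^ c * (m : ℝ) ^ 2 * A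
      ≤ (3 + 2 ^ (c + 2) * A) / (n : ℝ) ^ (s + 1) := by
  have hn0 : (0 : ℝ) < n := by exact_mod_cast hn
  have hm' : (m : ℝ) ≤ 2 * n := by exact_mod_cast hm
  have hsplit : (n : ℝ) ^ (s + 3) = (n : ℝ) ^ (s + 1) * (n : ℝ) ^ 2 := by
    rw [← Real.rpow_natCast (n : ℝ) 2, ← Real.rpow_add hn0]
    push_cast
    ring_nf
  have hpow := rpow_le_natCeil_rpow_pow hδ hn hc
  rw [hsplit] at hpow ⊢
  calc _ ≤ (n : ℝ) ^ 2 * (3 / ((n : ℝ) ^ (s + 1) * (n : ℝ) ^ 2))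
        + 2 ^ c / ((n : ℝ) ^ (s + 1) * (n : ℝ) ^ 2) * (2 * n) ^ 2 * A := by
        rw [div_pow]
        gcongr
    _ = _ := by
        field_simp
        ring

theorem exists_uniformOnOutside_ds_le {δ ε : ℝ} (hδ : 0 < δ) (hε : 0 < ε) {s : ℝ} (hs : -3 < s) :
    ∃ D, 0 ≤ D ∧ ∀ {n u r : ℕ} [NeZero r] (L : Layout n u r), L.Tuned δ ε s →
      ∀ S : Finset (Fin u), S.card = n →
        ∃ B, prob B ≤ D / (n : ℝ) ^ (s + 1) ∧ UniformOnOutside L.ds.h S B := by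
  classical
  obtain ⟨A, hA, hsum⟩ := exists_sum_pow_mul_pow_le (ρ := 1 / (1 + ε / 4)) (by positivity)
    ((div_lt_one (by positivity)).2 (by linarith)) (6 * ⌈(s + 3) / δ⌉₊)
  refine ⟨3 + 2 ^ (⌈(s + 3) / δ⌉₊ + 2) * A, by positivity, fun {n u r} _ L h S hS => ?_⟩
  have hc : 0 < L.c := by
    rw [h.c_eq, Nat.ceil_pos]
    exact div_pos (by linarith) hδ
  have hS_le : (S.card : ℝ) ≤ 1 / (1 + ε / 4) * L.m := by
    rw [hS, one_div_mul_eq_div, le_div_iff₀' (by positivity)]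
    exact h.le_m
  have hprob := prob_badSeed_le (r := r) (kK := Fintype.card (Fin L.q → Fin L.l → Fin r)) hc
    L.tabClassH (isUniversal_mulClass (l := L.l) L.prime_pF L.N_le_pF) (by positivity) h.col_le
    hS_le (h.c_eq ▸ hsum)
  refine ⟨_, hprob.trans ?_, uniformOnOutside_badSeed L.𝒞.col L.tabClassH L.multClass L.tabClassK S⟩
  rw [hS, h.l_eq, ← h.c_eq]
  exact mul_add_two_div_pow_mul_le hδ hA L.one_le_n (h.c_eq ▸ Nat.le_ceil _) L.m_le

lemma natCeil_add_div_le {δ s a : ℝ} (hδ : 0 < δ) (ha : 0 ≤ a) :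
    (⌈(s + a) / δ⌉₊ : ℝ) ≤ (max s 1 + a) / δ + 1 := by
  have hle : (s + a) / δ ≤ (max s 1 + a) / δ := by
    gcongr
    exact le_max_left s 1
  have hpos : 0 ≤ (max s 1 + a) / δ := by
    have := le_max_right s 1
    positivity
  calc (⌈(s + a) / δ⌉₊ : ℝ) ≤ ⌈(max s 1 + a) / δ⌉₊ := by exact_mod_cast Nat.ceil_mono hle
    _ ≤ (max s 1 + a) / δ + 1 := (Nat.ceil_lt_add_one hpos).le

lemma one_le_max_one_div {δ : ℝ} (hδ : 0 < δ) (hδ1 : δ ≤ 1) (s : ℝ) : 1 ≤ max s 1 / δ :=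
  (one_le_div hδ).2 (hδ1.trans (le_max_right s 1))

namespace Layout.Tuned

variable {n u r : ℕ} {L : Layout n u r} {δ ε s : ℝ} [NeZero r]

lemma time_ds_le (h : L.Tuned δ ε s) (hδ : 0 < δ) (hδ1 : δ ≤ 1) :
    (L.ds.time : ℝ) ≤ 120000 * (max s 1 / δ) := by
  have htime : (L.ds.time : ℝ) ≤ 10000 * (L.c + L.q + 1) := by
    exact_mod_cast (Expr.length_code _ 1).trans_le L.size_hashE
  have hc : (L.c : ℝ) ≤ (max s 1 + 3) / δ + 1 := by
    rw [h.c_eq]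
    exact natCeil_add_div_le hδ (by norm_num)
  have hq : (L.q : ℝ) ≤ (max s 1 + 4) / δ + 1 :=
    (Nat.cast_le.2 (h.q_le hδ)).trans (natCeil_add_div_le hδ (by norm_num))
  have hinv : 1 / δ ≤ max s 1 / δ := by
    gcongr
    exact le_max_right s 1
  rw [add_div] at hc hq
  rw [← mul_one_div 3 δ] at hc
  rw [← mul_one_div 4 δ] at hq
  linarith [one_le_max_one_div hδ hδ1 s]

lemma builtFromZ (h : L.Tuned δ ε s) (hδ : 0 < δ) {ε' D : ℝ} (hε' : ε / 2 ≤ ε') (hD : 3 ≤ D) :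
    BuiltFromZ L.ds n δ ε' s D := by
  refine ⟨L.𝒞.N, L.c, L.l, L.m, _, _, _, _, L.𝒞.col, L.tabClassH, L.multClass, L.tabClassK,
    ?_, h.l_eq, h.m_le.trans ?_, h.N_le.trans ?_, fun x y hxy => (h.col_le x y hxy).trans ?_,
    isTwoIndependent_tabClass L.N_le_pow, isUniversal_mulClass L.prime_pF L.N_le_pF,
    isTwoIndependent_tabClass L.N_le_pow, id,
    IsUniform.of_equiv (Equiv.refl L.Seed), fun ω x => rfl⟩
  · rw [h.c_eq]
    exact le_trans (by gcongr; norm_num) (Nat.le_ceil _)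
  · gcongr
  · gcongr
    linarith
  · gcongr

end Layout.Tuned

lemma two_mul_add_le {ε ε₁ n m e : ℝ} (hε₁ : 0 ≤ ε₁) (hε₁_one : ε₁ ≤ 1) (hε₁_le : ε₁ ≤ ε)
    (hn : 0 ≤ n) (hm : m ≤ (1 + ε₁ / 2) * n) (he : e ≤ 7 / 10 * ε₁ * n) :
    2 * (1 + ε₁ / 10) * m + e ≤ 2 * (1 + ε) * n :=
  calc 2 * (1 + ε₁ / 10) * m + e
      ≤ 2 * (1 + ε₁ / 10) * ((1 + ε₁ / 2) * n) + 7 / 10 * ε₁ * n := by gcongr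
    _ = (2 + 19 / 10 * ε₁ + 1 / 10 * ε₁ * ε₁) * n := by ring
    _ ≤ 2 * (1 + ε) * n := by
        gcongr
        nlinarith

theorem exists_hashDS_of_large {δ ε s : ℝ} (hδ : 0 < δ) (hδ1 : δ < 1) (hε : 0 < ε) (hs : -2 ≤ s) :
    ∃ (D₀ : ℝ) (n₀ : ℕ), ∀ D, D₀ ≤ D → ∀ n u r : ℕ, n₀ ≤ n → n ≤ u → 1 < r → r ≤ u →
      ∃ ds : HashDS u r (8 * Nat.clog 2 u),
        (∀ S : Finset (Fin u), S.card = n →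
          ∃ B : Finset ds.Ω, prob B ≤ D / (n : ℝ) ^ (s + 1) ∧ UniformOnOutside ds.h S B) ∧
        (ds.time : ℝ) ≤ 120000 * (max s 1 / δ) ∧
        (ds.space : ℝ) ≤ 2 * (1 + ε) * n * Real.logb 2 r + D * Real.logb 2 (Real.logb 2 u) ∧
        BuiltFromZ ds n δ ε s D := by
  obtain ⟨ε₁, hε₁, hε₁_one, hε₁_le⟩ : ∃ ε₁ : ℝ, 0 < ε₁ ∧ ε₁ ≤ 1 ∧ ε₁ ≤ ε :=
    ⟨min ε 1, lt_min hε one_pos, min_le_right _ _, min_le_left _ _⟩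
  obtain ⟨D₁, hD₁, hunif⟩ := exists_uniformOnOutside_ds_le hδ hε₁ (by linarith : -3 < s)
  obtain ⟨D₂, hD₂, hspace⟩ := exists_space_ds_le ε₁ hδ hs
  obtain ⟨n₁, htuned⟩ := exists_tuned hδ hδ1.le hε₁ hε₁_one (by linarith : -3 ≤ s)
  obtain ⟨n₂, hlog⟩ := Filter.eventually_atTop.1 (eventually_mul_natCeil_rpow_mul_logb_le hδ.le hδ1
    hD₂ (by positivity : 0 < 7 / 10 * ε₁))
  refine ⟨3 + D₁ + D₂, max n₁ n₂, fun D hD n u r hn hnu hr hru => ?_⟩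
  obtain ⟨L, hL⟩ := htuned n u r ((le_max_left _ _).trans hn) hnu hr hru
  have : NeZero r := ⟨by omega⟩
  refine ⟨L.ds, fun S hS => ?_, hL.time_ds_le hδ hδ1.le, (hspace L hL).trans ?_,
    hL.builtFromZ hδ (by linarith) (by linarith)⟩
  · obtain ⟨B, hB, hBS⟩ := hunif L hL S hS
    refine ⟨B, hB.trans ?_, hBS⟩
    gcongr
    linarith
  · have hlogr : 0 ≤ Real.logb 2 r := logb_two_nonneg (by exact_mod_cast hr)
    have hloglogu : 0 ≤ Real.logb 2 (Real.logb 2 u) :=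
      logb_logb_two_nonneg (by exact_mod_cast L.two_le_u)
    have hmain := two_mul_add_le hε₁.le hε₁_one hε₁_le (by positivity) hL.m_le
      (hlog n ((le_max_right _ _).trans hn))
    calc _ = (2 * (1 + ε₁ / 10) * L.m + D₂ * ⌈(n : ℝ) ^ δ⌉₊ * Real.logb 2 n) * Real.logb 2 r
          + D₂ * Real.logb 2 (Real.logb 2 u) := by ring
      _ ≤ 2 * (1 + ε) * n * Real.logb 2 r + D * Real.logb 2 (Real.logb 2 u) := by
          gcongr
          linarith

/-- The data structure representing the constant function `0`, for sets so small that the error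
bound is trivial. -/
def constDS (u r w : ℕ) [NeZero r] : HashDS u r w where
  Ω := Unit
  memBits := 0
  mem _ := Fin.elim0
  prog := [Instr.const 0]
  h _ _ := 0
  run_eq _ _ := by simp [run, runRegs, Instr.eval]

lemma time_constDS (u r w : ℕ) [NeZero r] : (constDS u r w).time = 1 := rfl

lemma space_constDS (u r w : ℕ) [NeZero r] : (constDS u r w).space = 0 := rfl

lemma uniformOnOutside_univ {Ω : Type} [Fintype Ω] [DecidableEq Ω] {u r : ℕ}
    (h : Ω → Fin u → Fin r) (S : Finset (Fin u)) : UniformOnOutside h S Finset.univ := by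
  intro v
  simp [prob]

lemma exists_uniformOnOutside_le_div {Ω : Type} [Fintype Ω] [DecidableEq Ω] {u r : ℕ}
    (h : Ω → Fin u → Fin r) (S : Finset (Fin u)) {a D : ℝ} (ha : 0 < a) (haD : a ≤ D) :
    ∃ B, prob B ≤ D / a ∧ UniformOnOutside h S B :=
  ⟨Finset.univ, (prob_le_one _).trans ((one_le_div ha).2 haD), uniformOnOutside_univ h S⟩

end UniformHashing

open UniformHashing in
theorem mainTheorem5_general {δ ε s : ℝ} (hδ : 0 < δ) (hδ1 : δ < 1) (hε : 0 < ε) (hs : -1 ≤ s) :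
    ∃ (D : ℝ) (n₀ : ℕ), ∀ n u r : ℕ, 1 ≤ n → 1 < r → r ≤ u →
      ∃ ds : HashDS u r (8 * Nat.clog 2 u),
        (∀ S : Finset (Fin u), S.card = n →
          ∃ B : Finset ds.Ω, prob B ≤ D / (n : ℝ) ^ (s + 1) ∧ UniformOnOutside ds.h S B) ∧
        (ds.time : ℝ) ≤ 120000 * (max s 1 / δ) ∧
        (ds.space : ℝ) ≤ 2 * (1 + ε) * n * Real.logb 2 r + D * Real.logb 2 (Real.logb 2 u) ∧
        (n₀ ≤ n → n ≤ u → BuiltFromZ ds n δ ε s D) := by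
  obtain ⟨D₀, n₀, hlarge⟩ := exists_hashDS_of_large hδ hδ1 hε (by linarith : -2 ≤ s)
  refine ⟨max D₀ ((n₀ : ℝ) ^ (s + 1)), n₀, fun n u r hn hr hru => ?_⟩
  have hlogr : 0 ≤ Real.logb 2 r := logb_two_nonneg (by exact_mod_cast hr)
  have hloglogu : 0 ≤ Real.logb 2 (Real.logb 2 u) :=
    logb_logb_two_nonneg (by exact_mod_cast hr.trans_le hru)
  by_cases h : n₀ ≤ n ∧ n ≤ u
  · obtain ⟨ds, herr, htime, hspace, hbuilt⟩ := hlarge _ (le_max_left _ _) n u r h.1 h.2 hr hru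
    exact ⟨ds, herr, htime, hspace, fun _ _ => hbuilt⟩
  · have : NeZero r := ⟨by omega⟩
    refine ⟨constDS u r _, fun S hS => ?_, ?_, ?_, fun h₁ h₂ => (h ⟨h₁, h₂⟩).elim⟩
    · have hnu : n ≤ u := hS ▸ card_finset_fin_le S
      have hnn₀ : (n : ℝ) ≤ n₀ := by exact_mod_cast (by omega : n ≤ n₀)
      exact exists_uniformOnOutside_le_div _ S (by positivity) (le_max_of_le_right
        (Real.rpow_le_rpow n.cast_nonneg hnn₀ (by linarith)))
    · rw [time_constDS, Nat.cast_one]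
      linarith [one_le_max_one_div hδ hδ1.le s]
    · rw [space_constDS, Nat.cast_zero]
      positivity

/-- Simulating uniform hashing for a universe of size `u` and a range of size `r`. The factors
`κ` (word length `κ⌈log₂ u⌉`) and `C` (evaluation time) are absolute; `D`, `g` and `n₀` depend
only on `δ`, `ε`, `s`. -/
theorem mainTheorem5 :
    ∃ κ C : ℕ, 0 < κ ∧
      ∀ δ ε s : ℝ, 0 < δ → δ < 1 → 0 < ε → 0 ≤ s →
        ∃ (D : ℝ) (g : ℕ → ℝ) (n₀ : ℕ),
          g =o[Filter.atTop] (fun n : ℕ => (n : ℝ)) ∧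
          ∀ n u r : ℕ, 1 ≤ n → 1 < r → r ≤ u →
            ∃ ds : UniformHashing.HashDS u r (κ * Nat.clog 2 u),
              (∀ S : Finset (Fin u), S.card = n →
                ∃ B : Finset ds.Ω,
                  UniformHashing.prob B ≤ D / (n : ℝ) ^ (s + 1) ∧
                  UniformHashing.UniformOnOutside ds.h S B) ∧
              (ds.time : ℝ) ≤ C * (max s 1 / δ) ∧
              (ds.space : ℝ) ≤ 2 * (1 + ε) * n * Real.logb 2 r + g n
                + D * Real.logb 2 (Real.logb 2 u) ∧
              (n₀ ≤ n → n ≤ u → UniformHashing.BuiltFromZ ds n δ ε s D) := by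
  refine ⟨8, 120000, by norm_num, fun δ ε s hδ hδ1 hε hs => ?_⟩
  obtain ⟨D, n₀, h⟩ := mainTheorem5_general hδ hδ1 hε (by linarith)
  exact ⟨D, 0, n₀, Asymptotics.isLittleO_zero _ _, by simpa using h⟩
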